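/- Write $q=e^{2\pi i\tau}$, $y=e^{2\pi i z}$ for $\tau\in\mathbb H$, $z\in\mathbb C$. For $k\in\mathbb Z$ and $t\in\frac12\mathbb Z$, a weak Jacobi form of weight $k$ and index $t$ is a holomorphic function $\phi:\mathbb H\times\mathbb C\to\mathbb C$ such that $$\phi\Bigl(\frac{a\tau+b}{c\tau+d},\frac z{c\tau+d}\Bigr)=(c\tau+d)^k e^{2\pi i t\frac{cz^2}{c\tau+d}}\phi(\tau,z)\quad\text{for all }\begin{pmatrix}a&b\\c&d\end{pmatrix}\in SL_2(\mathbb Z),$$ $$\phi(\tau,z+\lambda\tau+\mu)=(-1)^{2t(\lambda+\mu)}e^{-2\pi i t(\lambda^2\tau+2\lambda z)}\phi(\tau,z)\quad\text{for all }\lambda,\mu\in\mathbb Z,$$ and $\phi$ has a Fourier expansion $\phi(\tau,z)=\sum_{n\ge 0,\ l\in t+\mathbb Z}f(n,l)q^ny^l$. Let $J^{\mathbb Z}_{k,t}$ be the group of those forms all of whose Fourier coefficients $f(n,l)$ are integers. Let $$\vartheta(\tau,z)=\sum_{n\equiv 1\bmod 2}(-1)^{\frac{n-1}2}q^{\frac{n^2}8}y^{\frac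 n2},$$ let $\eta$ be the Dedekind eta function, $\Delta=\eta^{24}$, and put $$\phi_{0,\frac32}(\tau,z)=\frac{\vartheta(\tau,2z)}{\vartheta(\tau,z)},\qquad \phi_{-1,\frac12}(\tau,z)=\frac{\vartheta(\tau,z)}{\eta(\tau)^3},\qquad \xi_{0,6}(\tau,z)=\frac{\vartheta(\tau,z)^{12}}{\eta(\tau)^{12}},$$ where the quotient $\phi_{0,\frac32}$ has only removable singularities in $z$ and is extended by its limits there. **A.** For all $k,m\in\mathbb Z$, $$J^{\mathbb Z}_{2k,m+\frac12}=\phi_{0,\frac32}\cdot J^{\mathbb Z}_{2k,m-1},\qquad J^{\mathbb Z}_{2k+1,m+\frac12}=\phi_{-1,\frac12}\cdot J^{\mathbb Z}_{2k+2,m}.$$ **B.** Let $J^{\mathbb Z}_{0,*}=\bigoplus_{m\in\mathbb Z}J^{\mathbb Z}_{0,m}$ be the graded ring of integral weak Jacobi forms of weight $0$ and integral index, and let $J^{\mathbb Z}_{0,*}(q)=\bigoplus_{m\in\mathbb Z}J^{\mathbb Z}_{0,m}(q)$ be its homogeneous ideal, where $J^{\mathbb Z}_{0,m}(q)$ consists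 of the $\phi\in J^{\mathbb Z}_{0,m}$ without $q^0$-term, that is, with $f(0,l)=0$ for all $l$. Then $\xi_{0,6}\in J^{\mathbb Z}_{0,6}$, it satisfies $$\xi_{0,6}(\tau,z)=\Delta(\tau)\phi_{-1,\frac12}(\tau,z)^{12}=q(y^{\frac12}-y^{-\frac12})^{12}+q^2(\dots),$$ and the ideal $J^{\mathbb Z}_{0,*}(q)$ is principal, generated by $\xi_{0,6}$. -/

import Mathlib

open Filter Topology UpperHalfPlane
open scoped DirectSum MatrixGroups

namespace JacobiForms

/-- The monomial `q ^ n * y ^ (r / 2)`, where `q = exp (2 π i τ)` and `y = exp (2 π i z)`. -/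
noncomputable def qyMonomial (n : ℕ) (r : ℤ) (τ : ℍ) (z : ℂ) : ℂ :=
  Complex.exp (2 * Real.pi * Complex.I * (n * (τ : ℂ) + (r : ℂ) / 2 * z))

/-- `φ (τ, z) = ∑ a n r * q ^ n * y ^ (r / 2)`, the sum over all `n ≥ 0` and all `r / 2` in
`N / 2 + ℤ` (this is the Fourier expansion required of a weak Jacobi form of index `N / 2`). -/
def HasFourierExpansion (N : ℤ) (a : ℕ → ℤ → ℂ) (φ : ℍ → ℂ → ℂ) : Prop :=
  (∀ n r, a n r ≠ 0 → Even (r - N)) ∧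
    ∀ τ z, HasSum (fun p : ℕ × ℤ => a p.1 p.2 * qyMonomial p.1 p.2 τ z) (φ τ z)

/-- Weak Jacobi forms of integral weight `k` and index `N / 2` for `SL(2, ℤ)`, with trivial
character. The index is stored as the integer `N`, so that half-integral indices are allowed. -/
structure IsWeakJacobiForm (k N : ℤ) (φ : ℍ → ℂ → ℂ) : Prop where
  /-- `φ` is holomorphic, as a function of two variables. -/
  holo : DifferentiableOn ℂ (fun p : ℂ × ℂ => φ (ofComplex p.1) p.2) {p | 0 < p.1.im}
  modular : ∀ (γ : SL(2, ℤ)) (τ : ℍ) (z : ℂ),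
    φ (γ • τ) (z / ((γ 1 0 : ℂ) * τ + (γ 1 1 : ℂ))) =
      ((γ 1 0 : ℂ) * τ + (γ 1 1 : ℂ)) ^ k *
        Complex.exp (2 * Real.pi * Complex.I * ((N : ℂ) / 2) *
          ((γ 1 0 : ℂ) * z ^ 2 / ((γ 1 0 : ℂ) * τ + (γ 1 1 : ℂ)))) * φ τ z
  elliptic : ∀ (l m : ℤ) (τ : ℍ) (z : ℂ),
    φ τ (z + l * τ + m) =
      (-1) ^ (N * (l + m)) *
        Complex.exp (-(2 * Real.pi * Complex.I * ((N : ℂ) / 2) *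
          ((l : ℂ) ^ 2 * τ + 2 * l * z))) * φ τ z
  fourier : ∃ a : ℕ → ℤ → ℂ, HasFourierExpansion N a φ

/-- `φ` has a Fourier expansion (of the type of index `N / 2`) with integral coefficients. -/
def HasIntegralExpansion (N : ℤ) (a : ℕ → ℤ → ℤ) (φ : ℍ → ℂ → ℂ) : Prop :=
  HasFourierExpansion N (fun n r => (a n r : ℂ)) φ

lemma qyMonomial_add (n n' : ℕ) (r r' : ℤ) (τ : ℍ) (z : ℂ) :
    qyMonomial (n + n') (r + r') τ z = qyMonomial n r τ z * qyMonomial n' r' τ z := by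
  unfold qyMonomial
  rw [← Complex.exp_add]
  congr 1
  push_cast
  ring

lemma HasFourierExpansion.zero (N : ℤ) : HasFourierExpansion N (fun _ _ => 0) 0 :=
  ⟨fun _ _ h => absurd rfl h, fun τ z => by simp⟩

lemma HasFourierExpansion.add {N : ℤ} {a b : ℕ → ℤ → ℂ} {φ ψ : ℍ → ℂ → ℂ}
    (ha : HasFourierExpansion N a φ) (hb : HasFourierExpansion N b ψ) :
    HasFourierExpansion N (fun n r => a n r + b n r) (φ + ψ) := by
  refine ⟨fun n r h => ?_, fun τ z => ?_⟩
  · by_cases h' : a n r = 0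
    · exact hb.1 n r fun h'' => h (by simp [h', h''])
    · exact ha.1 n r h'
  · simpa [add_mul] using (ha.2 τ z).add (hb.2 τ z)

lemma HasFourierExpansion.neg {N : ℤ} {a : ℕ → ℤ → ℂ} {φ : ℍ → ℂ → ℂ}
    (ha : HasFourierExpansion N a φ) : HasFourierExpansion N (fun n r => -a n r) (-φ) :=
  ⟨fun n r h => ha.1 n r (by simpa using h), fun τ z => by simpa using (ha.2 τ z).neg⟩

lemma HasIntegralExpansion.zero (N : ℤ) : HasIntegralExpansion N (fun _ _ => 0) 0 := by
  simpa [HasIntegralExpansion] using HasFourierExpansion.zero N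

lemma HasIntegralExpansion.add {N : ℤ} {a b : ℕ → ℤ → ℤ} {φ ψ : ℍ → ℂ → ℂ}
    (ha : HasIntegralExpansion N a φ) (hb : HasIntegralExpansion N b ψ) :
    HasIntegralExpansion N (fun n r => a n r + b n r) (φ + ψ) := by
  simpa [HasIntegralExpansion] using HasFourierExpansion.add ha hb

lemma HasIntegralExpansion.neg {N : ℤ} {a : ℕ → ℤ → ℤ} {φ : ℍ → ℂ → ℂ}
    (ha : HasIntegralExpansion N a φ) : HasIntegralExpansion N (fun n r => -a n r) (-φ) := by
  simpa [HasIntegralExpansion] using HasFourierExpansion.neg ha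

/-- The product of two integral expansions: the coefficients are the (finite) convolutions. -/
lemma HasIntegralExpansion.mul {M N : ℤ} {a b : ℕ → ℤ → ℤ} {φ ψ : ℍ → ℂ → ℂ}
    (ha : HasIntegralExpansion M a φ) (hb : HasIntegralExpansion N b ψ) :
    ∃ c : ℕ → ℤ → ℤ, HasIntegralExpansion (M + N) c (φ * ψ) ∧
      ((∀ r, b 0 r = 0) → ∀ r, c 0 r = 0) := by
  let s : (ℕ × ℤ) × (ℕ × ℤ) → ℕ × ℤ := fun x => x.1 + x.2
  let g : (ℕ × ℤ) × (ℕ × ℤ) → ℤ := fun x => a x.1.1 x.1.2 * b x.2.1 x.2.2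
  let c : ℕ × ℤ → ℤ := fun t => ∑' x : {x // s x = t}, g x.1
  have key : ∀ n r, c (n, r) ≠ 0 → ∃ x, s x = (n, r) ∧ g x ≠ 0 := by
    intro n r h
    by_contra! h'
    exact h (by simp only [c]; rw [← tsum_zero]; exact tsum_congr fun x => h' x.1 x.2)
  refine ⟨fun n r => c (n, r), ⟨fun n r h => ?_, fun τ z => ?_⟩, fun h0 r => ?_⟩
  · obtain ⟨x, hx, hg⟩ := key n r (by simpa using h)
    have h1 := ha.1 x.1.1 x.1.2 (Int.cast_ne_zero.mpr (left_ne_zero_of_mul hg))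
    have h2 := hb.1 x.2.1 x.2.2 (Int.cast_ne_zero.mpr (right_ne_zero_of_mul hg))
    have h3 : x.1.2 + x.2.2 = r := congrArg Prod.snd hx
    have := h1.add h2
    rwa [sub_add_sub_comm, h3] at this
  · have h1 : HasSum (fun p : ℕ × ℤ => (a p.1 p.2 : ℂ) * qyMonomial p.1 p.2 τ z) (φ τ z) :=
      ha.2 τ z
    have h2 : HasSum (fun p : ℕ × ℤ => (b p.1 p.2 : ℂ) * qyMonomial p.1 p.2 τ z) (ψ τ z) :=
      hb.2 τ z
    have h3 := h1.mul h2 (summable_mul_of_summable_norm (f := fun p : ℕ × ℤ =>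
        (a p.1 p.2 : ℂ) * qyMonomial p.1 p.2 τ z) (g := fun p : ℕ × ℤ =>
        (b p.1 p.2 : ℂ) * qyMonomial p.1 p.2 τ z) h1.summable.norm h2.summable.norm)
    have h4 : HasSum (fun x : (ℕ × ℤ) × (ℕ × ℤ) => (g x : ℂ) * qyMonomial (s x).1 (s x).2 τ z)
        (φ τ z * ψ τ z) := by
      refine (congrArg (HasSum · _) (funext fun x => ?_)).mpr h3
      simp only [g, s, Prod.fst_add, Prod.snd_add, qyMonomial_add]
      push_cast
      ring
    have h5 := (Equiv.sigmaFiberEquiv s).hasSum_iff.mpr h4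
    refine h5.sigma fun t => ?_
    have h6 : Summable fun x : {x // s x = t} =>
        (g x.1 : ℂ) * qyMonomial t.1 t.2 τ z := by
      have := h4.summable.comp_injective (Subtype.val_injective (p := fun x => s x = t))
      refine this.congr fun x => ?_
      simp only [Function.comp_apply, x.2]
    have hne : qyMonomial t.1 t.2 τ z ≠ 0 := Complex.exp_ne_zero _
    have h7 : Summable fun x : {x // s x = t} => (g x.1 : ℂ) :=
      (summable_mul_right_iff hne).mp h6
    have h8 : (Function.support fun x : {x // s x = t} => g x.1).Finite := by
      have := (h7.tendsto_cofinite_zero.norm).eventually_lt_const (u := 1) (by simp)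
      rw [Filter.eventually_cofinite] at this
      refine this.subset fun x hx => ?_
      simp only [Set.mem_ofPred_eq, not_lt, Complex.norm_intCast]
      exact_mod_cast Int.one_le_abs hx
    have h9 : HasSum (fun x : {x // s x = t} => g x.1) (c t) :=
      (summable_of_hasFiniteSupport h8).hasSum
    have h10 := (h9.map (Int.castAddHom ℂ) continuous_of_discreteTopology).mul_right
      (qyMonomial t.1 t.2 τ z)
    refine (congrArg (HasSum · _) (funext fun x => ?_)).mpr h10
    obtain ⟨x, hx⟩ := x
    simp [Equiv.sigmaFiberEquiv, hx]
  · by_contra h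
    obtain ⟨x, hx, hg⟩ := key 0 r h
    have h3 : x.1.1 + x.2.1 = 0 := congrArg Prod.fst hx
    have h4 : x.2.1 = 0 := by omega
    exact hg (by simp [g, h4, h0])

/-- `JZ k N` is the group of weak Jacobi forms of weight `k` and index `N / 2` with integral
Fourier coefficients. -/
def JZ (k N : ℤ) : AddSubgroup (ℍ → ℂ → ℂ) where
  carrier := {φ | IsWeakJacobiForm k N φ ∧ ∃ a : ℕ → ℤ → ℤ, HasIntegralExpansion N a φ}
  zero_mem' := by
    refine ⟨⟨?_, ?_, ?_, ⟨_, .zero N⟩⟩, ⟨_, .zero N⟩⟩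
    · exact differentiableOn_const (0 : ℂ)
    · intros; simp
    · intros; simp
  add_mem' := by
    rintro φ ψ ⟨hφ, a, ha⟩ ⟨hψ, b, hb⟩
    refine ⟨⟨hφ.holo.add hψ.holo, fun γ τ z => ?_, fun l m τ z => ?_, _, ha.add hb⟩,
      _, HasIntegralExpansion.add ha hb⟩
    · simp only [Pi.add_apply, hφ.modular γ τ z, hψ.modular γ τ z, mul_add]
    · simp only [Pi.add_apply, hφ.elliptic l m τ z, hψ.elliptic l m τ z, mul_add]
  neg_mem' := by
    rintro φ ⟨hφ, a, ha⟩
    refine ⟨⟨hφ.holo.neg, fun γ τ z => ?_, fun l m τ z => ?_, _, ha.neg⟩,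
      _, HasIntegralExpansion.neg ha⟩
    · simp only [Pi.neg_apply, hφ.modular γ τ z, mul_neg]
    · simp only [Pi.neg_apply, hφ.elliptic l m τ z, mul_neg]

lemma one_mem_JZ : (1 : ℍ → ℂ → ℂ) ∈ JZ 0 0 := by
  have h : HasIntegralExpansion 0 (fun n r => if n = 0 ∧ r = 0 then 1 else 0) 1 := by
    refine ⟨fun n r h => ?_, fun τ z => ?_⟩
    · by_cases h' : n = 0 ∧ r = 0
      · simp [h'.2]
      · simp [h'] at h
    · convert hasSum_ite_eq ((0, 0) : ℕ × ℤ) (1 : ℂ) using 2 with p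
      · obtain ⟨n, r⟩ := p
        by_cases h' : n = 0 ∧ r = 0
        · simp [h'.1, h'.2, qyMonomial]
        · simp [h']
      · rfl
  refine ⟨⟨differentiableOn_const (1 : ℂ), ?_, ?_, _, h⟩, _, h⟩
  · intros; simp
  · intros; simp

lemma mul_mem_JZ {k k' M N : ℤ} {φ ψ : ℍ → ℂ → ℂ} (h₁ : φ ∈ JZ k M) (h₂ : ψ ∈ JZ k' N) :
    φ * ψ ∈ JZ (k + k') (M + N) := by
  obtain ⟨hφ, a, ha⟩ := h₁
  obtain ⟨hψ, b, hb⟩ := h₂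
  obtain ⟨c, hc, -⟩ := ha.mul hb
  refine ⟨⟨hφ.holo.mul hψ.holo, fun γ τ z => ?_, fun l m τ z => ?_, _, hc⟩, _, hc⟩
  · have hne : (γ 1 0 : ℂ) * τ + (γ 1 1 : ℂ) ≠ 0 := by
      simpa [ModularGroup.denom_apply] using denom_ne_zero (γ : GL (Fin 2) ℝ) τ
    simp only [Pi.mul_apply, hφ.modular γ τ z, hψ.modular γ τ z, zpow_add₀ hne]
    rw [show ((M + N : ℤ) : ℂ) / 2 = (M : ℂ) / 2 + (N : ℂ) / 2 by push_cast; ring,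
      mul_add, add_mul, Complex.exp_add]
    ring
  · simp only [Pi.mul_apply, hφ.elliptic l m τ z, hψ.elliptic l m τ z]
    rw [show ((M + N : ℤ) : ℂ) / 2 = (M : ℂ) / 2 + (N : ℂ) / 2 by push_cast; ring,
      show 2 * Real.pi * Complex.I * ((M : ℂ) / 2 + (N : ℂ) / 2) *
          ((l : ℂ) ^ 2 * τ + 2 * l * z) =
        2 * Real.pi * Complex.I * ((M : ℂ) / 2) * ((l : ℂ) ^ 2 * τ + 2 * l * z) +
          2 * Real.pi * Complex.I * ((N : ℂ) / 2) * ((l : ℂ) ^ 2 * τ + 2 * l * z) by ring,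
      neg_add, Complex.exp_add, add_mul, zpow_add₀ (by norm_num)]
    ring

/-- The integral weak Jacobi forms of weight `0` and (integral) index `m`. -/
def JZ0 (m : ℤ) : AddSubgroup (ℍ → ℂ → ℂ) := JZ 0 (2 * m)

instance : SetLike.GradedMonoid JZ0 where
  one_mem := by simpa [JZ0] using one_mem_JZ
  mul_mem i j φ ψ h₁ h₂ := by
    have := mul_mem_JZ h₁ h₂
    rwa [add_zero, ← mul_add] at this

/-- The graded ring of the integral weak Jacobi forms of weight `0` and integral index:
the direct sum of all `JZ0 m`, multiplied as functions. -/
abbrev JZ0Ring : Type := ⨁ m : ℤ, JZ0 m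

/-- The Fourier expansion of `φ`, of the type of index `N / 2`, has no `q ^ 0`-term. -/
def NoQZeroTerm (N : ℤ) (φ : ℍ → ℂ → ℂ) : Prop :=
  ∃ a : ℕ → ℤ → ℤ, (∀ r, a 0 r = 0) ∧ HasIntegralExpansion N a φ

lemma NoQZeroTerm.zero (N : ℤ) : NoQZeroTerm N 0 := ⟨_, fun _ => rfl, .zero N⟩

lemma NoQZeroTerm.add {N : ℤ} {φ ψ : ℍ → ℂ → ℂ} (h₁ : NoQZeroTerm N φ) (h₂ : NoQZeroTerm N ψ) :
    NoQZeroTerm N (φ + ψ) := by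
  obtain ⟨a, ha, ha'⟩ := h₁
  obtain ⟨b, hb, hb'⟩ := h₂
  exact ⟨_, fun r => by simp [ha, hb], ha'.add hb'⟩

/-- The homogeneous ideal of the forms without `q ^ 0`-term: the sum over all `m` of the groups of
forms in `JZ0 m` without `q ^ 0`-term. -/
def noQZeroIdeal : Ideal JZ0Ring where
  carrier := {φ | ∀ m : ℤ, NoQZeroTerm (2 * m) (φ m : ℍ → ℂ → ℂ)}
  zero_mem' m := NoQZeroTerm.zero _
  add_mem' h₁ h₂ m := by simpa using (h₁ m).add (h₂ m)
  smul_mem' c φ h m := by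
    classical
    rw [smul_eq_mul, DirectSum.coe_mul_apply]
    refine Finset.sum_induction _ (NoQZeroTerm (2 * m)) (fun _ _ => NoQZeroTerm.add)
      (NoQZeroTerm.zero _) fun ij hij => ?_
    obtain ⟨-, a, ha⟩ := (c ij.1).2
    obtain ⟨b, hb, hb'⟩ := h ij.2
    obtain ⟨d, hd, hd'⟩ := ha.mul hb'
    rw [← mul_add, (Finset.mem_filter.mp hij).2] at hd
    exact ⟨d, hd' hb, hd⟩

/-- The Jacobi theta-series: the sum of `(-1) ^ ((n - 1) / 2) * q ^ (n ^ 2 / 8) * y ^ (n / 2)` over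
all odd integers `n`, written here as `n = 2 * j + 1`. -/
noncomputable def theta (τ : ℍ) (z : ℂ) : ℂ :=
  ∑' j : ℤ, (-1 : ℂ) ^ j *
    Complex.exp (2 * Real.pi * Complex.I *
      (((2 * j + 1 : ℤ) : ℂ) ^ 2 / 8 * (τ : ℂ) + ((2 * j + 1 : ℤ) : ℂ) / 2 * z))

/-- `φ_{0, 3/2} (τ, z) = ϑ (τ, 2 z) / ϑ (τ, z)`; as the quotient has removable singularities at the
zeros of `ϑ (τ, ·)`, its value at each point is the limit there. -/
noncomputable def phiZeroThreeHalves (τ : ℍ) (z : ℂ) : ℂ :=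
  limUnder (𝓝[≠] z) fun w => theta τ (2 * w) / theta τ w

/-- `φ_{-1, 1/2} (τ, z) = ϑ (τ, z) / η (τ) ^ 3`. -/
noncomputable def phiNegOneHalf (τ : ℍ) (z : ℂ) : ℂ :=
  theta τ z / ModularForm.eta τ ^ 3

/-- `ξ_{0, 6} (τ, z) = ϑ (τ, z) ^ 12 / η (τ) ^ 12`. -/
noncomputable def xiZeroSix (τ : ℍ) (z : ℂ) : ℂ :=
  theta τ z ^ 12 / ModularForm.eta τ ^ 12

end JacobiForms

/-!
The whole statement reduces to divisibility of Jacobi forms by `φ_{-1, 1/2} = ϑ / η ^ 3`, whose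
zeros in `z` are the points of `ℤ τ + ℤ`, all of them simple.

* *Theta.* `φ_{-1, 1/2}` is an integral weak Jacobi form of weight `-1` and index `1 / 2`, with
  `q ^ 0`-term `y ^ (1 / 2) - y ^ (-1 / 2)` (`phiNegOneHalf_mem_JZ`): the transformation laws come
  from those of `jacobiTheta₂` and `η`, and `η ^ (-3)` is expanded by means of the pentagonal number
  series. Its zeros are found by comparison with the infinite product `thetaProduct`: the quotient
  is entire and doubly periodic, hence constant (`exists_phiNegOneHalf_eq_mul_thetaProduct`).
* *Division.* Let `φ` and `ψ` be integral weak Jacobi forms such that `φ` vanishes at the zeros of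
  `ψ`, which are simple, and let the `q ^ 0`-term of `ψ` be `y ^ (s / 2) - y ^ (-s / 2)`. Then
  `φ / ψ` is an integral weak Jacobi form (`exists_eq_mul_of_hasSimpleLinearZeros`). Formally, the
  expansions can be divided over `ℤ` because each coefficient of `φ` and `ψ` vanishes where
  `y ^ (s / 2) - y ^ (-s / 2)` does and the quotient of `ψ` by this factor is invertible
  (`exists_hasExpansion_extendedQuotient`). Analytically, the formal quotient converges to `φ / ψ`
  by Cauchy's estimates off `|y| = 1` (`HasExpansion.of_mul_eq`).

This is applied with `s = 1` to `φ_{-1, 1/2}`, which divides every form that vanishes at `z = 0`,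
and with `s = 2` to `φ_{-1, 1/2} (τ, 2 z) = φ_{-1, 1/2} * φ_{0, 3/2}`, which divides every form of
odd weight and integral index, as such a form vanishes at all half-periods. A form of odd weight
vanishes at `z = 0`, so it is a multiple of `φ_{-1, 1/2}` (`JZ_odd_eq`). For `φ` of even weight and
half-integral index, `φ_{-1, 1/2} * φ` is a multiple of `φ_{-1, 1/2} (τ, 2 z)`, so `φ` is a multiple
of `φ_{0, 3/2}` (`JZ_even_eq`).

Finally, a form of weight `0` without `q ^ 0`-term is `Δ` times a form of weight `-12`. At `z = 0`
a form of negative weight restricts to a modular form of negative weight, which is zero. So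
`φ_{-1, 1/2}` can be divided out twelve times, and the original form is a multiple of
`ξ_{0, 6} = Δ * φ_{-1, 1/2} ^ 12` (`exists_eq_mul_xiZeroSix`).
-/

namespace JacobiForms

open scoped Manifold
open LaurentPolynomial (T)

/-! ### Double series in `q` and `y` -/

/-- The coefficients `c n r` decay so fast that `∑ c n r * q ^ n * y ^ (r / 2)` converges absolutely
for all `(τ, z) ∈ ℍ × ℂ`: they are `O (exp (s * n - b * |r|))` for all `s > 0` and all `b`. -/
def RapidDecay (c : ℕ → ℤ → ℂ) : Prop :=
  ∀ s > 0, ∀ b : ℝ, ∃ M, ∀ n r, ‖c n r‖ ≤ M * Real.exp (s * n - b * |(r : ℝ)|)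

/-- The function `qyMonomial` with both variables complex. -/
noncomputable def expMonomial (n : ℕ) (r : ℤ) (p : ℂ × ℂ) : ℂ :=
  Complex.exp (2 * Real.pi * Complex.I * (n * p.1 + (r : ℂ) / 2 * p.2))

/-- The sum of the double series with coefficients `c`. -/
noncomputable def expSum (c : ℕ → ℤ → ℂ) (p : ℂ × ℂ) : ℂ :=
  ∑' k : ℕ × ℤ, c k.1 k.2 * expMonomial k.1 k.2 p

lemma qyMonomial_eq (n : ℕ) (r : ℤ) (τ : ℍ) (z : ℂ) :
    qyMonomial n r τ z = expMonomial n r (τ, z) := rfl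

lemma norm_expMonomial (n : ℕ) (r : ℤ) (p : ℂ × ℂ) :
    ‖expMonomial n r p‖ = Real.exp (-(2 * Real.pi * n * p.1.im) - Real.pi * r * p.2.im) := by
  rw [expMonomial, Complex.norm_exp]
  congr 1
  have h : ((r : ℂ) / 2 * p.2) = ((r / 2 : ℝ) : ℂ) * p.2 := by push_cast; ring
  rw [h, show (2 * Real.pi * Complex.I * (n * p.1 + ((r / 2 : ℝ) : ℂ) * p.2)) =
    ((2 * Real.pi : ℝ) : ℂ) * (((n : ℝ) : ℂ) * p.1 + ((r / 2 : ℝ) : ℂ) * p.2) * Complex.I by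
      push_cast; ring, Complex.mul_I_re, Complex.im_ofReal_mul, Complex.add_im,
      Complex.im_ofReal_mul, Complex.im_ofReal_mul]
  ring

lemma summable_exp_neg_nat_abs {a : ℝ} (ha : 0 < a) :
    Summable fun k : ℕ × ℤ => Real.exp (-(a * k.1) - |(k.2 : ℝ)|) := by
  have h1 : Summable fun n : ℕ => Real.exp (-(a * n)) := by
    simpa [mul_comm] using Real.summable_exp_nat_mul_of_ge (c := -a) (f := fun n : ℕ => (n : ℝ))
      (by linarith) fun _ => le_rfl
  have h2 : Summable fun r : ℤ => Real.exp (-|(r : ℝ)|) := by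
    have h : Summable fun n : ℕ => Real.exp (-(n : ℝ)) := Real.summable_exp_neg_nat
    apply Summable.of_nat_of_neg
    · simpa using h
    · simpa using h
  refine (h1.mul_of_nonneg h2 (fun _ => (Real.exp_pos _).le) (fun _ => (Real.exp_pos _).le)).congr
    fun k => ?_
  rw [← Real.exp_add]; ring_nf

namespace RapidDecay

variable {c : ℕ → ℤ → ℂ}

lemma nat_mul (hc : RapidDecay c) : RapidDecay fun n r => n * c n r := by
  intro s hs b
  obtain ⟨M, hM⟩ := hc (s / 2) (by positivity) b
  refine ⟨2 / s * M, fun n r => ?_⟩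
  have hn : (n : ℝ) ≤ 2 / s * Real.exp (s / 2 * n) := by
    have := Real.add_one_le_exp (s / 2 * n)
    calc (n : ℝ) = 2 / s * (s / 2 * n) := by field_simp
      _ ≤ _ := by gcongr; linarith
  rw [norm_mul, Complex.norm_natCast]
  calc (n : ℝ) * ‖c n r‖ ≤
      (2 / s * Real.exp (s / 2 * n)) * (M * Real.exp (s / 2 * n - b * |(r : ℝ)|)) := by
        gcongr; exact hM n r
    _ = 2 / s * M * (Real.exp (s / 2 * n) * Real.exp (s / 2 * n - b * |(r : ℝ)|)) := by ring
    _ = _ := by rw [← Real.exp_add]; ring_nf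

lemma int_mul (hc : RapidDecay c) : RapidDecay fun n r => r * c n r := by
  intro s hs b
  obtain ⟨M, hM⟩ := hc s hs (b + 1)
  refine ⟨M, fun n r => ?_⟩
  have hn : |(r : ℝ)| ≤ Real.exp |(r : ℝ)| := by
    have := Real.add_one_le_exp |(r : ℝ)|
    linarith
  rw [norm_mul, Complex.norm_intCast]
  calc |(r : ℝ)| * ‖c n r‖ ≤
      Real.exp |(r : ℝ)| * (M * Real.exp (s * n - (b + 1) * |(r : ℝ)|)) := by
        gcongr; exact hM n r
    _ = M * (Real.exp |(r : ℝ)| * Real.exp (s * n - (b + 1) * |(r : ℝ)|)) := by ring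
    _ = _ := by rw [← Real.exp_add]; ring_nf

/-- The locally uniform bound by which all series below are dominated. -/
lemma exists_bound (hc : RapidDecay c) {T : ℝ} (hT : 0 < T) (B : ℝ) :
    ∃ M, ∀ n r (p : ℂ × ℂ), T < p.1.im → |p.2.im| < B →
      ‖c n r * expMonomial n r p‖ ≤ M * Real.exp (-(Real.pi * T * n) - |(r : ℝ)|) := by
  obtain ⟨M, hM⟩ := hc (Real.pi * T) (by positivity) (Real.pi * B + 1)
  have hM0 : 0 ≤ M := by
    have := (norm_nonneg _).trans (hM 0 0)
    simpa using this
  refine ⟨M, fun n r p h1 h2 => ?_⟩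
  rw [norm_mul, norm_expMonomial]
  have h3 : -(Real.pi * r * p.2.im) ≤ Real.pi * (|(r : ℝ)| * B) := by
    rw [mul_assoc, ← mul_neg]
    gcongr
    calc -(r * p.2.im) ≤ |(r : ℝ) * p.2.im| := neg_le_abs _
      _ = |(r : ℝ)| * |p.2.im| := abs_mul _ _
      _ ≤ _ := by gcongr
  have h4 : Real.pi * n * T ≤ Real.pi * n * p.1.im := by gcongr
  calc ‖c n r‖ * Real.exp (-(2 * Real.pi * n * p.1.im) - Real.pi * r * p.2.im) ≤
      (M * Real.exp (Real.pi * T * n - (Real.pi * B + 1) * |(r : ℝ)|)) *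
        Real.exp (-(2 * Real.pi * n * p.1.im) - Real.pi * r * p.2.im) := by
        gcongr; exact hM n r
    _ = M * Real.exp ((Real.pi * T * n - (Real.pi * B + 1) * |(r : ℝ)|) +
          (-(2 * Real.pi * n * p.1.im) - Real.pi * r * p.2.im)) := by
        rw [Real.exp_add]; ring
    _ ≤ _ := by
        gcongr
        nlinarith

lemma summable (hc : RapidDecay c) {p : ℂ × ℂ} (hp : 0 < p.1.im) :
    Summable fun k : ℕ × ℤ => c k.1 k.2 * expMonomial k.1 k.2 p := by
  obtain ⟨M, hM⟩ := hc.exists_bound (half_pos hp) (|p.2.im| + 1)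
  refine Summable.of_norm_bounded
    ((summable_exp_neg_nat_abs (a := Real.pi * (p.1.im / 2)) (by positivity)).mul_left M)
    fun k => hM k.1 k.2 p (by linarith) (by linarith)

lemma hasFDerivAt (hc : RapidDecay c) {p : ℂ × ℂ} (hp : 0 < p.1.im) :
    HasFDerivAt (expSum c)
      ((2 * Real.pi * Complex.I * expSum (fun n r => n * c n r) p) • ContinuousLinearMap.fst ℂ ℂ ℂ +
        (Real.pi * Complex.I * expSum (fun n r => r * c n r) p) •
          ContinuousLinearMap.snd ℂ ℂ ℂ) p := by
  set T := p.1.im / 2 with hT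
  have hT0 : 0 < T := half_pos hp
  set B := |p.2.im| + 1
  obtain ⟨M₁, hM₁⟩ := hc.nat_mul.exists_bound hT0 B
  obtain ⟨M₂, hM₂⟩ := hc.int_mul.exists_bound hT0 B
  let s : Set (ℂ × ℂ) := {x : ℂ | T < x.im} ×ˢ {x : ℂ | |x.im| < B}
  have hs : IsOpen s := (isOpen_lt continuous_const Complex.continuous_im).prod
    (isOpen_lt (Complex.continuous_im.abs) continuous_const)
  have hs' : IsPreconnected s := by
    refine (Convex.isPreconnected (convex_halfSpace_im_gt T)).prod ?_
    have : {x : ℂ | |x.im| < B} = {x : ℂ | x.im < B} ∩ {x : ℂ | -B < x.im} := by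
      ext x; simp [abs_lt, and_comm]
    rw [this]
    exact ((convex_halfSpace_im_lt B).inter (convex_halfSpace_im_gt (-B))).isPreconnected
  let f' : ℕ × ℤ → ℂ × ℂ → (ℂ × ℂ →L[ℂ] ℂ) := fun k x =>
    (2 * Real.pi * Complex.I * (k.1 * c k.1 k.2 * expMonomial k.1 k.2 x)) •
        ContinuousLinearMap.fst ℂ ℂ ℂ +
      (Real.pi * Complex.I * (k.2 * c k.1 k.2 * expMonomial k.1 k.2 x)) •
          ContinuousLinearMap.snd ℂ ℂ ℂ
  have hu := (summable_exp_neg_nat_abs (a := Real.pi * T) (by positivity)).mul_left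
    (2 * Real.pi * M₁ + Real.pi * M₂)
  have hps : p ∈ s := by
    constructor
    · change T < p.1.im; linarith
    · change |p.2.im| < |p.2.im| + 1; linarith
  have key := hasFDerivAt_tsum_of_isPreconnected (𝕜 := ℂ)
    (f := fun (k : ℕ × ℤ) x => c k.1 k.2 * expMonomial k.1 k.2 x) (f' := f') hu hs hs'
    (fun k x _ => ?_) (fun k x hx => ?_) hps (hc.summable hp) hps
  · refine key.congr_fderiv ?_
    have h1 := (hc.nat_mul.summable hp).hasSum
    have h2 := (hc.int_mul.summable hp).hasSum
    exact (((h1.mul_left (2 * Real.pi * Complex.I)).smul_const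
      (ContinuousLinearMap.fst ℂ ℂ ℂ)).add ((h2.mul_left (Real.pi * Complex.I)).smul_const
      (ContinuousLinearMap.snd ℂ ℂ ℂ))).tsum_eq
  · have h1 : HasFDerivAt (fun x : ℂ × ℂ =>
        2 * Real.pi * Complex.I * (k.1 * x.1 + (k.2 : ℂ) / 2 * x.2))
        ((2 * Real.pi * Complex.I) • ((k.1 : ℂ) • ContinuousLinearMap.fst ℂ ℂ ℂ +
          ((k.2 : ℂ) / 2) • ContinuousLinearMap.snd ℂ ℂ ℂ)) x :=
      ((hasFDerivAt_fst.const_mul _).add (hasFDerivAt_snd.const_mul _)).const_mul _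
    have h2 := (h1.cexp).const_mul (c k.1 k.2)
    refine h2.congr_fderiv ?_
    ext <;> simp [f', expMonomial] <;> ring
  · have hM₁' := hM₁ k.1 k.2 x hx.1 hx.2
    have hM₂' := hM₂ k.1 k.2 x hx.1 hx.2
    calc ‖f' k x‖ ≤ ‖2 * Real.pi * Complex.I * (k.1 * c k.1 k.2 * expMonomial k.1 k.2 x)‖ * 1 +
        ‖Real.pi * Complex.I * (k.2 * c k.1 k.2 * expMonomial k.1 k.2 x)‖ * 1 := by
          refine (norm_add_le _ _).trans ?_
          rw [norm_smul, norm_smul]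
          gcongr
          · exact ContinuousLinearMap.norm_fst_le _ _ _
          · exact ContinuousLinearMap.norm_snd_le _ _ _
      _ = 2 * Real.pi * ‖k.1 * c k.1 k.2 * expMonomial k.1 k.2 x‖ +
          Real.pi * ‖k.2 * c k.1 k.2 * expMonomial k.1 k.2 x‖ := by
          rw [norm_mul (2 * Real.pi * Complex.I), norm_mul (Real.pi * Complex.I)]
          simp [abs_of_pos Real.pi_pos]
      _ ≤ 2 * Real.pi * (M₁ * Real.exp (-(Real.pi * T * k.1) - |(k.2 : ℝ)|)) +
          Real.pi * (M₂ * Real.exp (-(Real.pi * T * k.1) - |(k.2 : ℝ)|)) := by gcongr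
      _ = _ := by ring

lemma differentiableOn (hc : RapidDecay c) :
    DifferentiableOn ℂ (expSum c) {p | 0 < p.1.im} := fun _ hp =>
  (hc.hasFDerivAt hp).differentiableAt.differentiableWithinAt

lemma continuousAt (hc : RapidDecay c) {p : ℂ × ℂ} (hp : 0 < p.1.im) :
    ContinuousAt (expSum c) p := (hc.hasFDerivAt hp).continuousAt

lemma hasStrictFDerivAt (hc : RapidDecay c) {p : ℂ × ℂ} (hp : 0 < p.1.im) :
    HasStrictFDerivAt (expSum c)
      ((2 * Real.pi * Complex.I * expSum (fun n r => n * c n r) p) • ContinuousLinearMap.fst ℂ ℂ ℂ +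
        (Real.pi * Complex.I * expSum (fun n r => r * c n r) p) •
          ContinuousLinearMap.snd ℂ ℂ ℂ) p := by
  have hopen : IsOpen {p : ℂ × ℂ | 0 < p.1.im} :=
    isOpen_lt continuous_const (Complex.continuous_im.comp continuous_fst)
  refine hasStrictFDerivAt_of_hasFDerivAt_of_continuousAt (f' := fun p =>
    (2 * Real.pi * Complex.I * expSum (fun n r => n * c n r) p) • ContinuousLinearMap.fst ℂ ℂ ℂ +
        (Real.pi * Complex.I * expSum (fun n r => r * c n r) p) •
          ContinuousLinearMap.snd ℂ ℂ ℂ) ?_ ?_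
  · filter_upwards [hopen.mem_nhds hp] with x hx using hc.hasFDerivAt hx
  · exact ((hc.nat_mul.continuousAt hp).const_mul _ |>.smul continuousAt_const).add
      ((hc.int_mul.continuousAt hp).const_mul _ |>.smul continuousAt_const)

end RapidDecay

/-- Absolute convergence of the double series everywhere forces rapid decay: the terms are bounded
at the points `(i * s / (2 * π), ± i * b / π)`. -/
lemma rapidDecay_of_summable {c : ℕ → ℤ → ℂ}
    (h : ∀ (τ : ℍ) (z : ℂ), Summable fun k : ℕ × ℤ => c k.1 k.2 * qyMonomial k.1 k.2 τ z) :
    RapidDecay c := by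
  intro s hs b
  have key : ∀ b : ℝ, ∃ M, ∀ n r, ‖c n r‖ ≤ M * Real.exp (s * n - b * r) := by
    intro b
    let τ : ℍ := ⟨(s / (2 * Real.pi) : ℝ) * Complex.I, by
      simp only [Complex.mul_I_im, Complex.ofReal_re]; positivity⟩
    let z : ℂ := ((-b / Real.pi : ℝ) : ℂ) * Complex.I
    obtain ⟨M, hM⟩ := (h τ z).norm.tendsto_cofinite_zero.bddAbove_range_of_cofinite
    refine ⟨M, fun n r => ?_⟩
    have h1 : ‖c n r * qyMonomial n r τ z‖ ≤ M := hM ⟨(n, r), rfl⟩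
    rw [norm_mul, qyMonomial_eq, norm_expMonomial] at h1
    have h2 : (τ : ℂ).im = s / (2 * Real.pi) :=
      (Complex.mul_I_im _).trans (Complex.ofReal_re _)
    have h3 : z.im = -b / Real.pi := by simp [z]
    simp only [h2, h3] at h1
    rw [show -(2 * Real.pi * n * (s / (2 * Real.pi))) - Real.pi * r * (-b / Real.pi) =
      -(s * n - b * r) by field_simp; ring, Real.exp_neg, ← div_eq_mul_inv,
      div_le_iff₀ (Real.exp_pos _)] at h1
    exact h1
  obtain ⟨M₁, h₁⟩ := key b
  obtain ⟨M₂, h₂⟩ := key (-b)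
  refine ⟨max M₁ M₂, fun n r => ?_⟩
  rcases le_total 0 r with hr | hr
  · rw [abs_of_nonneg (by exact_mod_cast hr)]
    refine (h₁ n r).trans ?_
    gcongr; exact le_max_left _ _
  · rw [abs_of_nonpos (by exact_mod_cast hr)]
    refine (h₂ n r).trans ?_
    rw [show s * n - -b * (r : ℝ) = s * n - b * -(r : ℝ) by ring]
    gcongr; exact le_max_right _ _

/-! ### Integral expansions as power series over Laurent polynomials -/

/-- Evaluation of a Laurent polynomial in `y ^ (1 / 2)` at the point `y = exp (2 π i z)`. -/
noncomputable def evalExp (z : ℂ) : LaurentPolynomial ℤ →+* ℂ :=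
  (AddMonoidAlgebra.lift ℤ ℂ ℤ
    { toFun := fun r => Complex.exp (Real.pi * Complex.I * (Multiplicative.toAdd r : ℤ) * z)
      map_one' := by simp
      map_mul' := fun r s => by
        rw [← Complex.exp_add, toAdd_mul]; push_cast; ring_nf }).toRingHom

lemma evalExp_apply (z : ℂ) (p : LaurentPolynomial ℤ) :
    evalExp z p = p.coeff.sum fun r c => (c : ℂ) * Complex.exp (Real.pi * Complex.I * r * z) := by
  simp [evalExp, AddMonoidAlgebra.lift_apply]

lemma evalExp_T (z : ℂ) (r : ℤ) :
    evalExp z (LaurentPolynomial.T r) = Complex.exp (Real.pi * Complex.I * r * z) := by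
  rw [evalExp_apply, LaurentPolynomial.T]
  exact (Finsupp.sum_single_index (by simp)).trans (by simp)

lemma hasSum_evalExp (z : ℂ) (p : LaurentPolynomial ℤ) :
    HasSum (fun r : ℤ => (p.coeff r : ℂ) * Complex.exp (Real.pi * Complex.I * r * z))
      (evalExp z p) := by
  rw [evalExp_apply, Finsupp.sum]
  refine hasSum_sum_of_ne_finset_zero fun r hr => ?_
  rw [Finsupp.notMem_support_iff.mp hr]; simp

/-- Cauchy's estimate for the coefficients of a Laurent polynomial. -/
lemma norm_coeff_le_of_forall_evalExp (p : LaurentPolynomial ℤ) {b C : ℝ}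
    (h : ∀ x : ℝ, ‖evalExp (x + b * Complex.I) p‖ ≤ C) (r : ℤ) :
    ‖(p.coeff r : ℂ)‖ ≤ C * Real.exp (Real.pi * r * b) := by
  have horth : ∀ s : ℤ, ∫ x : ℝ in (0 : ℝ)..2,
      Complex.exp (Real.pi * Complex.I * s * (x + b * Complex.I)) *
        Complex.exp (-(Real.pi * Complex.I * r * (x + b * Complex.I))) =
      if s = r then 2 else 0 := by
    intro s
    split_ifs with hs
    · subst hs
      simp [← Complex.exp_add]
    · have hc : (Real.pi * Complex.I * (s - r) : ℂ) ≠ 0 := by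
        have : (s : ℂ) - r ≠ 0 := by
          rw [sub_ne_zero]; exact_mod_cast hs
        simp [Real.pi_ne_zero, this]
      have : ∀ x : ℝ, Complex.exp (Real.pi * Complex.I * s * (x + b * Complex.I)) *
          Complex.exp (-(Real.pi * Complex.I * r * (x + b * Complex.I))) =
          Complex.exp (Real.pi * Complex.I * (s - r) * (b * Complex.I)) *
            Complex.exp (Real.pi * Complex.I * (s - r) * x) := by
        intro x
        rw [← Complex.exp_add, ← Complex.exp_add]; ring_nf
      simp_rw [this]
      rw [intervalIntegral.integral_const_mul, integral_exp_mul_complex hc]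
      have h1 : Complex.exp (Real.pi * Complex.I * (s - r) * (2 : ℝ)) = 1 := by
        rw [show (Real.pi * Complex.I * (s - r) * (2 : ℝ) : ℂ) =
          ((s - r : ℤ) : ℂ) * (2 * Real.pi * Complex.I) by push_cast; ring]
        exact Complex.exp_int_mul_two_pi_mul_I _
      rw [h1]; simp
  have hint : ∫ x : ℝ in (0 : ℝ)..2, evalExp (x + b * Complex.I) p *
      Complex.exp (-(Real.pi * Complex.I * r * (x + b * Complex.I))) = 2 * p.coeff r := by
    simp_rw [evalExp_apply, Finsupp.sum, Finset.sum_mul, mul_assoc ((p.coeff _ : ℤ) : ℂ)]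
    rw [intervalIntegral.integral_finsetSum]
    · simp_rw [intervalIntegral.integral_const_mul, horth]
      rw [Finset.sum_eq_single r]
      · simp [mul_comm]
      · intro s _ hs; simp [hs]
      · intro hr; rw [Finsupp.notMem_support_iff.mp hr]; simp
    · intro s _
      exact Continuous.intervalIntegrable (by fun_prop) _ _
  have hnorm := intervalIntegral.norm_integral_le_of_norm_le_const (a := (0 : ℝ)) (b := 2)
    (C := C * Real.exp (Real.pi * r * b)) (f := fun x : ℝ => evalExp (x + b * Complex.I) p *
      Complex.exp (-(Real.pi * Complex.I * r * (x + b * Complex.I)))) fun x _ => by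
      rw [norm_mul, Complex.norm_exp]
      refine mul_le_mul (h x) (le_of_eq ?_) (Real.exp_pos _).le ((norm_nonneg _).trans (h x))
      congr 1
      simp [Complex.mul_re, Complex.mul_im]
  rw [hint, norm_mul] at hnorm
  norm_num at hnorm
  rw [Complex.norm_intCast]
  linarith

lemma evalExp_injective {p p' : LaurentPolynomial ℤ}
    (h : ∀ z : ℂ, z.im ≠ 0 → evalExp z p = evalExp z p') : p = p' := by
  rw [← sub_eq_zero]
  refine LaurentPolynomial.ext fun r => ?_
  have := norm_coeff_le_of_forall_evalExp (p - p') (b := 1) (C := 0)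
    (fun x => by rw [map_sub, h _ (by simp), sub_self, norm_zero]) r
  rw [zero_mul, norm_le_zero_iff] at this
  exact_mod_cast this

/-- Functions on `ℍ` which have a Taylor expansion in `q`: holomorphic, of period `1`, and bounded
at the cusp. -/
structure HasQExpansion (f : ℍ → ℂ) : Prop where
  periodic : Function.Periodic (f ∘ ofComplex) ((1 : ℝ) : ℂ)
  mdiff : MDiff f
  bdd : IsBoundedAtImInfty f

namespace HasQExpansion

variable {f g : ℍ → ℂ}

lemma analyticAt (hf : HasQExpansion f) : AnalyticAt ℂ (cuspFunction 1 f) 0 :=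
  analyticAt_cuspFunction_zero one_pos hf.periodic hf.mdiff hf.bdd

lemma hasSum (hf : HasQExpansion f) (τ : ℍ) :
    HasSum (fun n => (qExpansion 1 f).coeff n * Function.Periodic.qParam 1 τ ^ n) (f τ) :=
  hasSum_qExpansion one_pos hf.periodic hf.mdiff hf.bdd τ

lemma qExpansion_eq (hf : HasQExpansion f) {A : PowerSeries ℂ}
    (h : ∀ τ : ℍ, HasSum (fun n => A.coeff n * Function.Periodic.qParam 1 τ ^ n) (f τ)) :
    qExpansion 1 f = A := by
  have h1 := hasFPowerSeriesOnBall_cuspFunction one_pos hf.analyticAt (c := fun n => A.coeff n) h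
  have h2 := hasFPowerSeriesOnBall_cuspFunction one_pos hf.analyticAt
    (c := fun n => (qExpansion 1 f).coeff n) hf.hasSum
  ext n
  have h3 := h1.hasFPowerSeriesAt.eq_formalMultilinearSeries h2.hasFPowerSeriesAt
  have h4 := congrArg (fun s => FormalMultilinearSeries.coeff s n) h3
  simpa [FormalMultilinearSeries.coeff_ofScalars] using h4.symm

lemma qExpansion_mul (hf : HasQExpansion f) (hg : HasQExpansion g) :
    qExpansion 1 (f * g) = qExpansion 1 f * qExpansion 1 g :=
  UpperHalfPlane.qExpansion_mul hf.analyticAt hg.analyticAt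

lemma tendsto (hf : HasQExpansion f) : Tendsto f atImInfty (𝓝 ((qExpansion 1 f).coeff 0)) := by
  have h1 := hf.analyticAt.continuousAt.tendsto.comp (qParam_tendsto_atImInfty one_pos)
  rw [qExpansion_coeff]
  simpa [Function.comp_def, eq_cuspFunction _ one_ne_zero hf.periodic] using h1

/-- A quotient of two functions with a Taylor expansion in `q`, if it is holomorphic, has one too
when the constant term of the denominator does not vanish. -/
lemma of_mul_eq {h : ℍ → ℂ} (hf : HasQExpansion f) (hg : HasQExpansion g) (hfgh : f = g * h)
    (h0 : (qExpansion 1 g).coeff 0 ≠ 0) (hper : Function.Periodic (h ∘ ofComplex) ((1 : ℝ) : ℂ))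
    (hh : MDiff h) : HasQExpansion h := by
  refine ⟨hper, hh, ?_⟩
  have h1 : Tendsto (fun τ => f τ / g τ) atImInfty
      (𝓝 ((qExpansion 1 f).coeff 0 / (qExpansion 1 g).coeff 0)) := hf.tendsto.div hg.tendsto h0
  have h2 : Tendsto h atImInfty
      (𝓝 ((qExpansion 1 f).coeff 0 / (qExpansion 1 g).coeff 0)) := by
    refine h1.congr' ?_
    filter_upwards [hg.tendsto.eventually_ne h0] with τ hτ
    rw [hfgh, Pi.mul_apply, mul_div_cancel_left₀ _ hτ]
  exact h2.isBigO_one ℝ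

/-- Cauchy's estimate for the Taylor coefficients in `q`. -/
lemma norm_coeff_le (hf : HasQExpansion f) {t C : ℝ} (ht : 0 < t)
    (h : ∀ τ : ℍ, τ.im = t → τ.re ∈ Set.Icc (0 : ℝ) 1 → ‖f τ‖ ≤ C) (n : ℕ) :
    ‖(qExpansion 1 f).coeff n‖ ≤ C * Real.exp (2 * Real.pi * t * n) := by
  rw [qExpansion_coeff_eq_intervalIntegral one_pos hf.periodic hf.mdiff hf.bdd n ht]
  have := intervalIntegral.norm_integral_le_of_norm_le_const (a := (0 : ℝ)) (b := 1)
    (C := C * Real.exp (2 * Real.pi * t * n)) (f := fun u : ℝ =>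
      1 / Function.Periodic.qParam 1 (u + t * Complex.I) ^ n *
        f ⟨u + t * Complex.I, by simpa using ht⟩) fun u hu => by
    rw [Set.uIoc_of_le zero_le_one] at hu
    rw [norm_mul, mul_comm]
    refine mul_le_mul (h _ ?_ ?_) (le_of_eq ?_) (norm_nonneg _) ?_
    · simp [UpperHalfPlane.im]
    · simpa [UpperHalfPlane.re] using ⟨hu.1.le, hu.2⟩
    · rw [norm_div, norm_pow, Function.Periodic.norm_qParam, norm_one, one_div,
        ← Real.exp_nat_mul, ← Real.exp_neg]
      congr 1
      simp; ring
    · refine (norm_nonneg _).trans (h ⟨t * Complex.I, by simpa using ht⟩ ?_ ?_)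
      · simp [UpperHalfPlane.im]
      · simp [UpperHalfPlane.re]
  simpa using this

end HasQExpansion

/-- `F`, a power series in `q` whose coefficients are Laurent polynomials in `y ^ (1 / 2)` over
`ℤ`, is the Fourier expansion of `φ` (of the type of index `N / 2`). -/
def HasExpansion (N : ℤ) (F : PowerSeries (LaurentPolynomial ℤ)) (φ : ℍ → ℂ → ℂ) : Prop :=
  HasIntegralExpansion N (fun n r => (F.coeff n).coeff r) φ

/-- For each `n` only finitely many integral coefficients `a n r` are nonzero, so an integral
expansion is given by a power series of Laurent polynomials. -/
lemma HasIntegralExpansion.exists_hasExpansion {N : ℤ} {a : ℕ → ℤ → ℤ} {φ : ℍ → ℂ → ℂ}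
    (h : HasIntegralExpansion N a φ) :
    ∃ F : PowerSeries (LaurentPolynomial ℤ),
      (∀ n r, (F.coeff n).coeff r = a n r) ∧ HasExpansion N F φ := by
  have hfin : ∀ n, (Function.support (a n)).Finite := by
    intro n
    have h0 : Summable fun p : ℕ × ℤ => (a p.1 p.2 : ℂ) * qyMonomial p.1 p.2 I 0 :=
      (h.2 I 0).summable
    have h1 : Summable fun r : ℤ => (a n r : ℂ) * qyMonomial n r I 0 :=
      h0.comp_injective (i := fun r : ℤ => (n, r)) (Prod.mk_right_injective n)
    have h2 : ∀ r : ℤ, qyMonomial n r I 0 = qyMonomial n 0 I 0 := by simp [qyMonomial]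
    simp_rw [h2] at h1
    have h7 : Summable fun r : ℤ => (a n r : ℂ) :=
      (summable_mul_right_iff (Complex.exp_ne_zero _)).mp h1
    have := (h7.tendsto_cofinite_zero.norm).eventually_lt_const (u := 1) (by simp)
    rw [Filter.eventually_cofinite] at this
    refine this.subset fun x hx => ?_
    simp only [Set.mem_ofPred_eq, not_lt, Complex.norm_intCast]
    exact_mod_cast Int.one_le_abs hx
  let F : PowerSeries (LaurentPolynomial ℤ) := PowerSeries.mk fun n =>
    AddMonoidAlgebra.ofCoeff (Finsupp.ofSupportFinite (a n) (hfin n))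
  have hF : ∀ n r, (F.coeff n).coeff r = a n r := fun n r => by
    simp only [F, PowerSeries.coeff_mk]
    rfl
  refine ⟨F, hF, ?_⟩
  have : (fun n r => (F.coeff n).coeff r) = a := by ext n r; exact hF n r
  rw [HasExpansion, this]
  exact h

namespace HasExpansion

variable {N M : ℤ} {F G : PowerSeries (LaurentPolynomial ℤ)} {φ ψ : ℍ → ℂ → ℂ}

lemma rapidDecay (h : HasExpansion N F φ) :
    RapidDecay fun n r => ((F.coeff n).coeff r : ℂ) :=
  rapidDecay_of_summable fun τ z => (h.2 τ z).summable

lemma eq_expSum (h : HasExpansion N F φ) (τ : ℍ) (z : ℂ) :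
    φ τ z = expSum (fun n r => ((F.coeff n).coeff r : ℂ)) (τ, z) :=
  (h.2 τ z).tsum_eq.symm

lemma differentiableOn (h : HasExpansion N F φ) :
    DifferentiableOn ℂ (fun p : ℂ × ℂ => φ (ofComplex p.1) p.2) {p | 0 < p.1.im} := by
  refine h.rapidDecay.differentiableOn.congr fun p hp => ?_
  rw [h.eq_expSum, ofComplex_apply_of_im_pos hp]

lemma hasSum_evalExp (h : HasExpansion N F φ) (τ : ℍ) (z : ℂ) :
    HasSum (fun n => (PowerSeries.map (evalExp z) F).coeff n *
      Function.Periodic.qParam 1 τ ^ n) (φ τ z) := by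
  have h1 : HasSum (fun p : ℕ × ℤ => ((F.coeff p.1).coeff p.2 : ℂ) * qyMonomial p.1 p.2 τ z)
    (φ τ z) := h.2 τ z
  refine h1.prod_fiberwise fun n => ?_
  rw [PowerSeries.coeff_map]
  refine (congrArg (HasSum · _) (funext fun r => ?_)).mpr
    ((JacobiForms.hasSum_evalExp z (F.coeff n)).mul_right (Function.Periodic.qParam 1 τ ^ n))
  rw [mul_assoc, qyMonomial, Function.Periodic.qParam, ← Complex.exp_nat_mul, ← Complex.exp_add]
  congr 2
  push_cast
  ring

lemma hasQExpansion (h : HasExpansion N F φ) (z : ℂ) : HasQExpansion fun τ => φ τ z := by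
  refine ⟨fun w => ?_, ?_, isBoundedAtImInfty_of_hasSum_qExpansion one_pos
    fun τ => h.hasSum_evalExp τ z⟩
  · by_cases hw : 0 < w.im
    · have hw' : 0 < (w + (1 : ℝ)).im := by simpa using hw
      refine (h.hasSum_evalExp _ z).unique ?_
      change HasSum _ (φ (ofComplex w) z)
      convert h.hasSum_evalExp (ofComplex w) z using 4
      rw [ofComplex_apply_of_im_pos hw', ofComplex_apply_of_im_pos hw]
      simp only [Function.Periodic.qParam]
      rw [Complex.exp_eq_exp_iff_exists_int]
      exact ⟨1, by push_cast; ring⟩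
    · have hw' : ¬ 0 < (w + (1 : ℝ)).im := by simpa using hw
      simp only [Function.comp_apply]
      rw [ofComplex_apply_of_im_nonpos (not_lt.mp hw), ofComplex_apply_of_im_nonpos (not_lt.mp hw')]
  · rw [UpperHalfPlane.mdifferentiable_iff]
    exact h.differentiableOn.comp (f := fun w : ℂ => (w, z)) (by fun_prop) fun w hw => hw

lemma qExpansion_eq (h : HasExpansion N F φ) (z : ℂ) :
    qExpansion 1 (fun τ => φ τ z) = PowerSeries.map (evalExp z) F :=
  (h.hasQExpansion z).qExpansion_eq fun τ => h.hasSum_evalExp τ z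

end HasExpansion

lemma map_evalExp_injective {F G : PowerSeries (LaurentPolynomial ℤ)}
    (h : ∀ z, PowerSeries.map (evalExp z) F = PowerSeries.map (evalExp z) G) : F = G := by
  ext1 n
  refine evalExp_injective fun z _ => ?_
  simpa using congrArg (PowerSeries.coeff n) (h z)

namespace HasExpansion

variable {N M : ℤ} {F G : PowerSeries (LaurentPolynomial ℤ)} {φ ψ : ℍ → ℂ → ℂ}

lemma mul (hF : HasExpansion N F φ) (hG : HasExpansion M G ψ) :
    HasExpansion (N + M) (F * G) (φ * ψ) := by
  obtain ⟨c, hc, -⟩ := HasIntegralExpansion.mul hF hG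
  obtain ⟨H, -, hH⟩ := hc.exists_hasExpansion
  have : H = F * G := by
    refine map_evalExp_injective fun z => ?_
    rw [map_mul, ← hF.qExpansion_eq, ← hG.qExpansion_eq, ← hH.qExpansion_eq,
      ← (hF.hasQExpansion z).qExpansion_mul (hG.hasQExpansion z)]
    rfl
  rwa [← this]

lemma pow (hF : HasExpansion N F φ) (k : ℕ) : HasExpansion (k * N) (F ^ k) (φ ^ k) := by
  induction k with
  | zero =>
    obtain ⟨-, a, ha⟩ := one_mem_JZ
    obtain ⟨H, -, hH⟩ := ha.exists_hasExpansion
    have : H = 1 := map_evalExp_injective fun z => by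
      rw [map_one, ← hH.qExpansion_eq]
      exact qExpansion_one 1
    rwa [pow_zero, pow_zero, Nat.cast_zero, zero_mul, ← this]
  | succ k ih =>
    rw [pow_succ, pow_succ]
    convert ih.mul hF using 1
    push_cast; ring

lemma tendsto_atImInfty (hF : HasExpansion N F φ) (z : ℂ) :
    Tendsto (fun τ => φ τ z) atImInfty (𝓝 (evalExp z (F.coeff 0))) := by
  have := (hF.hasQExpansion z).tendsto
  rwa [hF.qExpansion_eq, PowerSeries.coeff_map] at this

end HasExpansion

/-! ### Division of integral expansions -/

lemma evalExp_toLaurent (z : ℂ) (f : Polynomial ℤ) :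
    evalExp z (Polynomial.toLaurent f) =
      Polynomial.aeval (Complex.exp (Real.pi * Complex.I * z)) f := by
  have : (evalExp z).comp Polynomial.toLaurent =
      (Polynomial.aeval (Complex.exp (Real.pi * Complex.I * z)) :
        Polynomial ℤ →ₐ[ℤ] ℂ).toRingHom := by
    refine Polynomial.ringHom_ext (fun a => by simp) ?_
    simp [evalExp_T]
  exact congrArg (fun g => g f) this

/-- A Laurent polynomial over `ℤ` in `w = y ^ (1 / 2)` which vanishes at the `2 s`-th roots of unity
is divisible by `w ^ s - w ^ (-s)`, over `ℤ`, since `w ^ (2 s) - 1` is monic and has simple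
roots. -/
lemma T_sub_T_dvd {s : ℕ} (hs : 0 < s) (p : LaurentPolynomial ℤ)
    (h : ∀ j : ℕ, evalExp ((j : ℂ) / s) p = 0) : (T (s : ℤ) - T (-(s : ℤ))) ∣ p := by
  obtain ⟨n, f, hf⟩ := p.exists_T_pow
  have hmonic : (Polynomial.X ^ (2 * s) - 1 : Polynomial ℤ).Monic :=
    Polynomial.monic_X_pow_sub_C 1 (by omega)
  have hw : ∀ j : ℕ, Complex.exp (Real.pi * Complex.I * ((j : ℂ) / s)) =
      Complex.exp (2 * Real.pi * Complex.I / (2 * s : ℕ)) ^ j := fun j => by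
    rw [← Complex.exp_nat_mul]
    congr 1
    push_cast
    field_simp
  have hprim := Complex.isPrimitiveRoot_exp (2 * s) (by omega)
  have hroot : ∀ j : ℕ, Polynomial.aeval (Complex.exp (Real.pi * Complex.I * ((j : ℂ) / s)))
      (f %ₘ (Polynomial.X ^ (2 * s) - 1)) = 0 := fun j => by
    have h1 : Polynomial.aeval (Complex.exp (Real.pi * Complex.I * ((j : ℂ) / s))) f = 0 := by
      rw [← evalExp_toLaurent, hf, map_mul, h, zero_mul]
    have h2 := Polynomial.modByMonic_add_div f (Polynomial.X ^ (2 * s) - 1)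
    rw [← h2] at h1
    simp only [map_add, map_mul, map_sub, map_pow, Polynomial.aeval_X, map_one] at h1
    have h3 : Complex.exp (Real.pi * Complex.I * ((j : ℂ) / s)) ^ (2 * s) = 1 := by
      rw [hw, ← pow_mul, mul_comm j, pow_mul, hprim.pow_eq_one, one_pow]
    rwa [h3, sub_self, zero_mul, add_zero] at h1
  have hzero : f %ₘ (Polynomial.X ^ (2 * s) - 1) = 0 := by
    rw [← Polynomial.map_eq_zero_iff (f := Int.castRingHom ℂ) Int.cast_injective]
    refine Polynomial.eq_zero_of_natDegree_lt_card_of_eval_eq_zero _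
      (f := fun j : Fin (2 * s) => Complex.exp (2 * Real.pi * Complex.I / (2 * s : ℕ)) ^ (j : ℕ))
      (fun i j hij => Fin.ext (hprim.pow_inj i.2 j.2 hij)) (fun j => ?_) ?_
    · have := hroot j
      rw [hw] at this
      rwa [Polynomial.aeval_def, Polynomial.eval₂_eq_eval_map] at this
    · rw [Fintype.card_fin]
      refine (Polynomial.natDegree_map_le).trans_lt ?_
      have h1 : (Polynomial.X ^ (2 * s) - 1 : Polynomial ℤ).natDegree = 2 * s :=
        Polynomial.natDegree_X_pow_sub_C
      have := Polynomial.natDegree_modByMonic_lt f hmonic (fun h => by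
        rw [h, Polynomial.natDegree_one] at h1; omega)
      omega
  have h3 := Polynomial.modByMonic_add_div f (Polynomial.X ^ (2 * s) - 1)
  rw [hzero, zero_add] at h3
  refine ⟨T (s : ℤ) * Polynomial.toLaurent (f /ₘ (Polynomial.X ^ (2 * s) - 1)) * T (-(n : ℤ)), ?_⟩
  have h4 : p = Polynomial.toLaurent f * T (-(n : ℤ)) := by
    rw [hf, mul_assoc, ← LaurentPolynomial.T_add, add_neg_cancel, LaurentPolynomial.T_zero, mul_one]
  have h5 : (T ((2 * s : ℕ) : ℤ) - 1 : LaurentPolynomial ℤ) =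
      (T (s : ℤ) - T (-(s : ℤ))) * T (s : ℤ) := by
    rw [sub_mul, ← LaurentPolynomial.T_add, ← LaurentPolynomial.T_add, neg_add_cancel,
      LaurentPolynomial.T_zero]
    push_cast
    rw [two_mul]
  rw [h4]
  conv_lhs => rw [← h3]
  rw [map_mul, map_sub, map_one, Polynomial.toLaurent_X_pow, h5]
  ring

/-- If `φ (τ, ·)` vanishes at all `j / s`, then so does each coefficient of a power of `q`, and
`y ^ (s / 2) - y ^ (-s / 2)` can be divided out of the whole expansion. -/
lemma HasExpansion.exists_eq_C_mul {N : ℤ} {F : PowerSeries (LaurentPolynomial ℤ)}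
    {φ : ℍ → ℂ → ℂ} (hF : HasExpansion N F φ) {s : ℕ} (hs : 0 < s)
    (h : ∀ (τ : ℍ) (j : ℕ), φ τ ((j : ℂ) / s) = 0) :
    ∃ F₁ : PowerSeries (LaurentPolynomial ℤ),
      F = PowerSeries.C (T (s : ℤ) - T (-(s : ℤ))) * F₁ := by
  have h1 : ∀ n, (T (s : ℤ) - T (-(s : ℤ))) ∣ F.coeff n := fun n => by
    refine T_sub_T_dvd hs _ fun j => ?_
    rw [← PowerSeries.coeff_map, ← hF.qExpansion_eq]
    simp_rw [h]
    have := qExpansion_zero 1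
    exact (congrArg (PowerSeries.coeff n) this).trans (map_zero _)
  choose g hg using h1
  refine ⟨PowerSeries.mk g, ?_⟩
  ext1 n
  rw [PowerSeries.coeff_C_mul, PowerSeries.coeff_mk, ← hg]

lemma evalExp_T_sub_T_ne_zero {s : ℕ} (hs : 0 < s) {z : ℂ} (hz : z.im ≠ 0) :
    evalExp z (T (s : ℤ) - T (-(s : ℤ))) ≠ 0 := by
  rw [map_sub, evalExp_T, evalExp_T, sub_ne_zero]
  intro h
  have h1 := congrArg norm h
  rw [Complex.norm_exp, Complex.norm_exp, Real.exp_eq_exp] at h1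
  have hs' : (0 : ℝ) < s := by exact_mod_cast hs
  have h2 : (Real.pi * s * z.im) = 0 := by
    simp [Complex.mul_re, Complex.mul_im] at h1
    linarith
  have := Real.pi_pos
  simp_all

lemma evalExp_add_one {K : ℤ} {p : LaurentPolynomial ℤ}
    (hp : ∀ r, p.coeff r ≠ 0 → Even (r - K)) (z : ℂ) :
    evalExp (z + 1) p = (-1) ^ K * evalExp z p := by
  rw [evalExp_apply, evalExp_apply, Finsupp.sum, Finsupp.sum, Finset.mul_sum]
  refine Finset.sum_congr rfl fun r hr => ?_
  have h1 : Complex.exp (Real.pi * Complex.I * r * (z + 1)) =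
      (-1) ^ K * Complex.exp (Real.pi * Complex.I * r * z) := by
    rw [mul_add, Complex.exp_add, mul_one, mul_comm ((-1 : ℂ) ^ K)]
    congr 1
    rw [mul_comm _ (r : ℂ), Complex.exp_int_mul, Complex.exp_pi_mul_I]
    obtain ⟨m, hm⟩ := hp r (Finsupp.mem_support_iff.mp hr)
    rw [show r = K + 2 * m by omega, zpow_add₀ (by norm_num), zpow_mul]
    norm_num
  rw [h1]; ring

/-- The parity of the exponents of `y ^ (1 / 2)` can be read off from the behaviour under
`z ↦ z + 1`. -/
lemma even_sub_of_evalExp_add_one {K : ℤ} {p : LaurentPolynomial ℤ}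
    (hp : ∀ z : ℂ, z.im ≠ 0 → evalExp (z + 1) p = (-1) ^ K * evalExp z p) (r : ℤ)
    (hr : p.coeff r ≠ 0) : Even (r - K) := by
  classical
  let p₀ : LaurentPolynomial ℤ :=
    AddMonoidAlgebra.ofCoeff (p.coeff.filter fun r => Even (r - K))
  let p₁ : LaurentPolynomial ℤ :=
    AddMonoidAlgebra.ofCoeff (p.coeff.filter fun r => ¬ Even (r - K))
  have hsum : p = p₀ + p₁ := LaurentPolynomial.ext fun a => by
    have := congrArg (fun q : ℤ →₀ ℤ => q a) (Finsupp.filter_add_filter_not p.coeff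
      fun r => Even (r - K))
    simpa [p₀, p₁] using this.symm
  have h0 : ∀ a, p₀.coeff a ≠ 0 → Even (a - K) := fun a ha => by
    by_contra h
    exact ha (by simp [p₀, h])
  have h1 : ∀ a, p₁.coeff a ≠ 0 → Even (a - (K + 1)) := fun a ha => by
    have : ¬ Even (a - K) := fun h => ha (by simp [p₁, h])
    rw [← sub_sub, Int.even_sub_one]
    exact this
  have h2 : p₁ = 0 := evalExp_injective fun z hz => by
    have h3 := hp z hz
    rw [hsum, map_add, map_add, evalExp_add_one h0, evalExp_add_one h1,
      zpow_add₀ (by norm_num)] at h3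
    have hne : ((-1 : ℂ)) ^ K ≠ 0 := zpow_ne_zero _ (by norm_num)
    have h4 : (-1 : ℂ) ^ K * evalExp z p₁ = 0 := by
      linear_combination (-1 / 2 : ℂ) * h3
    rw [map_zero]
    exact (mul_eq_zero.mp h4).resolve_left hne
  by_contra h
  refine hr ?_
  have : p₁.coeff r = p.coeff r := Finsupp.filter_apply_pos _ _ h
  rw [← this, h2]
  rfl

/-- Let `φ = ψ * χ`, where `φ` and `ψ` have integral expansions `F` and `G`, and `F = G * H`.
If `χ` is continuous, and holomorphic in `τ` for `z` off the real line, then `H` is the expansion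
of `χ`. The Cauchy estimates for `χ` on tori `|q| = R`, `|y| = ρ` with `ρ ≠ 1` give the convergence
of `H`, and its sum is `χ` for `|y| ≠ 1`, hence everywhere. -/
theorem HasExpansion.of_mul_eq {N M : ℤ} {F G H : PowerSeries (LaurentPolynomial ℤ)}
    {φ ψ χ : ℍ → ℂ → ℂ} (hF : HasExpansion N F φ) (hG : HasExpansion M G ψ) (hFGH : F = G * H)
    (hG0 : ∀ z : ℂ, z.im ≠ 0 → evalExp z (G.coeff 0) ≠ 0) (hφ : φ = ψ * χ)
    (hcont : ContinuousOn (fun p : ℂ × ℂ => χ (ofComplex p.1) p.2) {p | 0 < p.1.im})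
    (hper : ∀ z, Function.Periodic ((fun τ => χ τ z) ∘ ofComplex) ((1 : ℝ) : ℂ))
    (hdiff : ∀ z : ℂ, z.im ≠ 0 → MDiff fun τ => χ τ z) : HasExpansion (N - M) H χ := by
  have hGz : ∀ z : ℂ, z.im ≠ 0 → PowerSeries.map (evalExp z) G ≠ 0 := fun z hz h => hG0 z hz <| by
    rw [← PowerSeries.coeff_map, h, map_zero]
  have hq : ∀ z : ℂ, z.im ≠ 0 → HasQExpansion fun τ => χ τ z := fun z hz => by
    refine (hF.hasQExpansion z).of_mul_eq (hG.hasQExpansion z) ?_ ?_ (hper z) (hdiff z hz)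
    · ext τ; simp [hφ]
    · rw [hG.qExpansion_eq, PowerSeries.coeff_map]; exact hG0 z hz
  have hqH : ∀ z : ℂ, z.im ≠ 0 →
      qExpansion 1 (fun τ => χ τ z) = PowerSeries.map (evalExp z) H := fun z hz => by
    have h1 := (hG.hasQExpansion z).qExpansion_mul (hq z hz)
    have h2 : (fun τ => ψ τ z) * (fun τ => χ τ z) = fun τ => φ τ z := by ext τ; simp [hφ]
    rw [h2, hF.qExpansion_eq, hG.qExpansion_eq, hFGH, map_mul] at h1
    exact (mul_left_cancel₀ (hGz z hz) h1).symm
  have hcontτ : ∀ τ : ℍ, Continuous (χ τ) := fun τ => by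
    have h1 : ContinuousOn (fun z : ℂ => χ (ofComplex (τ : ℂ)) z) Set.univ :=
      hcont.comp (f := fun z : ℂ => ((τ : ℂ), z)) (by fun_prop) fun z _ => τ.2
    rwa [ofComplex_apply, continuousOn_univ] at h1
  -- Cauchy's estimates on the torus `|q| = exp (-s)`, `|y| = exp (-2 π b)`
  have key : ∀ s > 0, ∀ b : ℝ, b ≠ 0 → ∃ C, ∀ n r,
      ‖((H.coeff n).coeff r : ℂ)‖ ≤ C * Real.exp (s * n) * Real.exp (Real.pi * r * b) := by
    intro s hs b hb
    have ht : 0 < s / (2 * Real.pi) := by positivity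
    let g : ℝ × ℝ → ℂ × ℂ := fun u =>
      (u.1 + (s / (2 * Real.pi) : ℝ) * Complex.I, u.2 + b * Complex.I)
    have hK : IsCompact (g '' (Set.Icc (0 : ℝ) 1 ×ˢ Set.Icc (0 : ℝ) 2)) :=
      (isCompact_Icc.prod isCompact_Icc).image (by fun_prop)
    obtain ⟨C, hC⟩ := hK.exists_bound_of_continuousOn (hcont.mono (by
      rintro - ⟨u, -, rfl⟩
      change 0 < (u.1 + (s / (2 * Real.pi) : ℝ) * Complex.I).im
      rw [Complex.add_im, Complex.mul_I_im, Complex.ofReal_re, Complex.ofReal_im, zero_add]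
      exact ht))
    refine ⟨C, fun n r => ?_⟩
    refine norm_coeff_le_of_forall_evalExp _ (fun x => ?_) r
    obtain ⟨y, hy, hxy⟩ := (Function.Periodic.exists_mem_Ico₀ (c := (2 : ℝ))
      (f := fun x : ℝ => evalExp (x + b * Complex.I) (H.coeff n)) (fun x => by
        have : ((x + 2 : ℝ) : ℂ) + b * Complex.I = x + b * Complex.I + 2 := by push_cast; ring
        simp only [this, evalExp_apply]
        refine Finsupp.sum_congr fun r _ => ?_
        rw [mul_add (Real.pi * Complex.I * r), Complex.exp_add,
          show (Real.pi * Complex.I * r * 2 : ℂ) = r * (2 * Real.pi * Complex.I) by ring,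
          Complex.exp_int_mul_two_pi_mul_I, mul_one]) two_pos x)
    change evalExp (x + b * Complex.I) (H.coeff n) = _ at hxy
    have him : (y + b * Complex.I).im ≠ 0 := by simpa using hb
    rw [hxy, ← PowerSeries.coeff_map, ← hqH _ him]
    refine ((hq _ him).norm_coeff_le ht (C := C) (fun τ hτ hτ' => ?_) n).trans (le_of_eq ?_)
    · have := hC (g (τ.re, y)) ⟨(τ.re, y), ⟨hτ', Set.Ico_subset_Icc_self hy⟩, rfl⟩
      have h1 : (g (τ.re, y)).1 = τ := by
        apply Complex.ext <;> simp [g, ← hτ]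
      simp only [h1, ofComplex_apply] at this
      exact this
    · congr 2; field_simp
  have hrapid : RapidDecay fun n r => ((H.coeff n).coeff r : ℂ) := by
    intro s hs b
    set β := |b| + 1
    have hβ : 0 < β := by positivity
    have hb : b ≤ β := (le_abs_self b).trans (by linarith)
    obtain ⟨C₁, h₁⟩ := key s hs (-(β / Real.pi)) (by
      have := Real.pi_pos; exact neg_ne_zero.mpr (by positivity))
    obtain ⟨C₂, h₂⟩ := key s hs (β / Real.pi) (by positivity)
    have hC₁ : 0 ≤ C₁ := by simpa using (norm_nonneg _).trans (h₁ 0 0)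
    refine ⟨max C₁ C₂, fun n r => ?_⟩
    have h3 : max C₁ C₂ * Real.exp (s * n) * Real.exp (-(β * |(r : ℝ)|)) ≤
        max C₁ C₂ * Real.exp (s * n - b * |(r : ℝ)|) := by
      rw [mul_assoc, ← Real.exp_add]
      have : 0 ≤ max C₁ C₂ := hC₁.trans (le_max_left _ _)
      gcongr
      nlinarith [abs_nonneg (r : ℝ)]
    refine le_trans ?_ h3
    rcases le_total 0 r with hr | hr
    · rw [abs_of_nonneg (by exact_mod_cast hr)]
      refine (h₁ n r).trans ?_
      rw [show Real.pi * r * -(β / Real.pi) = -(β * r) by field_simp]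
      gcongr; exact le_max_left _ _
    · rw [abs_of_nonpos (by exact_mod_cast hr)]
      refine (h₂ n r).trans ?_
      rw [show Real.pi * r * (β / Real.pi) = -(β * -r) by field_simp]
      gcongr; exact le_max_right _ _
  refine ⟨fun n r hr => ?_, fun τ z => ?_⟩
  · refine even_sub_of_evalExp_add_one (p := H.coeff n) (fun z hz => ?_) r
      (fun h => hr (by simp [h]))
    have hpar : ∀ {K : ℤ} {A : PowerSeries (LaurentPolynomial ℤ)} {f : ℍ → ℂ → ℂ},
        HasExpansion K A f → PowerSeries.map (evalExp (z + 1)) A =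
          PowerSeries.C ((-1) ^ K) * PowerSeries.map (evalExp z) A := fun {K A f} h => by
      ext1 m
      rw [PowerSeries.coeff_C_mul, PowerSeries.coeff_map, PowerSeries.coeff_map]
      exact evalExp_add_one (fun r hr => h.1 m r (Int.cast_ne_zero.mpr hr)) z
    have h1 := hpar hF
    have h2 := hpar hG
    rw [hFGH, map_mul, map_mul, h2] at h1
    have hM : (-1 : ℂ) ^ M ≠ 0 := zpow_ne_zero _ (by norm_num)
    have h3 : PowerSeries.map (evalExp (z + 1)) H =
        PowerSeries.C ((-1) ^ (N - M)) * PowerSeries.map (evalExp z) H := by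
      refine mul_left_cancel₀ (mul_ne_zero (a := PowerSeries.C ((-1 : ℂ) ^ M))
        ((map_ne_zero_iff _ PowerSeries.C_injective).mpr hM) (hGz z hz)) ?_
      rw [h1, zpow_sub₀ (by norm_num), show PowerSeries.C ((-1 : ℂ) ^ N / (-1) ^ M) =
        PowerSeries.C ((-1 : ℂ) ^ N) * PowerSeries.C (((-1) ^ M)⁻¹) by
          rw [← map_mul, div_eq_mul_inv]]
      have h4 : PowerSeries.C ((-1 : ℂ) ^ M) * PowerSeries.C (((-1) ^ M)⁻¹) = 1 := by
        rw [← map_mul, mul_inv_cancel₀ hM, map_one]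
      linear_combination (-(PowerSeries.C ((-1 : ℂ) ^ N) * PowerSeries.map (evalExp z) G *
        PowerSeries.map (evalExp z) H)) * h4
    have h5 := congrArg (PowerSeries.coeff n) h3
    rwa [PowerSeries.coeff_C_mul, PowerSeries.coeff_map, PowerSeries.coeff_map] at h5
  · have hs : ∀ z, HasSum (fun p : ℕ × ℤ => ((H.coeff p.1).coeff p.2 : ℂ) *
        qyMonomial p.1 p.2 τ z) (expSum (fun n r => ((H.coeff n).coeff r : ℂ)) (τ, z)) :=
      fun z => (hrapid.summable (p := (τ, z)) τ.2).hasSum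
    have heq : χ τ = fun z => expSum (fun n r => ((H.coeff n).coeff r : ℂ)) (τ, z) := by
      refine Continuous.ext_on (s := {z : ℂ | z.im ≠ 0}) ?_ (hcontτ τ) ?_ fun z hz => ?_
      · have : {z : ℂ | z.im ≠ 0} = Complex.im ⁻¹' {0}ᶜ := rfl
        rw [this]
        exact (dense_compl_singleton (0 : ℝ)).preimage Complex.isOpenMap_im
      · exact continuous_iff_continuousAt.mpr fun z => (hrapid.continuousAt (p := (τ, z)) τ.2).comp
          (f := fun z : ℂ => ((τ : ℂ), z)) (by fun_prop)
      · have h1 := (hq z hz).hasSum τ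
        rw [hqH z hz] at h1
        refine h1.unique ((hs z).prod_fiberwise fun n => ?_)
        rw [PowerSeries.coeff_map]
        refine (congrArg (HasSum · _) (funext fun r => ?_)).mpr
          ((JacobiForms.hasSum_evalExp z (H.coeff n)).mul_right
            (Function.Periodic.qParam 1 τ ^ n))
        rw [mul_assoc, qyMonomial, Function.Periodic.qParam, ← Complex.exp_nat_mul,
          ← Complex.exp_add]
        congr 2
        push_cast
        ring
    rw [heq]
    exact hs z

/-! ### Quotients with simple zeros -/

lemma isOpen_im_fst_pos : IsOpen {p : ℂ × ℂ | 0 < p.1.im} :=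
  isOpen_lt continuous_const (Complex.continuous_im.comp continuous_fst)

namespace HasExpansion

variable {N M : ℤ} {F G : PowerSeries (LaurentPolynomial ℤ)} {φ ψ : ℍ → ℂ → ℂ}

lemma hasStrictFDerivAt (h : HasExpansion N F φ) (τ : ℍ) (z : ℂ) :
    ∃ L : ℂ × ℂ →L[ℂ] ℂ, L (0, 1) = deriv (φ τ) z ∧
      HasStrictFDerivAt (fun p : ℂ × ℂ => φ (ofComplex p.1) p.2) L (τ, z) := by
  have h1 := h.rapidDecay.hasStrictFDerivAt (p := (τ, z)) τ.2
  have h2 := h1.congr_of_eventuallyEq (f₁ := fun p : ℂ × ℂ => φ (ofComplex p.1) p.2) (by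
    filter_upwards [isOpen_im_fst_pos.mem_nhds (x := ((τ : ℂ), z)) τ.2] with p hp
    rw [h.eq_expSum, ofComplex_apply_of_im_pos hp])
  refine ⟨_, ?_, h2⟩
  have h3 := h2.hasFDerivAt.comp_hasDerivAt z (f := fun z : ℂ => ((τ : ℂ), z))
    ((hasDerivAt_const z (τ : ℂ)).prodMk (hasDerivAt_id z))
  simpa [Function.comp_def, ofComplex_apply] using h3.deriv.symm

lemma differentiable (h : HasExpansion N F φ) (τ : ℍ) : Differentiable ℂ (φ τ) := fun z => by
  obtain ⟨L, -, hL⟩ := h.hasStrictFDerivAt τ z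
  have h3 := hL.hasFDerivAt.comp_hasDerivAt z (f := fun z : ℂ => ((τ : ℂ), z))
    ((hasDerivAt_const z (τ : ℂ)).prodMk (hasDerivAt_id z))
  simpa [Function.comp_def, ofComplex_apply] using h3.differentiableAt

lemma continuousAt (h : HasExpansion N F φ) (τ : ℍ) (z : ℂ) :
    ContinuousAt (fun p : ℂ × ℂ => φ (ofComplex p.1) p.2) (τ, z) := by
  obtain ⟨L, -, hL⟩ := h.hasStrictFDerivAt τ z
  exact hL.continuousAt

lemma continuousAt_deriv (h : HasExpansion N F φ) (τ : ℍ) (z : ℂ) :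
    ContinuousAt (fun p : ℂ × ℂ => deriv (φ (ofComplex p.1)) p.2) (τ, z) := by
  have h1 := (h.rapidDecay.int_mul.continuousAt (p := (τ, z)) τ.2).const_mul
    (Real.pi * Complex.I)
  refine h1.congr ?_
  filter_upwards [isOpen_im_fst_pos.mem_nhds (x := ((τ : ℂ), z)) τ.2] with p hp
  have h2 := (h.rapidDecay.hasFDerivAt hp).comp_hasDerivAt p.2 (f := fun z : ℂ => (p.1, z))
    ((hasDerivAt_const p.2 p.1).prodMk (hasDerivAt_id p.2))
  have h3 : φ (ofComplex p.1) =
      fun z => expSum (fun n r => ((F.coeff n).coeff r : ℂ)) (p.1, z) := by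
    ext z
    rw [h.eq_expSum, ofComplex_apply_of_im_pos hp]
  rw [h3]
  refine Eq.trans ?_ h2.deriv.symm
  simp

lemma eq_of_vadd_one (h : HasExpansion N F φ) (w : ℂ) :
    φ (ofComplex (w + (1 : ℝ))) = φ (ofComplex w) := by
  ext z; exact (h.hasQExpansion z).periodic w

end HasExpansion

/-- If `f` vanishes on the graph `z = l τ` through the point `p`, then `f (τ, z) / (z - l τ)` tends
to the `z`-derivative of `f` at `p`, as a function of two variables. -/
lemma tendsto_div_sub_of_hasStrictFDerivAt {f : ℂ × ℂ → ℂ} {L : ℂ × ℂ →L[ℂ] ℂ} {p : ℂ × ℂ}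
    (hf : HasStrictFDerivAt f L p) {l : ℂ → ℂ} (hl : Continuous l) (hp : p.2 = l p.1)
    (h0 : ∀ᶠ τ in 𝓝 p.1, f (τ, l τ) = 0) :
    Tendsto (fun x : ℂ × ℂ => f x / (x.2 - l x.1)) (𝓝 p ⊓ 𝓟 {x | x.2 ≠ l x.1})
      (𝓝 (L (0, 1))) := by
  have h1 : Tendsto (fun x : ℂ × ℂ => (x, (x.1, l x.1))) (𝓝 p) (𝓝 (p, p)) := by
    have : Continuous fun x : ℂ × ℂ => (x, (x.1, l x.1)) := by fun_prop
    have h2 := this.tendsto p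
    simpa only [← hp, Prod.mk.eta] using h2
  have h2 := hf.isLittleO.comp_tendsto h1
  rw [← tendsto_sub_nhds_zero_iff]
  have h3 : (fun x : ℂ × ℂ => f x - L (0, 1) * (x.2 - l x.1)) =o[𝓝 p]
      fun x => x.2 - l x.1 := by
    refine (h2.trans_le (k := fun x : ℂ × ℂ => x.2 - l x.1) fun x => ?_).congr' ?_ EventuallyEq.rfl
    · simp [Prod.norm_def]
    · filter_upwards [(continuous_fst.tendsto p).eventually h0] with x hx
      have : x - (x.1, l x.1) = (x.2 - l x.1) • ((0, 1) : ℂ × ℂ) := by ext <;> simp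
      simp only [Function.comp_apply, hx, sub_zero, this, map_smul, smul_eq_mul]
      ring
  have h4 := (h3.mono (inf_le_left (b := 𝓟 {x : ℂ × ℂ | x.2 ≠ l x.1}))).tendsto_div_nhds_zero
  refine h4.congr' ?_
  filter_upwards [mem_inf_of_right (mem_principal_self _)] with x hx
  have hx' : x.2 - l x.1 ≠ 0 := sub_ne_zero.mpr hx
  field_simp

open Classical in
/-- The quotient of two functions of `(τ, z)`, extended to simple zeros in `z` of the denominator by
the quotient of the derivatives. -/
noncomputable def extendedQuotient (φ ψ : ℍ → ℂ → ℂ) (τ : ℍ) (z : ℂ) : ℂ :=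
  if ψ τ z = 0 then deriv (φ τ) z / deriv (ψ τ) z else φ τ z / ψ τ z

/-- Each zero of `ψ` lies on a graph `z = x τ + y` with real `x` and `y`, on which both `ψ` and `φ`
vanish, and all zeros of `ψ (τ, ·)` are simple. -/
structure HasSimpleLinearZeros (φ ψ : ℍ → ℂ → ℂ) : Prop where
  exists_line : ∀ τ z, ψ τ z = 0 → ∃ x y : ℝ, z = x * τ + y ∧
    ∀ τ' : ℍ, φ τ' (x * τ' + y) = 0 ∧ ψ τ' (x * τ' + y) = 0
  deriv_ne_zero : ∀ τ z, ψ τ z = 0 → deriv (ψ τ) z ≠ 0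

section Quotient

variable {N M : ℤ} {F G : PowerSeries (LaurentPolynomial ℤ)} {φ ψ : ℍ → ℂ → ℂ}

lemma mul_extendedQuotient (hz : HasSimpleLinearZeros φ ψ) (τ : ℍ) (z : ℂ) :
    φ τ z = ψ τ z * extendedQuotient φ ψ τ z := by
  by_cases h : ψ τ z = 0
  · obtain ⟨x, y, rfl, hxy⟩ := hz.exists_line τ z h
    rw [h, zero_mul, (hxy τ).1]
  · rw [extendedQuotient, if_neg h, mul_div_cancel₀ _ h]

lemma tendsto_div_linear (hF : HasExpansion N F φ) {τ : ℍ} {z : ℂ} {x y : ℝ}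
    (hz : z = x * τ + y) (h0 : ∀ τ' : ℍ, φ τ' (x * τ' + y) = 0) :
    Tendsto (fun p : ℂ × ℂ => φ (ofComplex p.1) p.2 / (p.2 - (x * p.1 + y)))
      (𝓝 ((τ : ℂ), z) ⊓ 𝓟 {p | p.2 ≠ x * p.1 + y}) (𝓝 (deriv (φ τ) z)) := by
  obtain ⟨L, hL, hL'⟩ := hF.hasStrictFDerivAt τ z
  rw [← hL]
  refine tendsto_div_sub_of_hasStrictFDerivAt hL' (l := fun w => x * w + y) (by fun_prop) hz ?_
  filter_upwards [isOpen_upperHalfPlaneSet.mem_nhds τ.2] with w hw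
  have := h0 (ofComplex w)
  rwa [ofComplex_apply_of_im_pos hw] at this ⊢

lemma continuousAt_extendedQuotient (hF : HasExpansion N F φ) (hG : HasExpansion M G ψ)
    (hz : HasSimpleLinearZeros φ ψ) (τ : ℍ) (z : ℂ) :
    ContinuousAt (fun p : ℂ × ℂ => extendedQuotient φ ψ (ofComplex p.1) p.2) (τ, z) := by
  by_cases h : ψ τ z = 0
  · obtain ⟨x, y, hxy, h0⟩ := hz.exists_line τ z h
    have hd := hz.deriv_ne_zero τ z h
    have h1 := tendsto_div_linear hF hxy fun τ' => (h0 τ').1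
    have h2 := tendsto_div_linear hG hxy fun τ' => (h0 τ').2
    have hval : extendedQuotient φ ψ (ofComplex (τ : ℂ)) z = deriv (φ τ) z / deriv (ψ τ) z := by
      rw [ofComplex_apply, extendedQuotient, if_pos h]
    rw [ContinuousAt]
    simp only [hval]
    have hsup : 𝓝 ((τ : ℂ), z) = (𝓝 ((τ : ℂ), z) ⊓ 𝓟 {p | p.2 ≠ x * p.1 + y}) ⊔
        (𝓝 ((τ : ℂ), z) ⊓ 𝓟 {p | p.2 = x * p.1 + y}) := by
      rw [← inf_sup_left, sup_principal]
      have : {p : ℂ × ℂ | p.2 ≠ x * p.1 + y} ∪ {p | p.2 = x * p.1 + y} = Set.univ := by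
        ext p; simp [em']
      rw [this, principal_univ, inf_top_eq]
    rw [hsup, tendsto_sup]
    constructor
    · refine (h1.div h2 hd).congr' ?_
      filter_upwards [mem_inf_of_right (mem_principal_self _), h2.eventually_ne hd] with p hp hp'
      have hp1 : p.2 - (x * p.1 + y) ≠ 0 := sub_ne_zero.mpr hp
      have hp2 : ψ (ofComplex p.1) p.2 ≠ 0 := fun h => hp' (by rw [h, zero_div])
      rw [extendedQuotient, if_neg hp2, Pi.div_apply, div_div_div_cancel_right₀ hp1]
    · have h3 := ((hF.continuousAt_deriv τ z).tendsto.div (hG.continuousAt_deriv τ z).tendsto (by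
        simpa [ofComplex_apply] using hd)).mono_left
          (inf_le_left (b := 𝓟 {p : ℂ × ℂ | p.2 = x * p.1 + y}))
      simp only [ofComplex_apply] at h3
      refine h3.congr' ?_
      filter_upwards [mem_inf_of_right (mem_principal_self _),
        mem_inf_of_left (isOpen_im_fst_pos.mem_nhds (x := ((τ : ℂ), z)) τ.2)] with p hp hp'
      have h4 := (h0 (ofComplex p.1)).2
      rw [ofComplex_apply_of_im_pos hp'] at h4
      have hp2 : ψ (ofComplex p.1) p.2 = 0 := by
        rw [show p.2 = x * p.1 + y from hp, ofComplex_apply_of_im_pos hp']; exact h4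
      rw [extendedQuotient, if_pos hp2, Pi.div_apply]
  · have hψ : ψ (ofComplex (τ : ℂ)) z ≠ 0 := by rwa [ofComplex_apply]
    refine ((hF.continuousAt τ z).div (hG.continuousAt τ z) hψ).congr ?_
    filter_upwards [(hG.continuousAt τ z).eventually_ne hψ] with p hp
    rw [extendedQuotient, if_neg hp, Pi.div_apply]

/-- For fixed `z` off the real line, the zeros of `ψ (·, z)` are isolated, and so they are removable
singularities of the quotient. -/
lemma mdiff_extendedQuotient (hF : HasExpansion N F φ) (hG : HasExpansion M G ψ)
    (hz : HasSimpleLinearZeros φ ψ) {z : ℂ} (him : z.im ≠ 0) :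
    MDiff fun τ => extendedQuotient φ ψ τ z := by
  intro τ
  rw [UpperHalfPlane.mdifferentiableAt_iff]
  have hcont : ContinuousAt (fun w : ℂ => extendedQuotient φ ψ (ofComplex w) z) τ :=
    (continuousAt_extendedQuotient hF hG hz τ z).comp (f := fun w : ℂ => (w, z)) (by fun_prop)
  have hcontG : ∀ τ : ℍ, ContinuousAt (fun w : ℂ => ψ (ofComplex w) z) τ := fun τ =>
    (hG.continuousAt τ z).comp (f := fun w : ℂ => (w, z)) (by fun_prop)
  have hdiff : ∀ τ : ℍ, ψ τ z ≠ 0 →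
      DifferentiableAt ℂ (fun w : ℂ => extendedQuotient φ ψ (ofComplex w) z) τ := fun τ hτ => by
    have h1 := UpperHalfPlane.mdifferentiableAt_iff.mp ((hF.hasQExpansion z).mdiff τ)
    have h2 := UpperHalfPlane.mdifferentiableAt_iff.mp ((hG.hasQExpansion z).mdiff τ)
    have hψ : ψ (ofComplex (τ : ℂ)) z ≠ 0 := by rwa [ofComplex_apply]
    refine (h1.div h2 hψ).congr_of_eventuallyEq ?_
    filter_upwards [(hcontG τ).eventually_ne hψ] with w hw
    rw [extendedQuotient, if_neg hw, Pi.div_apply]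
    rfl
  by_cases h : ψ τ z = 0
  · obtain ⟨x, y, hxy, h0⟩ := hz.exists_line τ z h
    have hx : (x : ℂ) ≠ 0 := by
      rintro hx
      rw [hx, zero_mul, zero_add] at hxy
      exact him (by rw [hxy, Complex.ofReal_im])
    have h2 := tendsto_div_linear hG hxy fun τ' => (h0 τ').2
    have h3 : Tendsto (fun w : ℂ => (w, z)) (𝓝[≠] (τ : ℂ))
        (𝓝 ((τ : ℂ), z) ⊓ 𝓟 {p | p.2 ≠ x * p.1 + y}) := by
      refine tendsto_inf.mpr ⟨?_, tendsto_principal.mpr ?_⟩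
      · exact Tendsto.mono_left (Continuous.tendsto (by fun_prop) _) nhdsWithin_le_nhds
      · filter_upwards [self_mem_nhdsWithin] with w hw h4
        refine hw (mul_left_cancel₀ hx ?_)
        rw [hxy] at h4
        exact (add_right_cancel h4).symm
    have h4 : ∀ᶠ w in 𝓝[≠] (τ : ℂ),
        DifferentiableAt ℂ (fun w : ℂ => extendedQuotient φ ψ (ofComplex w) z) w := by
      filter_upwards [(h2.comp h3).eventually_ne (hz.deriv_ne_zero τ z h),
        nhdsWithin_le_nhds (isOpen_upperHalfPlaneSet.mem_nhds τ.2)] with w hw hw'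
      refine hdiff ⟨w, hw'⟩ fun h5 => hw ?_
      simp only [Function.comp_apply, ofComplex_apply_of_im_pos hw']
      rw [h5, zero_div]
    exact (Complex.analyticAt_of_differentiable_on_punctured_nhds_of_continuousAt h4
      hcont).differentiableAt
  · exact hdiff τ h

/-- If `φ` vanishes at the zeros of `ψ`, which are simple, and the `q ^ 0`-term of `ψ` is
`y ^ (s / 2) - y ^ (-s / 2)`, then the quotient of `φ` by `ψ` has an integral Fourier expansion. -/
theorem exists_hasExpansion_extendedQuotient (hF : HasExpansion N F φ) (hG : HasExpansion M G ψ)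
    (hz : HasSimpleLinearZeros φ ψ) {s : ℕ} (hs : 0 < s)
    (hG0 : G.coeff 0 = T (s : ℤ) - T (-(s : ℤ)))
    (hφ0 : ∀ (τ : ℍ) (j : ℕ), φ τ ((j : ℂ) / s) = 0)
    (hψ0 : ∀ (τ : ℍ) (j : ℕ), ψ τ ((j : ℂ) / s) = 0) :
    ∃ H, HasExpansion (N - M) H (extendedQuotient φ ψ) := by
  obtain ⟨F₁, hF₁⟩ := hF.exists_eq_C_mul hs hφ0
  obtain ⟨U, hU⟩ := hG.exists_eq_C_mul hs hψ0
  have hd : (T (s : ℤ) - T (-(s : ℤ)) : LaurentPolynomial ℤ) ≠ 0 := fun h =>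
    evalExp_T_sub_T_ne_zero hs (z := Complex.I) (by simp) (by rw [h, map_zero])
  have hU0 : PowerSeries.constantCoeff U = 1 := by
    rw [hU, PowerSeries.coeff_C_mul] at hG0
    rw [← PowerSeries.coeff_zero_eq_constantCoeff_apply]
    exact mul_left_cancel₀ hd (hG0.trans (mul_one _).symm)
  refine ⟨F₁ * PowerSeries.invOfUnit U 1, hF.of_mul_eq hG ?_ ?_ ?_ ?_ ?_ ?_⟩
  · have h1 := PowerSeries.mul_invOfUnit U 1 (by simpa using hU0)
    rw [hF₁, hU]
    linear_combination (-(PowerSeries.C (T (s : ℤ) - T (-(s : ℤ))) * F₁)) * h1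
  · intro z hz'
    rw [hG0]
    exact evalExp_T_sub_T_ne_zero hs hz'
  · ext τ z; exact mul_extendedQuotient hz τ z
  · intro p hp
    have h1 := continuousAt_extendedQuotient hF hG hz ⟨p.1, hp⟩ p.2
    exact h1.continuousWithinAt
  · intro z w
    simp only [Function.comp_apply, extendedQuotient, hF.eq_of_vadd_one, hG.eq_of_vadd_one]
  · exact fun z hz' => mdiff_extendedQuotient hF hG hz hz'

end Quotient

/-! ### Euler's product and the eta function -/

/-- The polynomial `∏ i ∈ s, (1 - X ^ (i + 1))`, a partial product of Euler's product. -/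
noncomputable def eulerPolynomial (s : Finset ℕ) : Polynomial ℤ :=
  ∏ i ∈ s, (1 - Polynomial.X ^ (i + 1))

/-- The coefficients of all partial products of Euler's product satisfy a common bound. -/
lemma abs_coeff_eulerPolynomial_le {R : ℝ} (hR : 0 < R) (hR1 : R < 1) (s : Finset ℕ) (n : ℕ) :
    |((eulerPolynomial s).coeff n : ℝ)| * R ^ n ≤ Real.exp (R * (1 - R)⁻¹) := by
  have h1 : ∀ s : Finset ℕ, ∀ n,
      |((eulerPolynomial s).coeff n : ℝ)| * R ^ n ≤ ∏ i ∈ s, (1 + R ^ (i + 1)) := by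
    intro s
    induction s using Finset.induction_on with
    | empty =>
      intro n
      rw [eulerPolynomial, Finset.prod_empty, Finset.prod_empty, Polynomial.coeff_one]
      split_ifs with h
      · simp [h]
      · simp
    | insert i s hi ih =>
      intro n
      have hP : 0 ≤ ∏ i ∈ s, (1 + R ^ (i + 1)) := Finset.prod_nonneg fun i _ => by positivity
      have h2 : eulerPolynomial (insert i s) =
          eulerPolynomial s - Polynomial.X ^ (i + 1) * eulerPolynomial s := by
        rw [eulerPolynomial, Finset.prod_insert hi, ← eulerPolynomial]; ring
      rw [h2, Finset.prod_insert hi, Polynomial.coeff_sub, Polynomial.coeff_X_pow_mul', add_mul,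
        one_mul]
      push_cast
      refine (mul_le_mul_of_nonneg_right (abs_sub _ _) (by positivity)).trans ?_
      rw [add_mul]
      refine add_le_add (ih n) ?_
      split_ifs with h
      · calc |((eulerPolynomial s).coeff (n - (i + 1)) : ℝ)| * R ^ n =
            R ^ (i + 1) * (|((eulerPolynomial s).coeff (n - (i + 1)) : ℝ)| *
              R ^ (n - (i + 1))) := by
              rw [mul_left_comm, ← pow_add, Nat.add_sub_cancel' h]
          _ ≤ _ := by gcongr; exact ih _
      · simpa using by positivity
  refine (h1 s n).trans ?_
  calc ∏ i ∈ s, (1 + R ^ (i + 1)) ≤ ∏ i ∈ s, Real.exp (R ^ (i + 1)) := by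
        refine Finset.prod_le_prod (fun i _ => by positivity) fun i _ => ?_
        rw [add_comm]; exact Real.add_one_le_exp _
    _ = Real.exp (∑ i ∈ s, R ^ (i + 1)) := (Real.exp_sum _ _).symm
    _ ≤ _ := by
        gcongr
        have hs := (hasSum_geometric_of_lt_one hR.le hR1).mul_left R
        simp_rw [← pow_succ'] at hs
        exact sum_le_hasSum s (fun i _ => by positivity) hs

/-- The pentagonal number series, analytically: on the unit disc it converges to Euler's
product. -/
lemma hasSum_pentagonalSeries {q : ℂ} (hq : ‖q‖ < 1) :
    HasSum (fun n => ((PowerSeries.pentagonalSeries ℤ).coeff n : ℂ) * q ^ n)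
      (∏' n : ℕ, (1 - q ^ (n + 1))) := by
  obtain ⟨R, hR, hR1⟩ := exists_between (max_lt hq zero_lt_one)
  have hR0 : 0 < R := (le_max_right _ _).trans_lt hR
  have hqR : ‖q‖ / R < 1 := (div_lt_one hR0).mpr ((le_max_left _ _).trans_lt hR)
  set C := Real.exp (R * (1 - R)⁻¹)
  have hb : ∀ s n, ‖((eulerPolynomial s).coeff n : ℂ) * q ^ n‖ ≤ C * (‖q‖ / R) ^ n := by
    intro s n
    have := abs_coeff_eulerPolynomial_le hR0 hR1 s n
    rw [norm_mul, Complex.norm_intCast, norm_pow, div_pow, mul_div_assoc',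
      le_div_iff₀ (by positivity)]
    calc _ = |((eulerPolynomial s).coeff n : ℝ)| * R ^ n * ‖q‖ ^ n := by ring
      _ ≤ _ := by gcongr
  have hsum : Summable fun n => C * (‖q‖ / R) ^ n :=
    (summable_geometric_of_lt_one (by positivity) hqR).mul_left C
  have hlim : ∀ n, ∀ᶠ s in atTop,
      ((eulerPolynomial s).coeff n : ℂ) * q ^ n =
        ((PowerSeries.pentagonalSeries ℤ).coeff n : ℂ) * q ^ n := fun n => by
    filter_upwards [PowerSeries.coeff_prod_one_sub_X_pow_eventually_eq ℤ n] with s hs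
    rw [← hs, ← Polynomial.coeff_coe, eulerPolynomial]
    congr 3
    rw [← Polynomial.coeToPowerSeries.ringHom_apply, map_prod]
    simp
  have hE : Summable fun n => ((PowerSeries.pentagonalSeries ℤ).coeff n : ℂ) * q ^ n := by
    refine Summable.of_norm_bounded hsum fun n => ?_
    obtain ⟨s, hs⟩ := (hlim n).exists
    rw [← hs]; exact hb s n
  have h1 := tendsto_tsum_of_dominated_convergence (𝓕 := atTop) (f := fun (s : Finset ℕ) (n : ℕ) =>
    ((eulerPolynomial s).coeff n : ℂ) * q ^ n) hsum
    (fun n => tendsto_nhds_of_eventually_eq (hlim n)) (Eventually.of_forall fun s n => hb s n)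
  have h2 : ∀ s : Finset ℕ, ∑' n, ((eulerPolynomial s).coeff n : ℂ) * q ^ n =
      ∏ i ∈ s, (1 - q ^ (i + 1)) := fun s => by
    have h3 : Polynomial.aeval q (eulerPolynomial s) = ∏ i ∈ s, (1 - q ^ (i + 1)) := by
      simp [eulerPolynomial]
    rw [← h3, Polynomial.aeval_eq_sum_range, tsum_eq_sum]
    · exact Finset.sum_congr rfl fun n _ => by rw [zsmul_eq_mul]
    · intro n hn
      rw [Polynomial.coeff_eq_zero_of_natDegree_lt (by simpa using hn)]; simp
  simp_rw [h2] at h1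
  have h3 : HasProd (fun n : ℕ => 1 - q ^ (n + 1)) _ :=
    (ModularForm.multipliable_one_sub_pow hq).hasProd
  have h4 := tendsto_nhds_unique h1 h3
  rw [← h4]
  exact hE.hasSum

/-- Euler's product `∏ (1 - q ^ n)`, which is `q ^ (-1 / 24) * η`. -/
noncomputable def eulerProduct (τ : ℍ) : ℂ := ∏' n : ℕ, (1 - ModularForm.eta_q n τ)

lemma eta_eq (τ : ℍ) :
    ModularForm.eta τ = Function.Periodic.qParam 24 τ * eulerProduct τ := rfl

lemma eulerProduct_ne_zero (τ : ℍ) : eulerProduct τ ≠ 0 := ModularForm.eta_tprod_ne_zero τ.2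

/-- A power series in `q` with integral coefficients is an integral expansion of index `0`. -/
lemma hasExpansion_of_hasSum {E : PowerSeries ℤ} {f : ℍ → ℂ}
    (h : ∀ τ : ℍ, HasSum (fun n => (E.coeff n : ℂ) * Function.Periodic.qParam 1 τ ^ n) (f τ)) :
    HasExpansion 0 (PowerSeries.map LaurentPolynomial.C E) (fun τ _ => f τ) := by
  refine ⟨fun n r hr => ?_, fun τ z => ?_⟩
  · by_cases h0 : r = 0
    · rw [h0, sub_self]
      exact Even.zero
    · dsimp only at hr
      rw [PowerSeries.coeff_map, LaurentPolynomial.C_apply, if_neg h0] at hr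
      exact absurd Int.cast_zero hr
  · have hinj : Function.Injective fun n : ℕ => (n, (0 : ℤ)) := Prod.mk_left_injective 0
    refine (hinj.hasSum_iff fun p hp => ?_).mp ?_
    · obtain ⟨n, r⟩ := p
      have : r ≠ 0 := fun h => hp ⟨n, by rw [h]⟩
      dsimp only
      rw [PowerSeries.coeff_map, LaurentPolynomial.C_apply, if_neg this, Int.cast_zero, zero_mul]
    · refine (congrArg (HasSum · _) (funext fun n => ?_)).mpr (h τ)
      simp only [Function.comp_apply, PowerSeries.coeff_map, LaurentPolynomial.C_apply, if_true,
        qyMonomial, Function.Periodic.qParam, ← Complex.exp_nat_mul]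
      congr 2
      push_cast
      ring

lemma hasExpansion_eulerProduct :
    HasExpansion 0 (PowerSeries.map LaurentPolynomial.C (PowerSeries.pentagonalSeries ℤ))
      (fun τ _ => eulerProduct τ) :=
  hasExpansion_of_hasSum fun τ =>
    hasSum_pentagonalSeries (by simpa using Function.Periodic.norm_qParam_lt_one one_pos τ.2)

lemma HasExpansion.sum_const {E : PowerSeries ℤ} {f : ℍ → ℂ}
    (h : HasExpansion 0 (PowerSeries.map LaurentPolynomial.C E) (fun τ _ => f τ)) (τ : ℍ) :
    HasSum (fun n => (E.coeff n : ℂ) * Function.Periodic.qParam 1 τ ^ n) (f τ) := by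
  have := h.hasSum_evalExp τ 0
  refine (congrArg (HasSum · _) (funext fun n => ?_)).mpr this
  rw [PowerSeries.coeff_map, PowerSeries.coeff_map]
  simp

lemma hasQExpansion_one : HasQExpansion (1 : ℍ → ℂ) :=
  ⟨fun _ => rfl, mdifferentiable_const, isBoundedAtImInfty_iff.mpr ⟨1, 0, fun _ _ => by simp⟩⟩

lemma constantCoeff_pentagonalSeries :
    PowerSeries.constantCoeff (PowerSeries.pentagonalSeries ℤ) = 1 := by
  have h := PowerSeries.coeff_pentagonalSeries_pentagonal ℤ 0
  have h0 : pentagonal 0 = 0 := by simp [pentagonal_def]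
  rw [h0] at h
  simpa using h

/-- The reciprocal of the pentagonal number series. -/
noncomputable def pentagonalSeriesInv : PowerSeries ℤ :=
  PowerSeries.invOfUnit (PowerSeries.pentagonalSeries ℤ) 1

lemma constantCoeff_pentagonalSeriesInv : PowerSeries.constantCoeff pentagonalSeriesInv = 1 := by
  simp [pentagonalSeriesInv]

/-- The reciprocal of Euler's product is bounded at `i∞`, where the product tends to `1`, so that
its `q`-expansion is the formal reciprocal of the pentagonal number series. -/
lemma hasExpansion_inv_eulerProduct :
    HasExpansion 0 (PowerSeries.map LaurentPolynomial.C pentagonalSeriesInv)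
      (fun τ _ => (eulerProduct τ)⁻¹) := by
  have hE := hasExpansion_eulerProduct
  have hq := hE.hasQExpansion 0
  have hqE : qExpansion 1 eulerProduct =
      PowerSeries.map (Int.castRingHom ℂ) (PowerSeries.pentagonalSeries ℤ) :=
    hq.qExpansion_eq fun τ => by simpa using hE.sum_const τ
  have hinv : HasQExpansion fun τ => (eulerProduct τ)⁻¹ := by
    refine hasQExpansion_one.of_mul_eq hq ?_ ?_ (fun w => ?_) ?_
    · ext τ; simp [eulerProduct_ne_zero]
    · rw [hqE, PowerSeries.coeff_map, PowerSeries.coeff_zero_eq_constantCoeff_apply,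
        constantCoeff_pentagonalSeries]
      simp
    · exact congrArg (·⁻¹) (hq.periodic w)
    · have h1 := UpperHalfPlane.mdifferentiable_iff.mp hq.mdiff
      exact UpperHalfPlane.mdifferentiable_iff.mpr (h1.inv fun w _ => eulerProduct_ne_zero _)
  have h1 := hq.qExpansion_mul hinv
  have h2 : (fun τ => eulerProduct τ) * (fun τ => (eulerProduct τ)⁻¹) = 1 := by
    ext τ; simp [eulerProduct_ne_zero]
  rw [h2, qExpansion_one, hqE] at h1
  have h3 : qExpansion 1 (fun τ => (eulerProduct τ)⁻¹) =
      PowerSeries.map (Int.castRingHom ℂ) pentagonalSeriesInv := by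
    have h4 := congrArg (PowerSeries.map (Int.castRingHom ℂ))
      (PowerSeries.mul_invOfUnit (PowerSeries.pentagonalSeries ℤ) 1
        (by simpa using constantCoeff_pentagonalSeries))
    rw [map_mul, map_one] at h4
    refine mul_left_cancel₀ (fun h => ?_) (h1.symm.trans h4.symm)
    rw [h, zero_mul] at h4
    exact zero_ne_one h4
  refine hasExpansion_of_hasSum fun τ => ?_
  have := hinv.hasSum τ
  rw [h3] at this
  simpa using this

/-! ### Transformation laws of the theta-series -/

/-- The denominator `c τ + d` of `γ τ`. -/
def cocycle (γ : SL(2, ℤ)) (τ : ℍ) : ℂ := (γ 1 0 : ℂ) * τ + (γ 1 1 : ℂ)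

lemma cocycle_ne_zero (γ : SL(2, ℤ)) (τ : ℍ) : cocycle γ τ ≠ 0 := by
  simpa [ModularGroup.denom_apply, cocycle] using denom_ne_zero (γ : GL (Fin 2) ℝ) τ

lemma coe_smul_mul_cocycle (γ : SL(2, ℤ)) (τ : ℍ) :
    ((γ • τ : ℍ) : ℂ) * cocycle γ τ = (γ 0 0 : ℂ) * τ + (γ 0 1 : ℂ) := by
  rw [specialLinearGroup_apply]
  refine Eq.trans ?_ (div_mul_cancel₀ _ (cocycle_ne_zero γ τ))
  simp [cocycle]

lemma cocycle_mul (γ δ : SL(2, ℤ)) (τ : ℍ) :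
    cocycle (γ * δ) τ = cocycle γ (δ • τ) * cocycle δ τ := by
  have h := coe_smul_mul_cocycle δ τ
  have h1 : cocycle γ (δ • τ) * cocycle δ τ =
      (γ 1 0 : ℂ) * (((δ • τ : ℍ) : ℂ) * cocycle δ τ) + (γ 1 1 : ℂ) * cocycle δ τ := by
    rw [cocycle]; ring
  rw [h1, h]
  simp only [cocycle, Matrix.SpecialLinearGroup.coe_mul, Matrix.mul_apply, Fin.sum_univ_two]
  push_cast
  ring

/-- The factor of automorphy of the Jacobi forms of weight `k` and index `N / 2`. -/
noncomputable def jacobiFactor (k N : ℤ) (γ : SL(2, ℤ)) (τ : ℍ) (z : ℂ) : ℂ :=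
  cocycle γ τ ^ k *
    Complex.exp (2 * Real.pi * Complex.I * ((N : ℂ) / 2) * ((γ 1 0 : ℂ) * z ^ 2 / cocycle γ τ))

lemma jacobiFactor_ne_zero (k N : ℤ) (γ : SL(2, ℤ)) (τ : ℍ) (z : ℂ) :
    jacobiFactor k N γ τ z ≠ 0 :=
  mul_ne_zero (zpow_ne_zero _ (cocycle_ne_zero γ τ)) (Complex.exp_ne_zero _)

lemma jacobiFactor_mul (k N : ℤ) (γ δ : SL(2, ℤ)) (τ : ℍ) (z : ℂ) :
    jacobiFactor k N (γ * δ) τ z =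
      jacobiFactor k N γ (δ • τ) (z / cocycle δ τ) * jacobiFactor k N δ τ z := by
  have h1 := cocycle_ne_zero δ τ
  have h2 := cocycle_ne_zero γ (δ • τ)
  have hdet : (δ 0 0 : ℂ) * δ 1 1 - δ 0 1 * δ 1 0 = 1 := by
    have := δ.det_coe
    rw [Matrix.det_fin_two] at this
    exact_mod_cast this
  have hc : ((γ * δ) 1 0 : ℂ) = (γ 1 0 : ℂ) * δ 0 0 + γ 1 1 * δ 1 0 := by
    simp [Matrix.SpecialLinearGroup.coe_mul, Matrix.mul_apply, Fin.sum_univ_two]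
  have key : ((γ * δ) 1 0 : ℂ) * cocycle δ τ =
      γ 1 0 + δ 1 0 * (cocycle γ (δ • τ) * cocycle δ τ) := by
    rw [← cocycle_mul, hc, cocycle, cocycle, Matrix.SpecialLinearGroup.coe_mul, Matrix.mul_apply,
      Matrix.mul_apply, Fin.sum_univ_two, Fin.sum_univ_two]
    push_cast
    linear_combination (γ 1 0 : ℂ) * hdet
  have key2 : ((γ * δ) 1 0 : ℂ) * z ^ 2 / cocycle (γ * δ) τ =
      (γ 1 0 : ℂ) * (z / cocycle δ τ) ^ 2 / cocycle γ (δ • τ) +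
        (δ 1 0 : ℂ) * z ^ 2 / cocycle δ τ := by
    rw [cocycle_mul]
    field_simp
    linear_combination z ^ 2 * key
  rw [jacobiFactor, key2, cocycle_mul, mul_zpow, mul_add, Complex.exp_add, jacobiFactor,
    jacobiFactor]
  ring

lemma jacobiFactor_one (k N : ℤ) (τ : ℍ) (z : ℂ) : jacobiFactor k N 1 τ z = 1 := by
  simp [jacobiFactor, cocycle]

lemma modular_of_S_T {k N : ℤ} {φ : ℍ → ℂ → ℂ}
    (hT : ∀ τ z, φ (ModularGroup.T • τ) z = φ τ z)
    (hS : ∀ τ z, φ (ModularGroup.S • τ) (z / τ) =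
      (τ : ℂ) ^ k * Complex.exp (2 * Real.pi * Complex.I * ((N : ℂ) / 2) * (z ^ 2 / τ)) * φ τ z)
    (γ : SL(2, ℤ)) (τ : ℍ) (z : ℂ) :
    φ (γ • τ) (z / cocycle γ τ) = jacobiFactor k N γ τ z * φ τ z := by
  have hγ : γ ∈ Subgroup.closure {ModularGroup.S, ModularGroup.T} := by
    rw [SpecialLinearGroup.SL2Z_generators]; trivial
  induction hγ using Subgroup.closure_induction generalizing τ z with
  | mem γ h =>
    rcases h with rfl | rfl
    · simpa [jacobiFactor, cocycle, ModularGroup.S] using hS τ z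
    · simpa [jacobiFactor, cocycle, ModularGroup.T] using hT τ z
  | one => simp [jacobiFactor_one, cocycle]
  | mul γ δ _ _ hγ hδ =>
    rw [mul_smul, cocycle_mul, mul_comm (cocycle γ _), ← div_div, hγ, hδ, jacobiFactor_mul]
    ring
  | inv γ _ hγ =>
    have h1 := hγ (γ⁻¹ • τ) (z / cocycle γ⁻¹ τ)
    have h2 := jacobiFactor_mul k N γ γ⁻¹ τ z
    have h3 := cocycle_mul γ γ⁻¹ τ
    have h4 : cocycle 1 τ = 1 := by simp [cocycle]
    rw [mul_inv_cancel, h4] at h3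
    rw [smul_inv_smul, div_div, mul_comm, ← h3, div_one] at h1
    rw [mul_inv_cancel, jacobiFactor_one] at h2
    rw [h1]
    linear_combination φ (γ⁻¹ • τ) (z / cocycle γ⁻¹ τ) * h2

lemma HasExpansion.eq_T_smul {N : ℤ} {F : PowerSeries (LaurentPolynomial ℤ)} {φ : ℍ → ℂ → ℂ}
    (h : HasExpansion N F φ) (τ : ℍ) : φ (ModularGroup.T • τ) = φ τ := by
  have h1 := h.eq_of_vadd_one τ
  rw [ofComplex_apply] at h1
  rw [← h1, modular_T_smul]
  congr 1
  ext
  rw [ofComplex_apply_of_im_pos (by simpa using τ.2)]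
  simp [add_comm]

/-- A function with an integral expansion is a Jacobi form if it satisfies the transformation laws
under `S` and under the translations of `z`. -/
lemma HasExpansion.mem_JZ {k N : ℤ} {F : PowerSeries (LaurentPolynomial ℤ)} {φ : ℍ → ℂ → ℂ}
    (h : HasExpansion N F φ)
    (hS : ∀ τ z, φ (ModularGroup.S • τ) (z / τ) =
      (τ : ℂ) ^ k * Complex.exp (2 * Real.pi * Complex.I * ((N : ℂ) / 2) * (z ^ 2 / τ)) * φ τ z)
    (hell : ∀ (l m : ℤ) (τ : ℍ) (z : ℂ),
      φ τ (z + l * τ + m) =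
        (-1) ^ (N * (l + m)) *
          Complex.exp (-(2 * Real.pi * Complex.I * ((N : ℂ) / 2) *
            ((l : ℂ) ^ 2 * τ + 2 * l * z))) * φ τ z) :
    φ ∈ JZ k N :=
  ⟨⟨h.differentiableOn, modular_of_S_T (fun τ z => congrFun (h.eq_T_smul τ) z) hS, hell, _, h⟩,
    _, h⟩

/-- The term of index `2 * j + 1` of the theta-series. -/
noncomputable def thetaTerm (j : ℤ) (τ z : ℂ) : ℂ :=
  (-1 : ℂ) ^ j * Complex.exp (2 * Real.pi * Complex.I *
      (((2 * j + 1 : ℤ) : ℂ) ^ 2 / 8 * τ + ((2 * j + 1 : ℤ) : ℂ) / 2 * z))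

lemma exp_pi_I_mul_int (j : ℤ) : Complex.exp (Real.pi * Complex.I * j) = (-1) ^ j := by
  rw [mul_comm, Complex.exp_int_mul, Complex.exp_pi_mul_I]

lemma thetaTerm_eq (j : ℤ) (τ z : ℂ) :
    thetaTerm j τ z = Complex.exp (Real.pi * Complex.I * (τ / 4 + z)) *
      jacobiTheta₂_term j (z + τ / 2 + 1 / 2) τ := by
  rw [thetaTerm, jacobiTheta₂_term, ← exp_pi_I_mul_int, ← Complex.exp_add, ← Complex.exp_add]
  congr 1
  push_cast
  ring

lemma hasSum_thetaTerm (τ : ℍ) (z : ℂ) :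
    HasSum (fun j => thetaTerm j τ z) (Complex.exp (Real.pi * Complex.I * (τ / 4 + z)) *
      jacobiTheta₂ (z + τ / 2 + 1 / 2) τ) := by
  simp only [thetaTerm_eq]
  exact (hasSum_jacobiTheta₂_term _ τ.2).mul_left _

lemma theta_eq_tsum (τ : ℍ) (z : ℂ) : theta τ z = ∑' j, thetaTerm j τ z := rfl

lemma hasSum_theta (τ : ℍ) (z : ℂ) : HasSum (fun j => thetaTerm j τ z) (theta τ z) := by
  rw [theta_eq_tsum]; exact (hasSum_thetaTerm τ z).summable.hasSum

lemma theta_eq_jacobiTheta₂ (τ : ℍ) (z : ℂ) :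
    theta τ z = Complex.exp (Real.pi * Complex.I * (τ / 4 + z)) *
      jacobiTheta₂ (z + τ / 2 + 1 / 2) τ := (hasSum_thetaTerm τ z).tsum_eq

lemma thetaTerm_add (j l m : ℤ) (τ z : ℂ) :
    thetaTerm j τ (z + l * τ + m) = (-1) ^ (l + m) *
      Complex.exp (-(Real.pi * Complex.I * ((l : ℂ) ^ 2 * τ + 2 * l * z))) *
        thetaTerm (j + l) τ z := by
  have h2 : (-1 : ℂ) ^ ((2 * j + 1) * m) = (-1) ^ m := by
    rw [zpow_mul, Odd.neg_one_zpow ⟨j, rfl⟩]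
  have h3 : (-1 : ℂ) ^ j = (-1) ^ l * (-1) ^ (j + l) := by
    rw [← zpow_add₀ (by norm_num), show l + (j + l) = j + 2 * l by ring, zpow_add₀ (by norm_num),
      zpow_mul]
    simp
  have h4 : Complex.exp (2 * Real.pi * Complex.I * (((2 * j + 1 : ℤ) : ℂ) ^ 2 / 8 * τ +
      ((2 * j + 1 : ℤ) : ℂ) / 2 * (z + l * τ + m))) =
      Complex.exp (Real.pi * Complex.I * (((2 * j + 1) * m : ℤ))) *
        Complex.exp (-(Real.pi * Complex.I * ((l : ℂ) ^ 2 * τ + 2 * l * z))) *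
        Complex.exp (2 * Real.pi * Complex.I * (((2 * (j + l) + 1 : ℤ) : ℂ) ^ 2 / 8 * τ +
          ((2 * (j + l) + 1 : ℤ) : ℂ) / 2 * z)) := by
    rw [← Complex.exp_add, ← Complex.exp_add]
    congr 1
    push_cast
    ring
  rw [thetaTerm, thetaTerm, h4, exp_pi_I_mul_int, h2, h3, zpow_add₀ (by norm_num) l m]
  ring

lemma theta_add (l m : ℤ) (τ : ℍ) (z : ℂ) :
    theta τ (z + l * τ + m) = (-1) ^ (l + m) *
      Complex.exp (-(Real.pi * Complex.I * ((l : ℂ) ^ 2 * τ + 2 * l * z))) * theta τ z := by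
  have h := ((Equiv.addRight l).hasSum_iff.mpr (hasSum_theta τ z)).mul_left
    ((-1) ^ (l + m) * Complex.exp (-(Real.pi * Complex.I * ((l : ℂ) ^ 2 * τ + 2 * l * z))))
  refine (hasSum_theta τ _).unique ?_
  simpa only [thetaTerm_add, Function.comp_def, Equiv.coe_addRight] using h

lemma neg_I_mul_cpow_half (τ : ℍ) :
    (-Complex.I * τ) ^ (1 / 2 : ℂ) = Complex.I.sqrt⁻¹ * (τ : ℂ).sqrt := by
  have h0 : (τ : ℂ) ≠ 0 := ne_zero τ
  have hI : -Complex.I ≠ 0 := neg_ne_zero.mpr Complex.I_ne_zero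
  have hlog : Complex.log (-Complex.I * τ) = Complex.log τ - Complex.log Complex.I := by
    rw [Complex.log_mul hI h0, Complex.log_neg_I, Complex.log_I]
    · ring
    · rw [Complex.arg_neg_I]
      have h1 := Complex.arg_le_pi (τ : ℂ)
      have h2 := Complex.arg_nonneg_iff.mpr τ.2.le
      have := Real.pi_pos
      constructor <;> linarith
  rw [Complex.cpow_def_of_ne_zero (mul_ne_zero hI h0), hlog, sqrt_eq_exp h0,
    sqrt_eq_exp Complex.I_ne_zero, ← Complex.exp_neg, ← Complex.exp_add]
  congr 1
  ring

lemma neg_I_mul_cpow_half_sq (τ : ℍ) :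
    ((-Complex.I * τ) ^ (1 / 2 : ℂ)) ^ 2 = -Complex.I * τ := by
  rw [← Complex.cpow_nat_mul]
  simp

lemma coe_S_smul (τ : ℍ) : ((ModularGroup.S • τ : ℍ) : ℂ) = -1 / τ := by
  rw [modular_S_smul]
  simp [neg_div, inv_neg]

/-- Up to a shift of `z`, this is the functional equation of `jacobiTheta₂`. -/
lemma theta_S_smul (τ : ℍ) (z : ℂ) :
    theta (ModularGroup.S • τ) (z / τ) = -Complex.I * (-Complex.I * τ) ^ (1 / 2 : ℂ) *
      Complex.exp (Real.pi * Complex.I * (z ^ 2 / τ)) * theta τ z := by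
  have h0 : (τ : ℂ) ≠ 0 := ne_zero τ
  have hw : (-Complex.I * τ) ^ (1 / 2 : ℂ) ≠ 0 := fun h => by
    have := neg_I_mul_cpow_half_sq τ
    rw [h] at this
    simp [h0] at this
  have h1 := jacobiTheta₂_functional_equation (z - 1 / 2 + τ / 2) τ
  have h2 := jacobiTheta₂_add_left (z - 1 / 2 + τ / 2) τ
  rw [show z - 1 / 2 + (τ : ℂ) / 2 + 1 = z + τ / 2 + 1 / 2 by ring] at h2
  have h3 : z / τ + (-1 / τ : ℂ) / 2 + 1 / 2 = (z - 1 / 2 + τ / 2) / τ := by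
    field_simp
    ring
  rw [theta_eq_jacobiTheta₂, theta_eq_jacobiTheta₂, coe_S_smul, h3, h2, h1]
  have h4 : Complex.exp (Real.pi * Complex.I * (-1 / τ / 4 + z / τ)) =
      -Complex.I * Complex.exp (Real.pi * Complex.I * (z ^ 2 / τ)) *
        (Complex.exp (Real.pi * Complex.I * (τ / 4 + z)) *
          Complex.exp (-Real.pi * Complex.I * (z - 1 / 2 + τ / 2) ^ 2 / τ)) := by
    rw [← Complex.exp_neg_pi_div_two_mul_I, ← Complex.exp_add, ← Complex.exp_add,
      ← Complex.exp_add]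
    congr 1
    field_simp
    ring
  rw [h4]
  field_simp

lemma eta_S_smul (τ : ℍ) :
    ModularForm.eta (ModularGroup.S • τ : ℍ) =
      (-Complex.I * τ) ^ (1 / 2 : ℂ) * ModularForm.eta τ := by
  have := ModularForm.eta_comp_eq_csqrt_I_inv τ.2
  rw [coe_S_smul, neg_I_mul_cpow_half]
  simpa [mul_assoc] using this

lemma eta_ne_zero (τ : ℍ) : ModularForm.eta τ ≠ 0 := ModularForm.eta_ne_zero τ.2

lemma phiNegOneHalf_S_smul (τ : ℍ) (z : ℂ) :
    phiNegOneHalf (ModularGroup.S • τ) (z / τ) =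
      (τ : ℂ) ^ (-1 : ℤ) * Complex.exp (Real.pi * Complex.I * (z ^ 2 / τ)) *
        phiNegOneHalf τ z := by
  have h0 : (τ : ℂ) ≠ 0 := ne_zero τ
  have hw := neg_I_mul_cpow_half_sq τ
  rw [phiNegOneHalf, phiNegOneHalf, theta_S_smul, eta_S_smul]
  set w := (-Complex.I * τ) ^ (1 / 2 : ℂ)
  have hw0 : w ≠ 0 := fun h => by
    rw [h] at hw
    simp [h0] at hw
  have := eta_ne_zero τ
  rw [zpow_neg_one, mul_pow, pow_succ w 2, hw]
  field_simp

lemma coe_negOnePow_eq_zpow (j : ℤ) : ((j.negOnePow : ℤ) : ℂ) = (-1) ^ j := by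
  rcases Int.even_or_odd j with h | h
  · simp [Int.negOnePow_even j h, h.neg_one_zpow]
  · simp [Int.negOnePow_odd j h, h.neg_one_zpow]

/-- The coefficients of `q ^ (-1 / 8) * ϑ`. -/
lemma hasIntegralExpansion_theta :
    HasIntegralExpansion 1
      (fun n r => if 8 * (n : ℤ) + 1 = r ^ 2 then (((r - 1) / 2).negOnePow : ℤ) else 0)
      (fun τ z => theta τ z / Function.Periodic.qParam 8 τ) := by
  refine ⟨fun n r h => ?_, fun τ z => ?_⟩
  · have h1 : 8 * (n : ℤ) + 1 = r ^ 2 := by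
      by_contra h'
      simp [h'] at h
    have h2 : Odd (r ^ 2) := by rw [← h1]; exact ⟨4 * n, by ring⟩
    exact ((Int.odd_pow' two_ne_zero).mp h2).sub_odd odd_one
  · have hn : ∀ j : ℤ, 0 ≤ j * (j + 1) / 2 := fun j => by
      have : 0 ≤ j * (j + 1) := by nlinarith [sq_nonneg (2 * j + 1)]
      omega
    have hd : ∀ j : ℤ, 2 * (j * (j + 1) / 2) = j * (j + 1) := fun j =>
      Int.mul_ediv_cancel' (Int.even_mul_succ_self j).two_dvd
    have hn2 : ∀ j : ℤ, (((j * (j + 1) / 2).toNat : ℕ) : ℤ) = j * (j + 1) / 2 := fun j =>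
      Int.toNat_of_nonneg (hn j)
    have hinj : Function.Injective fun j : ℤ => ((j * (j + 1) / 2).toNat, 2 * j + 1) :=
      fun i j h => by
        have := congrArg Prod.snd h
        dsimp only at this
        omega
    refine (hinj.hasSum_iff fun p hp => ?_).mp ?_
    · obtain ⟨n, r⟩ := p
      dsimp only
      rw [if_neg, Int.cast_zero, zero_mul]
      intro h1
      have h2 : Odd (r ^ 2) := by rw [← h1]; exact ⟨4 * n, by ring⟩
      obtain ⟨j, rfl⟩ := (Int.odd_pow' two_ne_zero).mp h2
      refine hp ⟨j, ?_⟩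
      have h3 := hn2 j
      have h4 := hd j
      have h5 : 4 * (j * (j + 1)) = 8 * (n : ℤ) := by linarith
      ext
      · dsimp only; omega
      · rfl
    · refine (congrArg (HasSum · _) (funext fun j => ?_)).mpr
        ((hasSum_theta τ z).div_const (Function.Periodic.qParam 8 τ))
      have h3 := hd j
      have h4 : 2 * ((((j * (j + 1) / 2).toNat : ℕ)) : ℂ) = j * (j + 1) := by
        rw [← hn2] at h3
        exact_mod_cast h3
      simp only [Function.comp_apply]
      rw [if_pos (by rw [hn2]; linear_combination 4 * h3), thetaTerm,
        show (2 * j + 1 - 1) / 2 = j by omega, qyMonomial, Function.Periodic.qParam, mul_div_assoc,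
        ← Complex.exp_sub]
      congr 1
      · exact coe_negOnePow_eq_zpow j
      · congr 1
        push_cast
        linear_combination (Real.pi * Complex.I * τ) * h4

lemma exists_hasExpansion_phiNegOneHalf :
    ∃ F, HasExpansion 1 F phiNegOneHalf ∧ F.coeff 0 = T 1 - T (-1) := by
  obtain ⟨F, hF, hF'⟩ := hasIntegralExpansion_theta.exists_hasExpansion
  refine ⟨_, (congrArg₂ (fun N φ => HasExpansion N _ φ) (by simp) ?_).mp
    (hF'.mul (hasExpansion_inv_eulerProduct.pow 3)), ?_⟩
  · ext τ z
    have h : Function.Periodic.qParam 8 (τ : ℂ) = Function.Periodic.qParam 24 (τ : ℂ) ^ 3 := by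
      rw [Function.Periodic.qParam, Function.Periodic.qParam, ← Complex.exp_nat_mul]
      congr 1
      push_cast
      ring
    simp only [Pi.mul_apply, Pi.pow_apply, phiNegOneHalf, eta_eq, mul_pow, h, inv_pow,
      div_eq_mul_inv, mul_inv]
    ring
  · have h1 : (PowerSeries.map LaurentPolynomial.C pentagonalSeriesInv).coeff 0 = 1 := by
      rw [PowerSeries.coeff_map, PowerSeries.coeff_zero_eq_constantCoeff_apply,
        constantCoeff_pentagonalSeriesInv, map_one]
    rw [PowerSeries.coeff_zero_eq_constantCoeff_apply] at h1 ⊢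
    rw [map_mul, map_pow, h1, one_pow, mul_one, ← PowerSeries.coeff_zero_eq_constantCoeff_apply]
    refine LaurentPolynomial.ext fun r => ?_
    have hr : ∀ n : ℤ, (T n : LaurentPolynomial ℤ).coeff r = if n = r then 1 else 0 := fun n =>
      Finsupp.single_apply
    rw [hF, AddMonoidAlgebra.coeff_sub, Finsupp.sub_apply, hr, hr]
    by_cases h2 : r = 1
    · simp [h2]
    by_cases h3 : r = -1
    · simp [h3, Int.negOnePow_odd]
    rw [if_neg, if_neg (Ne.symm h2), if_neg (Ne.symm h3), sub_zero]
    intro h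
    have h4 : (r - 1) * (r + 1) = 0 := by
      push_cast at h
      linarith
    rcases mul_eq_zero.mp h4 with h5 | h5 <;> omega

lemma phiNegOneHalf_mem_JZ : phiNegOneHalf ∈ JZ (-1) 1 := by
  obtain ⟨F, hF, -⟩ := exists_hasExpansion_phiNegOneHalf
  refine hF.mem_JZ (fun τ z => ?_) fun l m τ z => ?_
  · rw [phiNegOneHalf_S_smul]
    congr 3
    push_cast
    ring
  · rw [phiNegOneHalf, phiNegOneHalf, theta_add, one_mul, mul_div_assoc]
    congr 3
    push_cast
    ring

/-! ### The product expansion of the theta-series -/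

/-- The exponential factor in the transformation law under the translations of `z`. -/
noncomputable def ellipticFactor (N l m : ℤ) (τ : ℍ) (z : ℂ) : ℂ :=
  (-1) ^ (N * (l + m)) * Complex.exp (-(2 * Real.pi * Complex.I * ((N : ℂ) / 2) *
    ((l : ℂ) ^ 2 * τ + 2 * l * z)))

lemma ellipticFactor_ne_zero (N l m : ℤ) (τ : ℍ) (z : ℂ) : ellipticFactor N l m τ z ≠ 0 :=
  mul_ne_zero (zpow_ne_zero _ (by norm_num)) (Complex.exp_ne_zero _)

section JZ

variable {k N : ℤ} {φ : ℍ → ℂ → ℂ}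

lemma exists_hasExpansion (hφ : φ ∈ JZ k N) : ∃ F, HasExpansion N F φ := by
  obtain ⟨-, a, ha⟩ := hφ
  obtain ⟨F, -, hF⟩ := ha.exists_hasExpansion
  exact ⟨F, hF⟩

lemma apply_add_lattice (hφ : φ ∈ JZ k N) (l m : ℤ) (τ : ℍ) (z : ℂ) :
    φ τ (z + l * τ + m) = ellipticFactor N l m τ z * φ τ z := hφ.1.elliptic l m τ z

lemma apply_lattice_eq_zero (hφ : φ ∈ JZ k N) (h0 : ∀ τ, φ τ 0 = 0) (l m : ℤ) (τ : ℍ) :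
    φ τ (l * τ + m) = 0 := by
  have := apply_add_lattice hφ l m τ 0
  rwa [zero_add, h0, mul_zero] at this

lemma apply_neg (hφ : φ ∈ JZ k N) (τ : ℍ) (z : ℂ) : φ τ (-z) = (-1) ^ k * φ τ z := by
  have := hφ.1.modular (-1) τ z
  simpa [div_neg] using this

lemma apply_zero_of_odd (hφ : φ ∈ JZ k N) (hk : Odd k) (τ : ℍ) : φ τ 0 = 0 := by
  have := apply_neg hφ τ 0
  rw [neg_zero, hk.neg_one_zpow] at this
  linear_combination (1 / 2 : ℂ) * this

end JZ

/-- The product `∏ (1 - q ^ n * x)` over all `n ≥ 1`. -/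
noncomputable def qProduct (q x : ℂ) : ℂ := ∏' n : ℕ, (1 - q ^ (n + 1) * x)

section qProduct

variable {q : ℂ}

lemma summable_norm_qProduct (hq : ‖q‖ < 1) (x : ℂ) :
    Summable fun n : ℕ => ‖-(q ^ (n + 1) * x)‖ := by
  simp only [norm_neg, norm_mul, norm_pow]
  exact ((summable_nat_add_iff 1).mpr
    (summable_geometric_of_lt_one (norm_nonneg _) hq)).mul_right _

lemma qProduct_ne_zero (hq : ‖q‖ < 1) {x : ℂ} (hx : ∀ n : ℕ, q ^ (n + 1) * x ≠ 1) :
    qProduct q x ≠ 0 := by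
  simp only [qProduct, sub_eq_add_neg]
  refine tprod_one_add_ne_zero_of_summable (fun n => ?_) (summable_norm_qProduct hq x)
  rw [← sub_eq_add_neg]
  exact sub_ne_zero.mpr (hx n).symm

lemma qProduct_eq (hq : ‖q‖ < 1) (x : ℂ) : qProduct q x = (1 - q * x) * qProduct q (q * x) := by
  have h : ∀ x, Multipliable fun n : ℕ => 1 - q ^ (n + 1) * x := fun x => by
    simp only [sub_eq_add_neg]
    exact multipliable_one_add_of_summable (summable_norm_qProduct hq x)
  rw [qProduct, tprod_eq_zero_mul' (by
    refine (h (q * x)).congr fun n => ?_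
    ring)]
  rw [qProduct, zero_add, pow_one]
  congr 2
  ext n
  ring

lemma differentiable_qProduct (hq : ‖q‖ < 1) : Differentiable ℂ (qProduct q) := by
  rw [← differentiableOn_univ]
  have h : HasProdLocallyUniformlyOn (fun (n : ℕ) x => 1 - q ^ (n + 1) * x) (qProduct q)
      Set.univ := by
    have hA : qProduct q = fun x => ∏' n : ℕ, (1 + -(q ^ (n + 1) * x)) := by
      ext x; simp only [qProduct, sub_eq_add_neg]
    rw [hA]
    simp_rw [sub_eq_add_neg]
    refine hasProdLocallyUniformlyOn_of_forall_compact isOpen_univ fun K _ hK => ?_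
    obtain ⟨C, hC⟩ := hK.isBounded.exists_norm_le
    exact (((summable_nat_add_iff 1).mpr
      (summable_geometric_of_lt_one (norm_nonneg _) hq)).mul_right C).hasProdUniformlyOn_nat_one_add
      hK (f := fun n x => -(q ^ (n + 1) * x)) (.of_forall fun n x hx => by
        rw [norm_neg, norm_mul, norm_pow]
        gcongr
        exact hC x hx) (fun _ => by fun_prop)
  exact h.differentiableOn (.of_forall fun _ => by
    simpa [Finset.prod_fn] using DifferentiableOn.finsetProd (fun _ _ => by fun_prop)) isOpen_univ

end qProduct

/-- The function `y ^ (1 / 2) * ∏ (1 - q ^ n * y) * (1 - q ^ (n - 1) * y⁻¹)`, the product over all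
`n ≥ 1`; up to a factor depending on `τ` only, it is the product expansion of `ϑ`. -/
noncomputable def thetaProduct (τ : ℍ) (z : ℂ) : ℂ :=
  (Complex.exp (Real.pi * Complex.I * z) - Complex.exp (-(Real.pi * Complex.I * z))) *
    (qProduct (Complex.exp (2 * Real.pi * Complex.I * τ))
        (Complex.exp (2 * Real.pi * Complex.I * z)) *
      qProduct (Complex.exp (2 * Real.pi * Complex.I * τ))
        (Complex.exp (-(2 * Real.pi * Complex.I * z))))

lemma norm_exp_two_pi_I_lt_one (τ : ℍ) : ‖Complex.exp (2 * Real.pi * Complex.I * τ)‖ < 1 := by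
  have := Function.Periodic.norm_qParam_lt_one one_pos τ.2
  simpa [Function.Periodic.qParam] using this

lemma differentiable_thetaProduct (τ : ℍ) : Differentiable ℂ (thetaProduct τ) := by
  have := differentiable_qProduct (norm_exp_two_pi_I_lt_one τ)
  unfold thetaProduct
  fun_prop

lemma thetaProduct_add_one (τ : ℍ) (z : ℂ) : thetaProduct τ (z + 1) = -thetaProduct τ z := by
  have h1 : Complex.exp (Real.pi * Complex.I * (z + 1)) =
      -Complex.exp (Real.pi * Complex.I * z) := by
    rw [mul_add, Complex.exp_add, mul_one, Complex.exp_pi_mul_I]; ring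
  have h2 : Complex.exp (2 * Real.pi * Complex.I * (z + 1)) =
      Complex.exp (2 * Real.pi * Complex.I * z) := by
    rw [mul_add, Complex.exp_add, mul_one, Complex.exp_two_pi_mul_I]; ring
  simp only [thetaProduct, Complex.exp_neg, h1, h2, inv_neg]
  ring

lemma thetaProduct_add_self (τ : ℍ) (z : ℂ) : thetaProduct τ (z + τ) =
    -Complex.exp (-(Real.pi * Complex.I * (τ + 2 * z))) * thetaProduct τ z := by
  have hq := norm_exp_two_pi_I_lt_one τ
  have e2 : ∀ z : ℂ, Complex.exp (2 * Real.pi * Complex.I * z) =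
      Complex.exp (Real.pi * Complex.I * z) ^ 2 := fun z => by
    rw [← Complex.exp_nat_mul]; congr 1; push_cast; ring
  have h1 : Complex.exp (-(Real.pi * Complex.I * (τ + 2 * z))) =
      (Complex.exp (Real.pi * Complex.I * τ))⁻¹ *
        (Complex.exp (Real.pi * Complex.I * z) ^ 2)⁻¹ := by
    rw [← e2, ← Complex.exp_neg, ← Complex.exp_neg, ← Complex.exp_add]; congr 1; ring
  have h2 : Complex.exp (Real.pi * Complex.I * (z + τ)) =
      Complex.exp (Real.pi * Complex.I * z) * Complex.exp (Real.pi * Complex.I * τ) := by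
    rw [← Complex.exp_add]; congr 1; ring
  simp only [thetaProduct, Complex.exp_neg] at h1 ⊢
  rw [h1]
  simp only [e2, h2] at hq ⊢
  set t := Complex.exp (Real.pi * Complex.I * τ)
  set w := Complex.exp (Real.pi * Complex.I * z)
  have ht : t ≠ 0 := Complex.exp_ne_zero _
  have hw : w ≠ 0 := Complex.exp_ne_zero _
  have h3 := qProduct_eq hq (w ^ 2)
  have h4 := qProduct_eq hq (((w * t) ^ 2)⁻¹)
  rw [show t ^ 2 * ((w * t) ^ 2)⁻¹ = (w ^ 2)⁻¹ by field_simp] at h4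
  rw [show t ^ 2 * w ^ 2 = (w * t) ^ 2 by ring] at h3
  rw [h3, h4]
  field_simp
  ring

lemma exists_lattice_of_exp_eq_one {z : ℂ} (h : Complex.exp (2 * Real.pi * Complex.I * z) = 1) :
    ∃ m : ℤ, z = m := by
  obtain ⟨m, hm⟩ := Complex.exp_eq_one_iff.mp h
  refine ⟨m, mul_left_cancel₀ Complex.two_pi_I_ne_zero (hm.trans (mul_comm _ _))⟩

lemma exists_lattice_of_thetaProduct_eq_zero {τ : ℍ} {z : ℂ} (h : thetaProduct τ z = 0) :
    ∃ l m : ℤ, z = l * τ + m := by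
  by_contra! hz
  have hne : ∀ l : ℤ, Complex.exp (2 * Real.pi * Complex.I * (z + l * τ)) ≠ 1 := fun l hl => by
    obtain ⟨m, hm⟩ := exists_lattice_of_exp_eq_one hl
    refine hz (-l) m ?_
    push_cast
    linear_combination hm
  refine mul_ne_zero ?_ (mul_ne_zero ?_ ?_) h
  · intro h1
    refine hne 0 ?_
    have h2 : Complex.exp (2 * Real.pi * Complex.I * (z + (0 : ℤ) * τ)) =
        Complex.exp (Real.pi * Complex.I * z) / Complex.exp (-(Real.pi * Complex.I * z)) := by
      rw [← Complex.exp_sub]; congr 1; push_cast; ring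
    rw [h2, sub_eq_zero.mp h1, div_self (Complex.exp_ne_zero _)]
  · refine qProduct_ne_zero (norm_exp_two_pi_I_lt_one τ) fun n h1 => hne (n + 1) ?_
    rw [← h1, ← Complex.exp_nat_mul, ← Complex.exp_add]
    congr 1; push_cast; ring
  · refine qProduct_ne_zero (norm_exp_two_pi_I_lt_one τ) fun n h1 => hne (-(n + 1)) ?_
    rw [← inv_eq_one, ← h1, ← Complex.exp_neg, ← Complex.exp_nat_mul, ← Complex.exp_add]
    congr 1; push_cast; ring

lemma deriv_thetaProduct_zero_ne_zero (τ : ℍ) : deriv (thetaProduct τ) 0 ≠ 0 := by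
  have hq := norm_exp_two_pi_I_lt_one τ
  have hd := differentiable_qProduct hq
  have h1 : qProduct (Complex.exp (2 * Real.pi * Complex.I * τ)) 1 ≠ 0 :=
    qProduct_ne_zero hq fun n h => by
      have := congrArg norm h
      rw [mul_one, norm_pow, norm_one] at this
      exact (pow_lt_one₀ (norm_nonneg _) hq n.succ_ne_zero).ne this
  have h2 : HasDerivAt (fun z : ℂ => Complex.exp (Real.pi * Complex.I * z) -
      Complex.exp (-(Real.pi * Complex.I * z))) (2 * Real.pi * Complex.I) 0 := by
    have h3 : HasDerivAt (fun z : ℂ => Real.pi * Complex.I * z) (Real.pi * Complex.I) 0 := by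
      simpa using (hasDerivAt_id (0 : ℂ)).const_mul (Real.pi * Complex.I)
    refine (h3.cexp.sub h3.neg.cexp).congr_deriv ?_
    rw [Pi.neg_apply, mul_zero, neg_zero, Complex.exp_zero]
    ring
  have h3 : DifferentiableAt ℂ (fun z : ℂ =>
    qProduct (Complex.exp (2 * Real.pi * Complex.I * τ))
        (Complex.exp (2 * Real.pi * Complex.I * z)) *
      qProduct (Complex.exp (2 * Real.pi * Complex.I * τ))
        (Complex.exp (-(2 * Real.pi * Complex.I * z)))) 0 := by
    fun_prop
  have h4 := (h2.mul h3.hasDerivAt).deriv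
  have h5 : deriv (thetaProduct τ) 0 = _ := h4
  rw [h5]
  simp [h1, Complex.I_ne_zero, Real.pi_ne_zero]

/-! ### The zeros of the theta-series -/

/-- Liouville's theorem for doubly periodic functions. -/
lemma apply_eq_apply_of_periodic {h : ℂ → ℂ} (hd : Differentiable ℂ h) (τ : ℍ)
    (h1 : Function.Periodic h 1) (h2 : Function.Periodic h τ) (z w : ℂ) : h z = h w := by
  refine hd.apply_eq_apply_of_bounded ?_ z w
  have hK : IsCompact ((fun p : ℝ × ℝ => h (p.1 * τ + p.2)) ''
      (Set.Icc (0 : ℝ) 1 ×ˢ Set.Icc (0 : ℝ) 1)) := by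
    refine (isCompact_Icc.prod isCompact_Icc).image ?_
    exact hd.continuous.comp (by fun_prop)
  refine hK.isBounded.subset ?_
  rintro _ ⟨z, rfl⟩
  have him : (τ : ℂ).im ≠ 0 := τ.2.ne'
  set a : ℝ := z.im / (τ : ℂ).im with ha
  set b : ℝ := z.re - a * (τ : ℂ).re with hb
  have hz : z = a * τ + b := by
    apply Complex.ext
    · simp [hb]
    · simpa [ha] using (div_mul_cancel₀ _ him).symm
  refine ⟨(Int.fract a, Int.fract b), ⟨⟨Int.fract_nonneg _, (Int.fract_lt_one _).le⟩,
    ⟨Int.fract_nonneg _, (Int.fract_lt_one _).le⟩⟩, ?_⟩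
  have h3 := h2.int_mul ⌊a⌋ ((Int.fract a : ℝ) * τ + (Int.fract b : ℝ))
  have h4 := h1.int_mul ⌊b⌋ ((Int.fract a : ℝ) * τ + (Int.fract b : ℝ) + ⌊a⌋ * τ)
  dsimp only
  rw [← h3, ← h4, hz]
  congr 1
  have e : ∀ a : ℝ, (a : ℂ) = (⌊a⌋ : ℂ) + (Int.fract a : ℝ) := fun a => by
    conv_lhs => rw [← Int.floor_add_fract a]
    push_cast; rfl
  rw [e a, e b]
  ring

lemma phiNegOneHalf_zero (τ : ℍ) : phiNegOneHalf τ 0 = 0 :=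
  apply_zero_of_odd phiNegOneHalf_mem_JZ ⟨-1, rfl⟩ τ

lemma differentiable_of_mem_JZ {k N : ℤ} {φ : ℍ → ℂ → ℂ} (hφ : φ ∈ JZ k N) (τ : ℍ) :
    Differentiable ℂ (φ τ) := by
  obtain ⟨F, hF⟩ := exists_hasExpansion hφ
  exact hF.differentiable τ

lemma phiNegOneHalf_add_one (τ : ℍ) (z : ℂ) :
    phiNegOneHalf τ (z + 1) = -phiNegOneHalf τ z := by
  simpa [ellipticFactor] using apply_add_lattice phiNegOneHalf_mem_JZ 0 1 τ z

lemma phiNegOneHalf_add_self (τ : ℍ) (z : ℂ) : phiNegOneHalf τ (z + τ) =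
    -Complex.exp (-(Real.pi * Complex.I * (τ + 2 * z))) * phiNegOneHalf τ z := by
  have := apply_add_lattice phiNegOneHalf_mem_JZ 1 0 τ z
  simp only [ellipticFactor, Int.cast_one, Int.cast_zero, one_mul, add_zero, zpow_one, one_pow,
    mul_one] at this
  rw [this]
  congr 3
  ring_nf

/-- Both functions have the same behaviour under the translations by `1` and `τ`, and the left-hand
side vanishes at the zeros of the product, which are simple. So their quotient extends to an entire
doubly periodic function, which is constant. -/
lemma exists_phiNegOneHalf_eq_mul_thetaProduct (τ : ℍ) :
    ∃ c, ∀ z, phiNegOneHalf τ z = c * thetaProduct τ z := by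
  set φ := phiNegOneHalf τ
  set g := thetaProduct τ
  set c := deriv φ 0 / deriv g 0 with hc
  have hφd : Differentiable ℂ φ := differentiable_of_mem_JZ phiNegOneHalf_mem_JZ τ
  have hgd : Differentiable ℂ g := differentiable_thetaProduct τ
  have hφ0 : φ 0 = 0 := phiNegOneHalf_zero τ
  have hg0 : g 0 = 0 := by simp [g, thetaProduct]
  have hg' : deriv g 0 ≠ 0 := deriv_thetaProduct_zero_ne_zero τ
  classical
  let h : ℂ → ℂ := fun z => if g z = 0 then c else φ z / g z
  have hper1 : Function.Periodic h 1 := fun z => by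
    simp only [h, g, φ, thetaProduct_add_one, phiNegOneHalf_add_one, neg_eq_zero, neg_div_neg_eq]
  have hperτ : Function.Periodic h τ := fun z => by
    have he : -Complex.exp (-(Real.pi * Complex.I * (τ + 2 * z))) ≠ 0 :=
      neg_ne_zero.mpr (Complex.exp_ne_zero _)
    simp only [h, g, φ, thetaProduct_add_self, phiNegOneHalf_add_self, mul_eq_zero, he, false_or,
      mul_div_mul_left _ _ he]
  have hdiff : ∀ z, g z ≠ 0 → DifferentiableAt ℂ h z := fun z hz => by
    refine ((hφd z).div (hgd z) hz).congr_of_eventuallyEq ?_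
    filter_upwards [(hgd z).continuousAt.eventually_ne hz] with w hw
    simp only [h, if_neg hw, Pi.div_apply]
  have hev : ∀ᶠ z in 𝓝[≠] (0 : ℂ), g z ≠ 0 := by
    have := (hgd 0).hasDerivAt.eventually_ne hg' (c := 0)
    exact this
  have hcont : ContinuousAt h 0 := by
    rw [continuousAt_iff_punctured_nhds]
    have h1 := hasDerivAt_iff_tendsto_slope.mp (hφd 0).hasDerivAt
    have h2 := hasDerivAt_iff_tendsto_slope.mp (hgd 0).hasDerivAt
    have h3 := h1.div h2 hg'
    rw [show h 0 = c by simp [h, hg0]]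
    refine h3.congr' ?_
    filter_upwards [hev, self_mem_nhdsWithin] with z hz hz0
    have hz0 : z ≠ 0 := hz0
    simp only [Pi.div_apply, slope_def_field, hφ0, hg0, sub_zero, h, if_neg hz]
    field_simp
  have h0 : DifferentiableAt ℂ h 0 :=
    (Complex.analyticAt_of_differentiable_on_punctured_nhds_of_continuousAt
      (hev.mono hdiff) hcont).differentiableAt
  -- every zero of `g` is a translate of `0` by periods of `h`
  have hd : Differentiable ℂ h := fun z => by
    by_cases hz : g z = 0
    · obtain ⟨l, m, rfl⟩ := exists_lattice_of_thetaProduct_eq_zero hz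
      have h3 : h = fun z => h (z - (l * τ + m)) := by
        ext z
        have e1 := hperτ.int_mul l (z - (l * τ + m))
        have e2 := hper1.int_mul m (z - (l * τ + m) + l * τ)
        rw [← e1, ← e2]
        congr 1
        ring
      rw [h3]
      refine DifferentiableAt.comp (g := h) (f := fun z : ℂ => z - (l * (τ : ℂ) + m)) _ ?_
        (by fun_prop)
      rwa [sub_self]
    · exact hdiff z hz
  refine ⟨c, fun z => ?_⟩
  have h4 := apply_eq_apply_of_periodic hd τ hper1 hperτ z 0
  rw [show h 0 = c by simp [h, hg0]] at h4
  by_cases hz : g z = 0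
  · rw [hz, mul_zero]
    obtain ⟨l, m, rfl⟩ := exists_lattice_of_thetaProduct_eq_zero hz
    exact apply_lattice_eq_zero phiNegOneHalf_mem_JZ phiNegOneHalf_zero l m τ
  · simp only [h, if_neg hz] at h4
    rw [← h4, div_mul_cancel₀ _ hz]

/-- The function does not vanish identically in `z`, as its mean over `[0, 1]` is `1`. -/
lemma exists_jacobiTheta₂_ne_zero (τ : ℍ) : ∃ z, jacobiTheta₂ z τ ≠ 0 := by
  by_contra! h
  have h1 : HasSum (fun n : ℤ => ∫ x in (0 : ℝ)..1, jacobiTheta₂_term n x τ)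
      (∫ x in (0 : ℝ)..1, jacobiTheta₂ x τ) := by
    refine intervalIntegral.hasSum_integral_of_dominated_convergence
      (fun n _ => ‖jacobiTheta₂_term n 0 τ‖) (fun n => ?_) (fun n => ?_) ?_ ?_ ?_
    · refine Continuous.aestronglyMeasurable ?_
      unfold jacobiTheta₂_term
      fun_prop
    · refine .of_forall fun x _ => ?_
      simp [norm_jacobiTheta₂_term]
    · exact .of_forall fun x _ => (hasSum_jacobiTheta₂_term 0 τ.2).summable.norm
    · simp
    · exact .of_forall fun x _ => hasSum_jacobiTheta₂_term x τ.2
  have h2 : ∀ n : ℤ, n ≠ 0 → ∫ x in (0 : ℝ)..1, jacobiTheta₂_term n x τ = 0 := fun n hn => by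
    have h3 : (2 * Real.pi * Complex.I * n : ℂ) ≠ 0 :=
      mul_ne_zero Complex.two_pi_I_ne_zero (Int.cast_ne_zero.mpr hn)
    have h4 : ∀ x : ℝ, jacobiTheta₂_term n x τ =
        Complex.exp (2 * Real.pi * Complex.I * n * x) *
          Complex.exp (Real.pi * Complex.I * n ^ 2 * τ) := fun x => by
      rw [jacobiTheta₂_term, Complex.exp_add]
    simp_rw [h4]
    rw [intervalIntegral.integral_mul_const, integral_exp_mul_complex h3]
    have : Complex.exp (2 * Real.pi * Complex.I * n) = 1 :=
      Complex.exp_eq_one_iff.mpr ⟨n, by ring⟩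
    simp [this]
  have h5 := (hasSum_single (0 : ℤ) h2).unique h1
  simp [h, jacobiTheta₂_term] at h5

lemma exists_phiNegOneHalf_ne_zero (τ : ℍ) : ∃ z, phiNegOneHalf τ z ≠ 0 := by
  obtain ⟨z, hz⟩ := exists_jacobiTheta₂_ne_zero τ
  refine ⟨z - (τ / 2 + 1 / 2), ?_⟩
  rw [phiNegOneHalf, theta_eq_jacobiTheta₂]
  refine div_ne_zero (mul_ne_zero (Complex.exp_ne_zero _) ?_) (pow_ne_zero _ (eta_ne_zero τ))
  convert hz using 2
  ring

lemma exists_lattice_of_phiNegOneHalf_eq_zero {τ : ℍ} {z : ℂ} (h : phiNegOneHalf τ z = 0) :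
    ∃ l m : ℤ, z = l * τ + m := by
  obtain ⟨c, hc⟩ := exists_phiNegOneHalf_eq_mul_thetaProduct τ
  obtain ⟨w, hw⟩ := exists_phiNegOneHalf_ne_zero τ
  refine exists_lattice_of_thetaProduct_eq_zero (τ := τ) ?_
  rw [hc] at h hw
  exact (mul_eq_zero.mp h).resolve_left (left_ne_zero_of_mul hw)

lemma deriv_phiNegOneHalf_zero_ne_zero (τ : ℍ) : deriv (phiNegOneHalf τ) 0 ≠ 0 := by
  obtain ⟨c, hc⟩ := exists_phiNegOneHalf_eq_mul_thetaProduct τ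
  obtain ⟨w, hw⟩ := exists_phiNegOneHalf_ne_zero τ
  rw [hc] at hw
  rw [show phiNegOneHalf τ = fun z => c * thetaProduct τ z from funext hc,
    deriv_const_mul_field]
  exact mul_ne_zero (left_ne_zero_of_mul hw) (deriv_thetaProduct_zero_ne_zero τ)

lemma deriv_phiNegOneHalf_ne_zero {τ : ℍ} {z : ℂ} (h : phiNegOneHalf τ z = 0) :
    deriv (phiNegOneHalf τ) z ≠ 0 := by
  obtain ⟨l, m, rfl⟩ := exists_lattice_of_phiNegOneHalf_eq_zero h
  have hd := differentiable_of_mem_JZ phiNegOneHalf_mem_JZ τ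
  have h1 : HasDerivAt (fun z => phiNegOneHalf τ (z + (l * τ + m)))
      (deriv (phiNegOneHalf τ) (l * τ + m)) 0 := by
    have h2 : HasDerivAt (phiNegOneHalf τ) (deriv (phiNegOneHalf τ) (l * τ + m))
      (0 + (l * τ + m)) := by rw [zero_add]; exact (hd _).hasDerivAt
    exact h2.comp_add_const 0 (l * (τ : ℂ) + m)
  have h2 : (fun z => phiNegOneHalf τ (z + (l * τ + m))) =
      fun z => ellipticFactor 1 l m τ z * phiNegOneHalf τ z := by
    ext z
    rw [← add_assoc, apply_add_lattice phiNegOneHalf_mem_JZ]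
  have h3 : DifferentiableAt ℂ (ellipticFactor 1 l m τ) 0 := by
    unfold ellipticFactor
    fun_prop
  rw [h2] at h1
  rw [h1.unique (h3.hasDerivAt.mul (hd 0).hasDerivAt), phiNegOneHalf_zero, mul_zero, zero_add]
  exact mul_ne_zero (ellipticFactor_ne_zero _ _ _ _ _) (deriv_phiNegOneHalf_zero_ne_zero τ)

/-! ### Division of Jacobi forms -/

lemma jacobiFactor_add (k k' N N' : ℤ) (γ : SL(2, ℤ)) (τ : ℍ) (z : ℂ) :
    jacobiFactor (k + k') (N + N') γ τ z = jacobiFactor k N γ τ z * jacobiFactor k' N' γ τ z := by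
  rw [jacobiFactor, zpow_add₀ (cocycle_ne_zero γ τ), show ((N + N' : ℤ) : ℂ) / 2 = (N : ℂ) / 2 +
    (N' : ℂ) / 2 by push_cast; ring, mul_add, add_mul, Complex.exp_add, jacobiFactor, jacobiFactor]
  ring

lemma ellipticFactor_add (N N' l m : ℤ) (τ : ℍ) (z : ℂ) :
    ellipticFactor (N + N') l m τ z = ellipticFactor N l m τ z * ellipticFactor N' l m τ z := by
  rw [ellipticFactor, add_mul, zpow_add₀ (by norm_num), show ((N + N' : ℤ) : ℂ) / 2 = (N : ℂ) / 2 +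
    (N' : ℂ) / 2 by push_cast; ring, mul_add _ ((N : ℂ) / 2),
    add_mul (2 * Real.pi * Complex.I * ((N : ℂ) / 2)), neg_add, Complex.exp_add, ellipticFactor,
    ellipticFactor]
  ring

lemma apply_smul {k N : ℤ} {φ : ℍ → ℂ → ℂ} (hφ : φ ∈ JZ k N) (γ : SL(2, ℤ)) (τ : ℍ) (z : ℂ) :
    φ (γ • τ) (z / cocycle γ τ) = jacobiFactor k N γ τ z * φ τ z := hφ.1.modular γ τ z

/-- Simple zeros are isolated, so continuous functions which agree off the simple zeros of `h` agree
everywhere. -/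
lemma eq_of_eq_of_ne_zero {f g h : ℂ → ℂ} (hf : Continuous f) (hg : Continuous g)
    (hh : ∀ z, h z = 0 → deriv h z ≠ 0) (hfg : ∀ z, h z ≠ 0 → f z = g z) : f = g := by
  ext z
  by_cases hz : h z = 0
  · have hd : DifferentiableAt ℂ h z := by
      by_contra hd
      exact hh z hz (deriv_zero_of_not_differentiableAt hd)
    have h1 : ∀ᶠ w in 𝓝[≠] z, h w ≠ 0 := hd.hasDerivAt.eventually_ne (hh z hz)
    have h2 : Tendsto f (𝓝[≠] z) (𝓝 (f z)) := hf.continuousAt.tendsto.mono_left nhdsWithin_le_nhds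
    have h3 : Tendsto g (𝓝[≠] z) (𝓝 (g z)) := hg.continuousAt.tendsto.mono_left nhdsWithin_le_nhds
    exact tendsto_nhds_unique (h2.congr' (h1.mono fun w hw => hfg w hw)) h3
  · exact hfg z hz

/-- A quotient of integral weak Jacobi forms is again one, if the numerator vanishes at the zeros
of the denominator, which are simple, and the `q ^ 0`-term of the denominator is
`y ^ (s / 2) - y ^ (-s / 2)`. -/
theorem exists_eq_mul_of_hasSimpleLinearZeros {k k' N M : ℤ} {φ ψ : ℍ → ℂ → ℂ}
    {G : PowerSeries (LaurentPolynomial ℤ)} (hφ : φ ∈ JZ k N) (hψ : ψ ∈ JZ k' M)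
    (hG : HasExpansion M G ψ) (hz : HasSimpleLinearZeros φ ψ) {s : ℕ} (hs : 0 < s)
    (hG0 : G.coeff 0 = T (s : ℤ) - T (-(s : ℤ)))
    (hφ0 : ∀ (τ : ℍ) (j : ℕ), φ τ ((j : ℂ) / s) = 0)
    (hψ0 : ∀ (τ : ℍ) (j : ℕ), ψ τ ((j : ℂ) / s) = 0) :
    ∃ χ ∈ JZ (k - k') (N - M), φ = ψ * χ := by
  obtain ⟨F, hF⟩ := exists_hasExpansion hφ
  obtain ⟨H, hH⟩ := exists_hasExpansion_extendedQuotient hF hG hz hs hG0 hφ0 hψ0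
  set χ := extendedQuotient φ ψ
  have hmul : ∀ τ z, φ τ z = ψ τ z * χ τ z := mul_extendedQuotient hz
  have hcont : ∀ τ, Continuous (χ τ) := fun τ => (hH.differentiable τ).continuous
  refine ⟨χ, ⟨⟨hH.differentiableOn, fun γ τ => ?_, fun l m τ => ?_, _, hH⟩, _, hH⟩,
    funext fun τ => funext fun z => hmul τ z⟩
  · refine congrFun (eq_of_eq_of_ne_zero (f := fun z => χ (γ • τ) (z / cocycle γ τ))
      (g := fun z => jacobiFactor (k - k') (N - M) γ τ z * χ τ z)
      ((hcont _).comp (continuous_id.div_const _)) (Continuous.mul ?_ (hcont τ))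
      (hz.deriv_ne_zero τ) fun z hz0 => ?_)
    · unfold jacobiFactor
      fun_prop
    · have h1 := apply_smul hφ γ τ z
      have h2 := jacobiFactor_add (k - k') k' (N - M) M γ τ z
      rw [sub_add_cancel, sub_add_cancel] at h2
      rw [hmul, hmul τ z, apply_smul hψ, h2] at h1
      refine mul_left_cancel₀ (mul_ne_zero (jacobiFactor_ne_zero k' M γ τ z) hz0) ?_
      linear_combination h1
  · refine congrFun (eq_of_eq_of_ne_zero (f := fun z => χ τ (z + l * τ + m))
      (g := fun z => ellipticFactor (N - M) l m τ z * χ τ z)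
      ((hcont _).comp (by fun_prop)) (Continuous.mul ?_ (hcont τ))
      (hz.deriv_ne_zero τ) fun z hz0 => ?_)
    · unfold ellipticFactor
      fun_prop
    · have h1 := apply_add_lattice hφ l m τ z
      have h2 := ellipticFactor_add (N - M) M l m τ z
      rw [sub_add_cancel] at h2
      rw [hmul, hmul τ z, apply_add_lattice hψ, h2] at h1
      refine mul_left_cancel₀ (mul_ne_zero (ellipticFactor_ne_zero M l m τ z) hz0) ?_
      linear_combination h1

theorem exists_eq_phiNegOneHalf_mul {k N : ℤ} {φ : ℍ → ℂ → ℂ} (hφ : φ ∈ JZ k N)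
    (h0 : ∀ τ, φ τ 0 = 0) : ∃ χ ∈ JZ (k + 1) (N - 1), φ = phiNegOneHalf * χ := by
  obtain ⟨G, hG, hG0⟩ := exists_hasExpansion_phiNegOneHalf
  have hj : ∀ {k N : ℤ} {φ : ℍ → ℂ → ℂ}, φ ∈ JZ k N → (∀ τ, φ τ 0 = 0) →
      ∀ (τ : ℍ) (j : ℕ), φ τ ((j : ℂ) / (1 : ℕ)) = 0 := fun hφ h0 τ j => by
    simpa using apply_lattice_eq_zero hφ h0 0 j τ
  refine exists_eq_mul_of_hasSimpleLinearZeros (k' := -1) hφ phiNegOneHalf_mem_JZ hG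
    ⟨fun τ z hz => ?_, fun τ z => deriv_phiNegOneHalf_ne_zero⟩ one_pos hG0 (hj hφ h0)
    (hj phiNegOneHalf_mem_JZ phiNegOneHalf_zero)
  obtain ⟨l, m, rfl⟩ := exists_lattice_of_phiNegOneHalf_eq_zero hz
  exact ⟨l, m, by push_cast; rfl, fun τ' => ⟨by simpa using apply_lattice_eq_zero hφ h0 l m τ',
    by simpa using apply_lattice_eq_zero phiNegOneHalf_mem_JZ phiNegOneHalf_zero l m τ'⟩⟩

lemma HasExpansion.comp_two_mul {N : ℤ} {F : PowerSeries (LaurentPolynomial ℤ)} {φ : ℍ → ℂ → ℂ}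
    (hF : HasExpansion N F φ) : ∃ G, HasExpansion (4 * N) G (fun τ z => φ τ (2 * z)) ∧
      ∀ z, evalExp z (G.coeff 0) = evalExp (2 * z) (F.coeff 0) := by
  have h : HasIntegralExpansion (4 * N)
      (fun n r => if Even r then (F.coeff n).coeff (r / 2) else 0) (fun τ z => φ τ (2 * z)) := by
    refine ⟨fun n r hr => ?_, fun τ z => ?_⟩
    · have h1 : Even r := by
        by_contra h1
        simp [h1] at hr
      exact h1.sub ⟨2 * N, by ring⟩
    · have hinj : Function.Injective fun p : ℕ × ℤ => (p.1, 2 * p.2) := fun p p' hp => by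
        have h1 := congrArg Prod.fst hp
        have h2 := congrArg Prod.snd hp
        dsimp only at h1 h2
        ext
        · exact h1
        · omega
      refine (hinj.hasSum_iff fun p hp => ?_).mp ?_
      · have h1 : ¬ Even p.2 := by
          rintro ⟨r, hr⟩
          exact hp ⟨(p.1, r), Prod.ext rfl ((two_mul r).trans hr.symm)⟩
        dsimp only
        rw [if_neg h1, Int.cast_zero, zero_mul]
      · refine (congrArg (HasSum · _) (funext fun p => ?_)).mpr (hF.2 τ (2 * z))
        simp only [Function.comp_apply, even_two_mul, if_true, qyMonomial]
        rw [Int.mul_ediv_cancel_left _ two_ne_zero]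
        congr 3
        push_cast
        ring
  obtain ⟨G, -, hG⟩ := h.exists_hasExpansion
  exact ⟨G, hG, fun z =>
    tendsto_nhds_unique (hG.tendsto_atImInfty z) (hF.tendsto_atImInfty (2 * z))⟩

lemma comp_two_mul_mem_JZ {k N : ℤ} {φ : ℍ → ℂ → ℂ} (hφ : φ ∈ JZ k N) :
    (fun τ z => φ τ (2 * z)) ∈ JZ k (4 * N) := by
  obtain ⟨F, hF⟩ := exists_hasExpansion hφ
  obtain ⟨G, hG, -⟩ := hF.comp_two_mul
  refine ⟨⟨hG.differentiableOn, fun γ τ z => ?_, fun l m τ z => ?_, _, hG⟩, _, hG⟩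
  · have h := apply_smul hφ γ τ (2 * z)
    rw [mul_div_assoc] at h
    refine h.trans ?_
    rw [jacobiFactor, cocycle]
    congr 3
    push_cast
    ring
  · have h := apply_add_lattice hφ (2 * l) (2 * m) τ (2 * z)
    have e : 2 * (z + l * τ + m) = 2 * z + (2 * l : ℤ) * τ + (2 * m : ℤ) := by push_cast; ring
    rw [e, h, ellipticFactor, Even.neg_one_zpow ⟨N * (l + m), by ring⟩,
      Even.neg_one_zpow ⟨2 * N * (l + m), by ring⟩]
    congr 3
    push_cast
    ring

/-- A form of odd weight and integral index is odd in `z` and vanishes at the half-periods: the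
elliptic law relates its values at `w` and `-w` by the factor `1` if `2 w` is a lattice point. -/
lemma apply_half_lattice_eq_zero {k N : ℤ} {φ : ℍ → ℂ → ℂ} (hφ : φ ∈ JZ k N) (hk : Odd k)
    (hN : Even N) (l m : ℤ) (τ : ℍ) : φ τ ((l : ℂ) / 2 * τ + m / 2) = 0 := by
  obtain ⟨M, rfl⟩ := hN
  set w : ℂ := (l : ℂ) / 2 * τ + m / 2 with hw
  have h1 := apply_add_lattice hφ l m τ (-w)
  have h2 : ellipticFactor (M + M) l m τ (-w) = 1 := by
    rw [ellipticFactor, Even.neg_one_zpow ⟨M * (l + m), by ring⟩, one_mul]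
    refine Complex.exp_eq_one_iff.mpr ⟨M * l * m, ?_⟩
    rw [hw]
    push_cast
    ring
  rw [show -w + l * τ + m = w by rw [hw]; ring, h2, one_mul, apply_neg hφ, hk.neg_one_zpow] at h1
  linear_combination (1 / 2 : ℂ) * h1

lemma evalExp_T_sub_T_two (z : ℂ) : evalExp (2 * z) (T 1 - T (-1)) =
    evalExp z (T ((2 : ℕ) : ℤ) - T (-((2 : ℕ) : ℤ))) := by
  simp only [map_sub, evalExp_T]
  congr 2 <;> (push_cast; ring)

theorem exists_eq_phiNegOneHalf_two_mul_mul {k N : ℤ} {φ : ℍ → ℂ → ℂ} (hφ : φ ∈ JZ k N)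
    (hk : Odd k) (hN : Even N) :
    ∃ χ ∈ JZ (k + 1) (N - 4), φ = (fun τ z => phiNegOneHalf τ (2 * z)) * χ := by
  obtain ⟨F, hF, hF0⟩ := exists_hasExpansion_phiNegOneHalf
  obtain ⟨G, hG, hG0⟩ := hF.comp_two_mul
  have h4 := comp_two_mul_mem_JZ phiNegOneHalf_mem_JZ
  have hj : ∀ {k N : ℤ} {φ : ℍ → ℂ → ℂ}, φ ∈ JZ k N → Odd k → Even N →
      ∀ (τ : ℍ) (j : ℕ), φ τ ((j : ℂ) / (2 : ℕ)) = 0 := fun hφ hk hN τ j => by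
    simpa using apply_half_lattice_eq_zero hφ hk hN 0 j τ
  refine exists_eq_mul_of_hasSimpleLinearZeros (k' := -1) hφ h4 hG
    ⟨fun τ z hz => ?_, fun τ z hz => ?_⟩ two_pos ?_ (hj hφ hk hN)
    (hj h4 ⟨-1, rfl⟩ ⟨2, rfl⟩)
  · obtain ⟨l, m, h⟩ := exists_lattice_of_phiNegOneHalf_eq_zero hz
    refine ⟨l / 2, m / 2, by push_cast; linear_combination h / 2, fun τ' => ⟨?_, ?_⟩⟩
    · simpa using apply_half_lattice_eq_zero hφ hk hN l m τ'
    · simpa using apply_half_lattice_eq_zero h4 ⟨-1, rfl⟩ ⟨2, rfl⟩ l m τ'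
  · rw [deriv_comp_mul_left]
    exact smul_ne_zero two_ne_zero (deriv_phiNegOneHalf_ne_zero hz)
  · refine evalExp_injective fun z _ => ?_
    rw [hG0, hF0, evalExp_T_sub_T_two]

lemma exists_phiNegOneHalf_two_mul_eq :
    ∃ χ ∈ JZ 0 3, (fun τ z => phiNegOneHalf τ (2 * z)) = phiNegOneHalf * χ :=
  exists_eq_phiNegOneHalf_mul (comp_two_mul_mem_JZ phiNegOneHalf_mem_JZ) fun τ => by
    simpa using phiNegOneHalf_zero τ

lemma eventually_phiNegOneHalf_ne_zero (τ : ℍ) (z : ℂ) : ∀ᶠ w in 𝓝[≠] z, phiNegOneHalf τ w ≠ 0 := by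
  have hd := differentiable_of_mem_JZ phiNegOneHalf_mem_JZ τ z
  by_cases hz : phiNegOneHalf τ z = 0
  · exact hd.hasDerivAt.eventually_ne (deriv_phiNegOneHalf_ne_zero hz)
  · exact nhdsWithin_le_nhds (hd.continuousAt.eventually_ne hz)

lemma tendsto_theta_div {χ : ℍ → ℂ → ℂ} (hχ : χ ∈ JZ 0 3)
    (h : (fun τ z => phiNegOneHalf τ (2 * z)) = phiNegOneHalf * χ) (τ : ℍ) (z : ℂ) :
    Tendsto (fun w => theta τ (2 * w) / theta τ w) (𝓝[≠] z) (𝓝 (χ τ z)) := by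
  have h1 : Tendsto (χ τ) (𝓝[≠] z) (𝓝 (χ τ z)) :=
    (differentiable_of_mem_JZ hχ τ z).continuousAt.tendsto.mono_left nhdsWithin_le_nhds
  refine h1.congr' ?_
  filter_upwards [eventually_phiNegOneHalf_ne_zero τ z] with w hw
  have h2 : phiNegOneHalf τ (2 * w) = phiNegOneHalf τ w * χ τ w := congrFun (congrFun h τ) w
  have h3 : ModularForm.eta τ ^ 3 ≠ 0 := pow_ne_zero 3 (eta_ne_zero τ)
  rw [eq_comm, ← div_div_div_cancel_right₀ h3]
  exact (div_eq_iff hw).mpr (h2.trans (mul_comm _ _))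

/-- The limit in the definition of `φ_{0, 3/2}` is the value of the quotient of
`φ_{-1, 1/2} (τ, 2 z)` by `φ_{-1, 1/2} (τ, z)`, which is a Jacobi form and so continuous. -/
lemma phiZeroThreeHalves_mem_JZ_and_mul_eq : phiZeroThreeHalves ∈ JZ 0 3 ∧
    (fun τ z => phiNegOneHalf τ (2 * z)) = phiNegOneHalf * phiZeroThreeHalves := by
  obtain ⟨χ, hχ, h⟩ := exists_phiNegOneHalf_two_mul_eq
  have : phiZeroThreeHalves = χ :=
    funext fun τ => funext fun z => (tendsto_theta_div hχ h τ z).limUnder_eq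
  rw [this]
  exact ⟨hχ, h⟩

lemma tendsto_phiZeroThreeHalves (τ : ℍ) (z : ℂ) :
    Tendsto (fun w => theta τ (2 * w) / theta τ w) (𝓝[≠] z) (𝓝 (phiZeroThreeHalves τ z)) :=
  tendsto_theta_div phiZeroThreeHalves_mem_JZ_and_mul_eq.1
    phiZeroThreeHalves_mem_JZ_and_mul_eq.2 τ z

theorem JZ_even_eq (k m : ℤ) : (JZ (2 * k) (2 * m + 1) : Set (ℍ → ℂ → ℂ)) =
    (fun ψ => phiZeroThreeHalves * ψ) '' (JZ (2 * k) (2 * (m - 1)) : Set (ℍ → ℂ → ℂ)) := by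
  obtain ⟨h1, h2⟩ := phiZeroThreeHalves_mem_JZ_and_mul_eq
  refine Set.Subset.antisymm (fun φ (hφ : φ ∈ JZ _ _) => ?_) ?_
  · -- `φ_{-1, 1/2} * φ` has odd weight and integral index, hence is a multiple of
    -- `φ_{-1, 1/2} (τ, 2 z)`, which is `φ_{-1, 1/2} * φ_{0, 3/2}`
    have h3 := mul_mem_JZ phiNegOneHalf_mem_JZ hφ
    obtain ⟨χ, hχ, h⟩ := exists_eq_phiNegOneHalf_two_mul_mul h3 ⟨k - 1, by ring⟩ ⟨m + 1, by ring⟩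
    rw [show -1 + 2 * k + 1 = 2 * k by ring, show 1 + (2 * m + 1) - 4 = 2 * (m - 1) by ring] at hχ
    refine ⟨χ, hχ, funext fun τ => eq_of_eq_of_ne_zero (h := phiNegOneHalf τ) ?_ ?_
      (fun z => deriv_phiNegOneHalf_ne_zero) fun z hz => ?_⟩
    · exact (differentiable_of_mem_JZ h1 τ).continuous.mul
        (differentiable_of_mem_JZ hχ τ).continuous
    · exact (differentiable_of_mem_JZ hφ τ).continuous
    · rw [h2] at h
      have h4 := congrFun (congrFun h τ) z
      simp only [Pi.mul_apply] at h4 ⊢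
      refine mul_left_cancel₀ hz ?_
      rw [h4, mul_assoc]
  · rintro _ ⟨χ, hχ, rfl⟩
    have := mul_mem_JZ h1 (show χ ∈ JZ _ _ from hχ)
    rwa [zero_add, show 3 + 2 * (m - 1) = 2 * m + 1 by ring] at this

theorem JZ_odd_eq (k m : ℤ) : (JZ (2 * k + 1) (2 * m + 1) : Set (ℍ → ℂ → ℂ)) =
    (fun ψ => phiNegOneHalf * ψ) '' (JZ (2 * k + 2) (2 * m) : Set (ℍ → ℂ → ℂ)) := by
  refine Set.Subset.antisymm (fun φ (hφ : φ ∈ JZ _ _) => ?_) ?_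
  · obtain ⟨χ, hχ, h⟩ := exists_eq_phiNegOneHalf_mul hφ (apply_zero_of_odd hφ ⟨k, rfl⟩)
    rw [show 2 * k + 1 + 1 = 2 * k + 2 by ring, show 2 * m + 1 - 1 = 2 * m by ring] at hχ
    exact ⟨χ, hχ, h.symm⟩
  · rintro _ ⟨χ, hχ, rfl⟩
    have := mul_mem_JZ phiNegOneHalf_mem_JZ (show χ ∈ JZ _ _ from hχ)
    rwa [show -1 + (2 * k + 2) = 2 * k + 1 by ring, show 1 + 2 * m = 2 * m + 1 by ring] at this

/-! ### Weight zero forms without constant term -/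

open scoped ModularForm in
/-- At `z = 0` a Jacobi form is a modular form of the same weight, which is zero if the weight is
negative. -/
lemma apply_zero_of_neg {k N : ℤ} {φ : ℍ → ℂ → ℂ} (hφ : φ ∈ JZ k N) (hk : k < 0) (τ : ℍ) :
    φ τ 0 = 0 := by
  obtain ⟨F, hF⟩ := exists_hasExpansion hφ
  have hq := hF.hasQExpansion 0
  have hslash : ∀ γ : SL(2, ℤ), (fun τ => φ τ 0) ∣[k] γ = fun τ => φ τ 0 := fun γ => by
    ext τ
    have h := apply_smul hφ γ τ 0
    have hc : denom γ τ = cocycle γ τ := ModularGroup.denom_apply γ τ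
    simp only [zero_div, jacobiFactor, ne_eq, OfNat.ofNat_ne_zero, not_false_eq_true, zero_pow,
      mul_zero, Complex.exp_zero, mul_one] at h
    rw [ModularForm.SL_slash_apply, h, hc, mul_right_comm, ← zpow_add₀ (cocycle_ne_zero γ τ),
      add_neg_cancel, zpow_zero, one_mul]
  let f : ModularForm 𝒮ℒ k :=
    { toFun := fun τ => φ τ 0
      slash_action_eq' := fun A hA => by
        obtain ⟨A, rfl⟩ := hA
        exact hslash A
      holo' := hq.mdiff
      bdd_at_cusps' := fun hc => by
        rw [Subgroup.IsArithmetic.isCusp_iff_isCusp_SL2Z] at hc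
        rw [OnePoint.isBoundedAt_iff_forall_SL2Z hc]
        intro γ _
        rw [hslash γ]
        exact hq.bdd }
  exact congrFun (ModularFormClass.levelOne_neg_weight_eq_zero hk f) τ

lemma phiNegOneHalf_pow_mem_JZ (n : ℕ) : phiNegOneHalf ^ n ∈ JZ (-n) n := by
  induction n with
  | zero => simpa using one_mem_JZ
  | succ n ih =>
    have := mul_mem_JZ ih phiNegOneHalf_mem_JZ
    rwa [pow_succ, Nat.cast_succ, neg_add]

lemma exists_eq_phiNegOneHalf_pow_mul (n : ℕ) {N : ℤ} {φ : ℍ → ℂ → ℂ} (hφ : φ ∈ JZ (-n) N) :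
    ∃ χ ∈ JZ 0 (N - n), φ = phiNegOneHalf ^ n * χ := by
  induction n generalizing N φ with
  | zero => exact ⟨φ, by simpa using hφ, by simp⟩
  | succ n ih =>
    obtain ⟨χ, hχ, rfl⟩ := exists_eq_phiNegOneHalf_mul hφ
      (apply_zero_of_neg hφ (by push_cast; omega))
    rw [show -((n + 1 : ℕ) : ℤ) + 1 = -(n : ℤ) by push_cast; ring] at hχ
    obtain ⟨ω, hω, rfl⟩ := ih hχ
    refine ⟨ω, ?_, by rw [pow_succ']; ring⟩
    convert hω using 2
    push_cast
    ring

lemma discriminant_eq (τ : ℍ) :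
    ModularForm.discriminant τ = Function.Periodic.qParam 1 τ * eulerProduct τ ^ 24 := by
  rw [ModularForm.discriminant, eta_eq, mul_pow]
  congr 1
  rw [Function.Periodic.qParam, Function.Periodic.qParam, ← Complex.exp_nat_mul]
  congr 1
  push_cast
  ring

lemma discriminant_ne_zero (τ : ℍ) : ModularForm.discriminant τ ≠ 0 :=
  pow_ne_zero 24 (eta_ne_zero τ)

lemma discriminant_smul (γ : SL(2, ℤ)) (τ : ℍ) :
    ModularForm.discriminant (γ • τ) = cocycle γ τ ^ (12 : ℤ) * ModularForm.discriminant τ := by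
  have h := congrFun (SlashInvariantForm.slash_action_generators_SL2Z
    ModularForm.discriminant_S_invariant ModularForm.discriminant_T_invariant γ) τ
  have hc : denom γ τ = cocycle γ τ := ModularGroup.denom_apply γ τ
  have h0 := cocycle_ne_zero γ τ
  rw [ModularForm.SL_slash_apply, hc, zpow_neg] at h
  rw [← h]
  field_simp

lemma hasExpansion_discriminant :
    HasExpansion 0 (PowerSeries.X *
      (PowerSeries.map LaurentPolynomial.C (PowerSeries.pentagonalSeries ℤ)) ^ 24)
      (fun τ _ => ModularForm.discriminant τ) := by
  have h1 : HasExpansion 0 (PowerSeries.map LaurentPolynomial.C PowerSeries.X)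
      (fun τ _ => Function.Periodic.qParam 1 τ) := hasExpansion_of_hasSum fun τ => by
    have := hasSum_ite_eq (1 : ℕ) (Function.Periodic.qParam 1 (τ : ℂ))
    refine (congrArg (HasSum · _) (funext fun n => ?_)).mpr this
    by_cases hn : n = 1
    · simp [hn, PowerSeries.coeff_X]
    · simp [hn, PowerSeries.coeff_X]
  rw [PowerSeries.map_X] at h1
  have h2 := h1.mul (hasExpansion_eulerProduct.pow 24)
  rw [mul_zero, zero_add] at h2
  convert h2 using 1
  ext τ z
  exact discriminant_eq τ

lemma discriminant_mem_JZ : (fun τ _ => ModularForm.discriminant τ) ∈ JZ 12 0 := by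
  have h := hasExpansion_discriminant
  refine ⟨⟨h.differentiableOn, fun γ τ z => ?_, fun l m τ z => ?_, _, h⟩, _, h⟩
  · simpa [cocycle] using discriminant_smul γ τ
  · simp

/-- A form without `q ^ 0`-term is divisible by `Δ`: its expansion is divisible by `q`, and
`q / Δ` is the `-24`-th power of Euler's product. -/
lemma exists_eq_discriminant_mul {k N : ℤ} {φ : ℍ → ℂ → ℂ} (hφ : φ ∈ JZ k N)
    (h0 : NoQZeroTerm N φ) :
    ∃ χ ∈ JZ (k - 12) N, φ = (fun τ _ => ModularForm.discriminant τ) * χ := by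
  obtain ⟨a, ha0, ha⟩ := h0
  have h1 : HasIntegralExpansion N (fun n r => a (n + 1) r)
      (fun τ z => φ τ z / Function.Periodic.qParam 1 τ) := by
    refine ⟨fun n r => ha.1 (n + 1) r, fun τ z => ?_⟩
    have hinj : Function.Injective fun p : ℕ × ℤ => (p.1 + 1, p.2) := fun p p' hp => by
      have h1 := congrArg Prod.fst hp
      have h2 := congrArg Prod.snd hp
      exact Prod.ext (Nat.succ_injective h1) h2
    have h2 := (hinj.hasSum_iff (f := fun p : ℕ × ℤ => (a p.1 p.2 : ℂ) * qyMonomial p.1 p.2 τ z)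
      fun p hp => by
        obtain ⟨n, r⟩ := p
        have : n = 0 := by
          by_contra hn
          exact hp ⟨(n - 1, r), Prod.ext (Nat.succ_pred hn) rfl⟩
        dsimp only
        rw [this, ha0, Int.cast_zero, zero_mul]).mpr (ha.2 τ z)
    refine (congrArg (HasSum · _) (funext fun p => ?_)).mpr
      (h2.div_const (Function.Periodic.qParam 1 τ))
    simp only [Function.comp_apply, qyMonomial, Function.Periodic.qParam, mul_div_assoc,
      ← Complex.exp_sub]
    congr 2
    push_cast
    ring
  obtain ⟨F, -, hF⟩ := h1.exists_hasExpansion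
  have h2 := hF.mul (hasExpansion_inv_eulerProduct.pow 24)
  rw [mul_zero, add_zero] at h2
  set χ : ℍ → ℂ → ℂ := fun τ z => φ τ z / ModularForm.discriminant τ with hχ
  have h3 : (fun τ z => φ τ z / Function.Periodic.qParam 1 τ) *
      (fun τ _ => (eulerProduct τ)⁻¹) ^ 24 = χ := by
    ext τ z
    simp only [hχ, Pi.mul_apply, Pi.pow_apply, discriminant_eq, inv_pow, div_eq_mul_inv, mul_inv]
    ring
  rw [h3] at h2
  refine ⟨χ, ⟨⟨h2.differentiableOn, fun γ τ z => ?_, fun l m τ z => ?_, _, h2⟩, _, h2⟩, ?_⟩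
  · have h4 := apply_smul hφ γ τ z
    have h5 := cocycle_ne_zero γ τ
    have h6 := discriminant_ne_zero τ
    change χ (γ • τ) (z / cocycle γ τ) = jacobiFactor (k - 12) N γ τ z * χ τ z
    simp only [hχ]
    rw [h4, discriminant_smul, jacobiFactor, jacobiFactor, zpow_sub₀ h5]
    field_simp
  · have h4 := apply_add_lattice hφ l m τ z
    change χ τ (z + l * τ + m) = ellipticFactor N l m τ z * χ τ z
    simp only [hχ]
    rw [h4, mul_div_assoc]
  · ext τ z
    exact (mul_div_cancel₀ _ (discriminant_ne_zero τ)).symm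

lemma xiZeroSix_eq (τ : ℍ) (z : ℂ) :
    xiZeroSix τ z = ModularForm.discriminant τ * phiNegOneHalf τ z ^ 12 := by
  have := eta_ne_zero τ
  rw [xiZeroSix, phiNegOneHalf, ModularForm.discriminant]
  field_simp

lemma xiZeroSix_eq_mul :
    xiZeroSix = (fun τ _ => ModularForm.discriminant τ) * phiNegOneHalf ^ 12 :=
  funext fun τ => funext fun z => xiZeroSix_eq τ z

lemma xiZeroSix_mem_JZ0 : xiZeroSix ∈ JZ0 6 := by
  rw [xiZeroSix_eq_mul]
  exact mul_mem_JZ discriminant_mem_JZ (phiNegOneHalf_pow_mem_JZ 12)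

lemma exists_hasExpansion_xiZeroSix : ∃ F : PowerSeries (LaurentPolynomial ℤ),
    HasExpansion (2 * 6) F xiZeroSix ∧ F.coeff 0 = 0 ∧ F.coeff 1 = (T 1 - T (-1)) ^ 12 := by
  obtain ⟨F, hF, hF0⟩ := exists_hasExpansion_phiNegOneHalf
  have h := hasExpansion_discriminant.mul (hF.pow 12)
  rw [← xiZeroSix_eq_mul, mul_assoc] at h
  refine ⟨_, h, by simp, ?_⟩
  have h1 : (PowerSeries.map LaurentPolynomial.C (PowerSeries.pentagonalSeries ℤ)).constantCoeff =
      1 := by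
    rw [← PowerSeries.coeff_zero_eq_constantCoeff_apply, PowerSeries.coeff_map,
      PowerSeries.coeff_zero_eq_constantCoeff_apply, constantCoeff_pentagonalSeries, map_one]
  rw [PowerSeries.coeff_zero_eq_constantCoeff_apply] at hF0
  rw [← zero_add 1, PowerSeries.coeff_succ_X_mul, PowerSeries.coeff_zero_eq_constantCoeff_apply,
    map_mul, map_pow, map_pow, h1, hF0, one_pow, one_mul]

lemma noQZeroTerm_xiZeroSix : NoQZeroTerm (2 * 6) xiZeroSix := by
  obtain ⟨F, hF, h0, -⟩ := exists_hasExpansion_xiZeroSix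
  exact ⟨_, fun r => by rw [h0]; rfl, hF⟩

lemma exists_eq_mul_xiZeroSix {m : ℤ} {φ : ℍ → ℂ → ℂ} (hφ : φ ∈ JZ0 m)
    (h0 : NoQZeroTerm (2 * m) φ) : ∃ χ ∈ JZ0 (m - 6), φ = χ * xiZeroSix := by
  obtain ⟨χ, hχ, rfl⟩ := exists_eq_discriminant_mul hφ h0
  obtain ⟨ω, hω, rfl⟩ := exists_eq_phiNegOneHalf_pow_mul 12 hχ
  refine ⟨ω, ?_, by rw [xiZeroSix_eq_mul]; ring⟩
  rwa [JZ0, show 2 * (m - 6) = 2 * m - ((12 : ℕ) : ℤ) by push_cast; ring]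

theorem noQZeroIdeal_eq_span : noQZeroIdeal =
    Ideal.span {DirectSum.of (fun m : ℤ => JZ0 m) 6 ⟨xiZeroSix, xiZeroSix_mem_JZ0⟩} := by
  classical
  refine le_antisymm (fun x hx => ?_) ((Ideal.span_singleton_le_iff_mem _).mpr fun m => ?_)
  · rw [← DirectSum.sum_support_of x]
    refine Ideal.sum_mem _ fun m _ => ?_
    obtain ⟨χ, hχ, h⟩ := exists_eq_mul_xiZeroSix (x m).2 (hx m)
    refine Ideal.mem_span_singleton'.mpr ⟨DirectSum.of (fun m : ℤ => JZ0 m) (m - 6) ⟨χ, hχ⟩, ?_⟩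
    rw [DirectSum.of_mul_of]
    exact DirectSum.of_eq_of_gradedMonoid_eq (Sigma.subtype_ext (sub_add_cancel m 6) h.symm)
  · by_cases hm : m = 6
    · rw [hm, DirectSum.of_eq_same]
      exact noQZeroTerm_xiZeroSix
    · rw [DirectSum.of_eq_of_ne _ _ _ hm]
      exact NoQZeroTerm.zero _

end JacobiForms

theorem lemma2p1 :
    (∀ (τ : ℍ) (z : ℂ),
      Tendsto (fun w => JacobiForms.theta τ (2 * w) / JacobiForms.theta τ w) (𝓝[≠] z)
        (𝓝 (JacobiForms.phiZeroThreeHalves τ z))) ∧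
    (∀ k m : ℤ,
      (JacobiForms.JZ (2 * k) (2 * m + 1) : Set (ℍ → ℂ → ℂ)) =
        (fun ψ => JacobiForms.phiZeroThreeHalves * ψ) ''
          (JacobiForms.JZ (2 * k) (2 * (m - 1)) : Set (ℍ → ℂ → ℂ))) ∧
    (∀ k m : ℤ,
      (JacobiForms.JZ (2 * k + 1) (2 * m + 1) : Set (ℍ → ℂ → ℂ)) =
        (fun ψ => JacobiForms.phiNegOneHalf * ψ) ''
          (JacobiForms.JZ (2 * k + 2) (2 * m) : Set (ℍ → ℂ → ℂ))) ∧
    (∀ (τ : ℍ) (z : ℂ), JacobiForms.xiZeroSix τ z =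
      ModularForm.discriminant τ * JacobiForms.phiNegOneHalf τ z ^ 12) ∧
    (∃ a : ℕ → ℤ → ℤ, JacobiForms.HasIntegralExpansion (2 * 6) a JacobiForms.xiZeroSix ∧
      (∀ r : ℤ, a 0 r = 0) ∧
      ∀ r : ℤ, a 1 r =
        ((LaurentPolynomial.T 1 - LaurentPolynomial.T (-1)) ^ 12 : LaurentPolynomial ℤ).coeff r) ∧
    ∃ hξ : JacobiForms.xiZeroSix ∈ JacobiForms.JZ0 6,
      JacobiForms.noQZeroIdeal =
        Ideal.span {DirectSum.of (fun m : ℤ => JacobiForms.JZ0 m) 6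
          ⟨JacobiForms.xiZeroSix, hξ⟩} := by
  obtain ⟨F, hF, h0, h1⟩ := JacobiForms.exists_hasExpansion_xiZeroSix
  exact ⟨JacobiForms.tendsto_phiZeroThreeHalves, JacobiForms.JZ_even_eq, JacobiForms.JZ_odd_eq,
    JacobiForms.xiZeroSix_eq, ⟨_, hF, fun r => by rw [h0]; rfl, fun r => by rw [h1]⟩,
    JacobiForms.xiZeroSix_mem_JZ0, JacobiForms.noQZeroIdeal_eq_span⟩
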